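/- Let $n\ge 1$, let $a=(a_1,\dots,a_n)\in\mathbb{Q}^n$ with $a_1=0$ and $a_i>0$ for $i\ge 2$, let $\sum_{i=1}^n a_i<\frac1{12}$, and let $\varepsilon>0$ be a rational number such that every $a_i$ is an integer multiple of $\varepsilon$. Put $x_n=3\cdot 2^{n-1}-1$. Let $G$ be the following network, in which "cost; capacity" is given for every arc. Nodes: $s$, $t$, and for each sign $\pm$ the nodes $s_0^\pm,\dots,s_n^\pm$, $t_0^\pm,\dots,t_n^\pm$, $c^\pm$. Arcs: for each sign and each $i=1,\dots,n$ the arcs $(s_i^\pm,s_{i-1}^\pm)$ and $(t_{i-1}^\pm,t_i^\pm)$ with $\pm\frac12a_i;\ 3\cdot2^{i-1}$, the arc $(s_i^\pm,t_{i-1}^\pm)$ with $2^{i-1}-\frac13\mp\frac12a_i;\ 3\cdot2^{i-1}$, and the arc $(s_{i-1}^\pm,t_i^\pm)$ with $2^{i-1}-\frac23\mp\frac12a_i;\ 3\cdot2^{i-1}$; the arcs $(s_0^+,c^+)$ and $(c^-,t_0^-)$ with $0;\ 2$, and the arcs $(c^+,t_0^+)$ and $(s_0^-,c^-)$ with $\frac15\varepsilon;\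 2$; the arcs $(s,s_n^\pm)$ and $(t_n^\pm,t)$ with $0;\ \infty$; the arc $(s,t)$ with $2^{n+1};\ \infty$; and the arc $e=(c^+,c^-)$ with $0;\ \frac12$. Supplies: $4x_n+2$ at $s$, $1$ at $t_0^+$ and at $c^-$; demands: $4x_n+2$ at $t$, $1$ at $c^+$ and at $s_0^-$; all other nodes have supply $0$. The Network Simplex Algorithm maintains a spanning tree (the basis) and a feasible flow that is zero or equal to the capacity on every non-tree arc. The reduced cost of a residual non-tree arc is the cost of sending one unit of flow in its direction around the unique cycle that it closes with the tree. In each iteration, by Dantzig's rule, a residual non-tree arc of minimum reduced cost, if this is negative, enters the basis, as much flow as possible is sent around its cycle, and an arc of the cycle that has become tight (possibly the entering arc itself) leaves the basis. The algorithm stops when no residual non-tree arc has negative reduced cost. It is started with flow $4x_n$ on $(s,t)$, flow $1$ on the arcs $(s,s_n^\pm)$, $(t_n^\pm,t)$, $(s_i^\pm,s_{i-1}^\pm)$, $(t_{i-1}^\pm,t_i^\pm)$ ($1\le i\le n$), $(s_0^+,c^+)$, $(c^-,t_0^-)$, and flow $0$ on all other arcs; the initial basis consists of the arcs with initial flow at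 least $1$ just listed. Then, in every execution of the Network Simplex Algorithm with Dantzig's rule on $G$ (no matter how ties are broken), arc $e$ enters the basis in some iteration if and only if there is a set $I\subseteq\{1,\dots,n\}$ with $\sum_{i\in I}a_i=\sum_{i\notin I}a_i$. -/

import Mathlib

/-! ### Capacitated networks and the network simplex algorithm -/

/-- A network with node set `V` and arc set `E`: every arc `a` leads from `src a` to `dst a`, has a
cost and a capacity (`⊤` is an infinite capacity), every node has a supply (negative: a demand). -/
structure Network (V E : Type*) where
  src : E → V
  dst : E → V
  cost : E → ℚ
  cap : E → WithTop ℚ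
  supply : V → ℚ

namespace Network

variable {V E : Type*} [DecidableEq V] [Fintype E] [DecidableEq E]

/-- Flow leaving `v` minus flow entering `v`. -/
def netOut (N : Network V E) (f : E → ℚ) (v : V) : ℚ :=
  (∑ a : E, if N.src a = v then f a else 0) - ∑ a : E, if N.dst a = v then f a else 0

/-- Feasible flows: capacities are respected and all supplies and demands are met. -/
def IsFeasibleFlow (N : Network V E) (f : E → ℚ) : Prop :=
  (∀ a, 0 ≤ f a ∧ (f a : WithTop ℚ) ≤ N.cap a) ∧ ∀ v, N.netOut f v = N.supply v

/-- Two nodes are joined by an arc of `T`, in one direction or the other. -/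
def Joined (N : Network V E) (T : Finset E) (u v : V) : Prop :=
  ∃ a ∈ T, (N.src a = u ∧ N.dst a = v) ∨ (N.src a = v ∧ N.dst a = u)

/-- `T` is the arc set of a spanning tree: it connects all nodes, and it has `|V| - 1` arcs. -/
def IsSpanningTree [Fintype V] (N : Network V E) (T : Finset E) : Prop :=
  (∀ u v, Relation.ReflTransGen (N.Joined T) u v) ∧ T.card + 1 = Fintype.card V

/-- What the algorithm maintains: a basis (the arc set of a spanning tree) and a flow. -/
structure Configuration (E : Type*) where
  tree : Finset E
  flow : E → ℚ

/-- Basic feasible solutions: a spanning tree, and a feasible flow whose value on every arc outside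
the tree is either zero or the capacity of the arc. -/
def IsBasicFeasible [Fintype V] (N : Network V E) (σ : Configuration E) : Prop :=
  N.IsSpanningTree σ.tree ∧ N.IsFeasibleFlow σ.flow ∧
    ∀ a, a ∉ σ.tree → σ.flow a = 0 ∨ (σ.flow a : WithTop ℚ) = N.cap a

/-- A direction in which an arc can be traversed. -/
inductive Direction
  | forward
  | backward

/-- `+1` for forward, `-1` for backward. -/
def Direction.sign : Direction → ℚ
  | .forward => 1
  | .backward => -1

/-- The arc `a` is present in direction `d` in the residual network of the flow `f`. -/
def IsResidual (N : Network V E) (f : E → ℚ) (a : E) : Direction → Prop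
  | .forward => (f a : WithTop ℚ) < N.cap a
  | .backward => 0 < f a

/-- `χ` sends one unit of flow around the cycle that arises by adding the arc `a` to the tree `T`,
in direction `d` of `a`. If `T` is a spanning tree and `a ∉ T`, this is the unique circulation
supported on `T ∪ {a}` with the value `d.sign` on `a`; it is `1` on the arcs that the cycle traverses
forwards, `-1` on the arcs that it traverses backwards, and `0` elsewhere. -/
def IsCycleFlow (N : Network V E) (T : Finset E) (a : E) (d : Direction) (χ : E → ℚ) : Prop :=
  (∀ v, N.netOut χ v = 0) ∧ χ a = d.sign ∧ ∀ b, b ∉ insert a T → χ b = 0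

/-- The cost of the flow `χ`. For the cycle flow of a non-tree arc `a` in direction `d` this is the
reduced cost of the residual arc `(a, d)`. -/
def flowCost (N : Network V E) (χ : E → ℚ) : ℚ := ∑ a, N.cost a * χ a

/-- The arc `l` lies on the cycle of `χ` and is tight for the flow `f`: the cycle traverses it
forwards and it is saturated, or the cycle traverses it backwards and it is empty. -/
def IsTight (N : Network V E) (f χ : E → ℚ) (l : E) : Prop :=
  (0 < χ l ∧ (f l : WithTop ℚ) = N.cap l) ∨ (χ l < 0 ∧ f l = 0)

/-- One iteration of the network simplex algorithm with Dantzig's rule, from the configuration `σ`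
to the configuration `τ`, in which the arc `a` enters the basis. The residual non-tree arc `(a, d)`
has negative reduced cost, and no residual non-tree arc has a smaller one. As much flow `θ` as the
capacities allow is sent around the cycle, and one arc `l` of the cycle that has become tight leaves
the basis; `l = a` is possible, then `a` enters and immediately leaves the basis. Ties, for the
entering and for the leaving arc, may be broken arbitrarily. -/
def IsPivot (N : Network V E) (σ : Configuration E) (a : E) (τ : Configuration E) : Prop :=
  ∃ (d : Direction) (χ : E → ℚ) (θ : ℚ) (l : E),
    (a ∉ σ.tree ∧ N.IsResidual σ.flow a d ∧ N.IsCycleFlow σ.tree a d χ) ∧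
    N.flowCost χ < 0 ∧
    (∀ (b : E) (d' : Direction) (χ' : E → ℚ),
      b ∉ σ.tree → N.IsResidual σ.flow b d' → N.IsCycleFlow σ.tree b d' χ' →
        N.flowCost χ ≤ N.flowCost χ') ∧
    0 ≤ θ ∧
    τ.flow = (fun b => σ.flow b + θ * χ b) ∧
    (∀ b, 0 ≤ τ.flow b ∧ (τ.flow b : WithTop ℚ) ≤ N.cap b) ∧
    N.IsTight τ.flow χ l ∧
    τ.tree = (insert a σ.tree).erase l

/-- A complete execution of the algorithm from the initial configuration `σ₀`. Here `σ k` is the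
configuration before iteration `k`, and `enter k` is the arc that enters the basis in iteration `k`,
or `none` if the algorithm has stopped before. The algorithm stops only when no pivot is possible,
that is, when no residual non-tree arc has negative reduced cost (or the cost is unbounded below);
for convenience the sequence of configurations is then continued as a constant. -/
structure IsExecution (N : Network V E) (σ₀ : Configuration E)
    (σ : ℕ → Configuration E) (enter : ℕ → Option E) : Prop where
  start : σ 0 = σ₀
  step : ∀ k, (∃ a, enter k = some a ∧ N.IsPivot (σ k) a (σ (k + 1))) ∨
    (enter k = none ∧ (∀ a τ, ¬ N.IsPivot (σ k) a τ) ∧ σ (k + 1) = σ k)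

/-- A complete execution exists from every initial configuration. -/
theorem exists_isExecution (N : Network V E) (σ₀ : Configuration E) :
    ∃ σ enter, N.IsExecution σ₀ σ enter := by
  have h : ∀ ρ : Configuration E, ∃ (o : Option E) (τ : Configuration E),
      (∃ a, o = some a ∧ N.IsPivot ρ a τ) ∨ (o = none ∧ (∀ a τ, ¬ N.IsPivot ρ a τ) ∧ τ = ρ) := by
    intro ρ
    by_cases hp : ∃ a τ, N.IsPivot ρ a τ
    · obtain ⟨a, τ, hp⟩ := hp
      exact ⟨some a, τ, Or.inl ⟨a, rfl, hp⟩⟩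
    · exact ⟨none, ρ, Or.inr ⟨rfl, fun a τ h => hp ⟨a, τ, h⟩, rfl⟩⟩
  choose o next hnext using h
  exact ⟨fun k => next^[k] σ₀, fun k => o (next^[k] σ₀), rfl, fun k => by
    simpa only [Function.iterate_succ_apply'] using hnext (next^[k] σ₀)⟩

end Network

/-! ### The network built from a Partition instance -/

/-- The vector `a` splits into two parts of equal sum. -/
def HasPartition {n : ℕ} (a : Fin n → ℚ) : Prop :=
  ∃ I : Finset (Fin n), ∑ i ∈ I, a i = ∑ i ∈ Iᶜ, a i

namespace PartitionNetwork

open Network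

/-- The two gadgets, for the vector `a` (plus) and for the vector `-a` (minus). -/
inductive Side
  | plus
  | minus
deriving DecidableEq

instance : Fintype Side := ⟨{.plus, .minus}, fun g => by cases g <;> simp⟩

/-- The sign with which the vector `a` enters the gadget. -/
def Side.sign : Side → ℚ
  | .plus => 1
  | .minus => -1

/-- Nodes: the source, the sink, the nodes `s_i`, `t_i` (`0 ≤ i ≤ n`) and `c` of either gadget. -/
inductive Node (n : ℕ)
  | source
  | sink
  | s (g : Side) (i : Fin (n + 1))
  | t (g : Side) (i : Fin (n + 1))
  | c (g : Side)
deriving DecidableEq, Fintype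

/-- Arcs. For `i = 0, …, n - 1` the four arcs with index `i` are those of level `i + 1`. -/
inductive Arc (n : ℕ)
  /-- The arc `(s_{i+1}, s_i)`. -/
  | ss (g : Side) (i : Fin n)
  /-- The arc `(t_i, t_{i+1})`. -/
  | tt (g : Side) (i : Fin n)
  /-- The arc `(s_{i+1}, t_i)`. -/
  | outer (g : Side) (i : Fin n)
  /-- The arc `(s_i, t_{i+1})`. -/
  | inner (g : Side) (i : Fin n)
  /-- The arc `(s_0, c)`. -/
  | sc (g : Side)
  /-- The arc `(c, t_0)`. -/
  | ct (g : Side)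
  /-- The arc from the source to `s_n`. -/
  | feed (g : Side)
  /-- The arc from `t_n` to the sink. -/
  | drain (g : Side)
  /-- The arc from the source to the sink. -/
  | direct
  /-- The arc `(c⁺, c⁻)`. -/
  | e
deriving DecidableEq, Fintype

/-- The tail of an arc. -/
def arcSrc {n : ℕ} : Arc n → Node n
  | .ss g i => .s g i.succ
  | .tt g i => .t g i.castSucc
  | .outer g i => .s g i.succ
  | .inner g i => .s g i.castSucc
  | .sc g => .s g 0
  | .ct g => .c g
  | .feed _ => .source
  | .drain g => .t g (Fin.last n)
  | .direct => .source
  | .e => .c .plus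

/-- The head of an arc. -/
def arcDst {n : ℕ} : Arc n → Node n
  | .ss g i => .s g i.castSucc
  | .tt g i => .t g i.succ
  | .outer g i => .t g i.castSucc
  | .inner g i => .t g i.succ
  | .sc g => .c g
  | .ct g => .t g 0
  | .feed g => .s g (Fin.last n)
  | .drain _ => .sink
  | .direct => .sink
  | .e => .c .minus

/-- Costs, where the gadgets have the parameter `r`. -/
def arcCost {n : ℕ} (a : Fin n → ℚ) (ε r : ℚ) : Arc n → ℚ
  | .ss g i => g.sign * a i / 2
  | .tt g i => g.sign * a i / 2
  | .outer g i => 2 ^ (i : ℕ) - r - g.sign * a i / 2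
  | .inner g i => 2 ^ (i : ℕ) - (1 - r) - g.sign * a i / 2
  | .sc .plus => 0
  | .ct .plus => ε / 5
  | .sc .minus => ε / 5
  | .ct .minus => 0
  | .feed _ => 0
  | .drain _ => 0
  | .direct => 2 ^ (n + 1)
  | .e => 0

/-- Capacities; the arcs of level `i + 1` have capacity `3 * 2 ^ i`. -/
def arcCap {n : ℕ} : Arc n → WithTop ℚ
  | .ss _ i => ((3 * 2 ^ (i : ℕ) : ℚ) : WithTop ℚ)
  | .tt _ i => ((3 * 2 ^ (i : ℕ) : ℚ) : WithTop ℚ)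
  | .outer _ i => ((3 * 2 ^ (i : ℕ) : ℚ) : WithTop ℚ)
  | .inner _ i => ((3 * 2 ^ (i : ℕ) : ℚ) : WithTop ℚ)
  | .sc _ => ((2 : ℚ) : WithTop ℚ)
  | .ct _ => ((2 : ℚ) : WithTop ℚ)
  | .feed _ => ⊤
  | .drain _ => ⊤
  | .direct => ⊤
  | .e => ((1 / 2 : ℚ) : WithTop ℚ)

/-- The number `x_n = 3 * 2 ^ (n - 1) - 1`, for `n ≥ 1`. -/
def x (n : ℕ) : ℚ := 3 * 2 ^ (n - 1) - 1

/-- Supplies (demands are negative supplies). -/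
def nodeSupply {n : ℕ} : Node n → ℚ
  | .source => 4 * x n + 2
  | .sink => -(4 * x n + 2)
  | .c .plus => -1
  | .t .plus i => if i = 0 then 1 else 0
  | .s .plus _ => 0
  | .c .minus => 1
  | .t .minus _ => 0
  | .s .minus i => if i = 0 then -1 else 0

/-- The network with the two gadgets for `a` and `-a`, both with the parameter `r = 1 / 3`. -/
def network {n : ℕ} (a : Fin n → ℚ) (ε : ℚ) : Network (Node n) (Arc n) where
  src := arcSrc
  dst := arcDst
  cost := arcCost a ε (1 / 3)
  cap := arcCap
  supply := nodeSupply

/-- The initial flow. -/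
def initialFlow {n : ℕ} : Arc n → ℚ
  | .ss _ _ => 1
  | .tt _ _ => 1
  | .outer _ _ => 0
  | .inner _ _ => 0
  | .sc .plus => 1
  | .ct .plus => 0
  | .sc .minus => 0
  | .ct .minus => 1
  | .feed _ => 1
  | .drain _ => 1
  | .direct => 4 * x n
  | .e => 0

/-- The arcs of the initial basis. -/
def isInitialTreeArc {n : ℕ} : Arc n → Bool
  | .ss _ _ => true
  | .tt _ _ => true
  | .outer _ _ => false
  | .inner _ _ => false
  | .sc .plus => true
  | .ct .plus => false
  | .sc .minus => false
  | .ct .minus => true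
  | .feed _ => true
  | .drain _ => true
  | .direct => true
  | .e => false

/-- The initial configuration. -/
def initial (n : ℕ) : Configuration (Arc n) where
  tree := Finset.univ.filter (fun a => isInitialTreeArc a = true)
  flow := initialFlow

theorem sum_side {M : Type*} [AddCommMonoid M] (F : Side → M) :
    ∑ g, F g = F .plus + F .minus := by
  have h : (Finset.univ : Finset Side) = {.plus, .minus} := rfl
  rw [h, Finset.sum_pair (by decide)]

/-- The arcs, family by family. -/
def arcEquiv (n : ℕ) : Arc n ≃ ((Side × Fin n) ⊕ (Side × Fin n) ⊕ (Side × Fin n) ⊕ (Side × Fin n)) ⊕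
    (Side ⊕ Side ⊕ Side ⊕ Side) ⊕ (Unit ⊕ Unit) where
  toFun
    | .ss g i => .inl (.inl (g, i))
    | .tt g i => .inl (.inr (.inl (g, i)))
    | .outer g i => .inl (.inr (.inr (.inl (g, i))))
    | .inner g i => .inl (.inr (.inr (.inr (g, i))))
    | .sc g => .inr (.inl (.inl g))
    | .ct g => .inr (.inl (.inr (.inl g)))
    | .feed g => .inr (.inl (.inr (.inr (.inl g))))
    | .drain g => .inr (.inl (.inr (.inr (.inr g))))
    | .direct => .inr (.inr (.inl ()))
    | .e => .inr (.inr (.inr ()))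
  invFun
    | .inl (.inl (g, i)) => .ss g i
    | .inl (.inr (.inl (g, i))) => .tt g i
    | .inl (.inr (.inr (.inl (g, i)))) => .outer g i
    | .inl (.inr (.inr (.inr (g, i)))) => .inner g i
    | .inr (.inl (.inl g)) => .sc g
    | .inr (.inl (.inr (.inl g))) => .ct g
    | .inr (.inl (.inr (.inr (.inl g)))) => .feed g
    | .inr (.inl (.inr (.inr (.inr g)))) => .drain g
    | .inr (.inr (.inl ())) => .direct
    | .inr (.inr (.inr ())) => .e
  left_inv := by rintro (_ | _) <;> rfl
  right_inv := by rintro ((⟨_, _⟩ | ⟨_, _⟩ | ⟨_, _⟩ | ⟨_, _⟩) | (_ | _ | _ | _) | (_ | _)) <;> rfl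

theorem sum_arc {M : Type*} [AddCommMonoid M] {n : ℕ} (F : Arc n → M) :
    ∑ b, F b = ((∑ g, ∑ i, F (.ss g i)) + ((∑ g, ∑ i, F (.tt g i)) +
      ((∑ g, ∑ i, F (.outer g i)) + ∑ g, ∑ i, F (.inner g i)))) +
      (((∑ g, F (.sc g)) + ((∑ g, F (.ct g)) + ((∑ g, F (.feed g)) + ∑ g, F (.drain g)))) +
        (F .direct + F .e)) := by
  rw [← (arcEquiv n).symm.sum_comp]
  simp only [Fintype.sum_sum_type, Fintype.sum_prod_type, Finset.univ_unique, Finset.sum_singleton]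
  rfl

/-- The nodes, family by family. -/
def nodeEquiv (n : ℕ) :
    Node n ≃ (Unit ⊕ Unit) ⊕ (Side × Fin (n + 1)) ⊕ (Side × Fin (n + 1)) ⊕ Side where
  toFun
    | .source => .inl (.inl ())
    | .sink => .inl (.inr ())
    | .s g i => .inr (.inl (g, i))
    | .t g i => .inr (.inr (.inl (g, i)))
    | .c g => .inr (.inr (.inr g))
  invFun
    | .inl (.inl ()) => .source
    | .inl (.inr ()) => .sink
    | .inr (.inl (g, i)) => .s g i
    | .inr (.inr (.inl (g, i))) => .t g i
    | .inr (.inr (.inr g)) => .c g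
  left_inv := by rintro (_ | _) <;> rfl
  right_inv := by rintro ((_ | _) | (⟨_, _⟩ | ⟨_, _⟩ | _)) <;> rfl

theorem card_node (n : ℕ) : Fintype.card (Node n) = 4 * n + 8 := by
  have h : Fintype.card Side = 2 := rfl
  rw [Fintype.card_congr (nodeEquiv n)]
  simp [h]
  ring

theorem card_initial_tree (n : ℕ) : (initial n).tree.card = 4 * n + 7 := by
  simp only [initial, Finset.card_filter]
  rw [sum_arc]
  simp only [sum_side, isInitialTreeArc]
  simp
  ring

theorem initial_isSpanningTree {n : ℕ} (a : Fin n → ℚ) (ε : ℚ) :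
    (network a ε).IsSpanningTree (initial n).tree := by
  refine ⟨?_, by rw [card_initial_tree, card_node]⟩
  set R := (network a ε).Joined (initial n).tree with hR
  have sym : ∀ u v, R u v → R v u := by
    rintro u v ⟨b, hb, h⟩
    exact ⟨b, hb, h.symm⟩
  have arc : ∀ b : Arc n, isInitialTreeArc b = true → R (arcSrc b) (arcDst b) := fun b hb =>
    ⟨b, by simp [initial, hb], Or.inl ⟨rfl, rfl⟩⟩
  have key : ∀ v, Relation.ReflTransGen R .source v := by
    have hsink : Relation.ReflTransGen R (.source : Node n) .sink := .single (arc .direct rfl)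
    have hs : ∀ g i, Relation.ReflTransGen R (.source : Node n) (.s g i) := by
      intro g i
      induction i using Fin.reverseInduction with
      | last => exact .single (arc (.feed g) rfl)
      | cast i ih => exact ih.tail (arc (.ss g i) rfl)
    have ht : ∀ g i, Relation.ReflTransGen R (.source : Node n) (.t g i) := by
      intro g i
      induction i using Fin.reverseInduction with
      | last => exact hsink.tail (sym _ _ (arc (.drain g) rfl))
      | cast i ih => exact ih.tail (sym _ _ (arc (.tt g i) rfl))
    rintro (_ | _ | ⟨g, i⟩ | ⟨g, i⟩ | (_ | _))
    · exact .refl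
    · exact hsink
    · exact hs g i
    · exact ht g i
    · exact (hs .plus 0).tail (arc (.sc .plus) rfl)
    · exact (ht .minus 0).tail (sym _ _ (arc (.ct .minus) rfl))
  have hsymm : ∀ u, Relation.ReflTransGen R .source u → Relation.ReflTransGen R u .source := by
    intro u hu
    induction hu with
    | refl => exact .refl
    | tail _ h ih => exact ih.head (sym _ _ h)
  intro u v
  exact (hsymm u (key u)).trans (key v)

theorem sum_succ_eq {n : ℕ} (j : Fin (n + 1)) :
    (∑ i : Fin n, if i.succ = j then (1 : ℚ) else 0) = if j = 0 then 0 else 1 := by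
  cases j using Fin.cases <;> simp [Fin.succ_ne_zero]

theorem sum_castSucc_eq {n : ℕ} (j : Fin (n + 1)) :
    (∑ i : Fin n, if i.castSucc = j then (1 : ℚ) else 0) = if j = Fin.last n then 0 else 1 := by
  cases j using Fin.lastCases <;> simp [Fin.castSucc_ne_last]

theorem initial_isFeasibleFlow {n : ℕ} (a : Fin n → ℚ) (ε : ℚ) :
    (network a ε).IsFeasibleFlow (initial n).flow := by
  have hx : 0 ≤ x n := by
    have : (1 : ℚ) ≤ 2 ^ (n - 1) := one_le_pow₀ (by norm_num)
    unfold x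
    linarith
  have hp : ∀ i : ℕ, (1 : ℚ) ≤ 3 * 2 ^ i := fun i => by
    have : (1 : ℚ) ≤ 2 ^ i := one_le_pow₀ (by norm_num)
    linarith
  have hp' : ∀ i : ℕ, (0 : ℚ) ≤ 3 * 2 ^ i := fun i => by positivity
  constructor
  · rintro (⟨g, i⟩ | ⟨g, i⟩ | ⟨g, i⟩ | ⟨g, i⟩ | (_ | _) | (_ | _) | g | g | _ | _) <;>
      simp only [initial, network, initialFlow, arcCap, WithTop.coe_le_coe, le_top, and_true] <;>
      first
        | exact ⟨by norm_num, by exact_mod_cast hp i⟩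
        | exact ⟨by norm_num, by exact_mod_cast hp' i⟩
        | linarith
        | norm_num
  · have h1 := fun (j : Fin (n + 1)) => sum_succ_eq j
    have h2 := fun (j : Fin (n + 1)) => sum_castSucc_eq j
    have hc1 := fun (j : Fin (n + 1)) => @eq_comm _ (0 : Fin (n + 1)) j
    have hc2 := fun (j : Fin (n + 1)) => @eq_comm _ (Fin.last n) j
    rintro (_ | _ | ⟨_ | _, j⟩ | ⟨_ | _, j⟩ | (_ | _)) <;>
      simp [Network.netOut, sum_arc, sum_side, network, arcSrc, arcDst, initial, initialFlow,
        nodeSupply, h1, h2, hc1, hc2, -Finset.sum_boole, -Finset.sum_const]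
    all_goals first
      | ring1
      | (split_ifs <;> norm_num)

/-- The initial configuration is a basic feasible solution. -/
theorem initial_isBasicFeasible {n : ℕ} (a : Fin n → ℚ) (ε : ℚ) :
    (network a ε).IsBasicFeasible (initial n) := by
  refine ⟨initial_isSpanningTree a ε, initial_isFeasibleFlow a ε, fun b hb => ?_⟩
  have hb' : isInitialTreeArc b ≠ true := by simpa [initial] using hb
  rcases b with _ | _ | _ | _ | (_ | _) | (_ | _) | _ | _ | _ | _ <;>
    first | exact Or.inl rfl | exact absurd rfl hb'

end PartitionNetwork

/-! ### Circulations, node potentials and the existence of pivots in a general network -/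

namespace Network

section

variable {V E : Type*} [DecidableEq V] [Fintype E]

/-! Each gadget is a counter. Beyond its initial flow it absorbs `full n = 3 * 2 ^ n - 2` units, one
per pivot, and its tree and flow depend only on the number `k` of units sent so far. A gadget with
`m + 1` levels first fills the inner gadget with `m` levels. It then sends one unit along `s_{m+1} →
s_m → t_{m+1}` and one along `s_{m+1} → t_m → t_{m+1}`. Finally it sends `full m` units along
`s_{m+1} → t_m`, backwards through the inner gadget, and `s_m → t_{m+1}`, which empties the inner
gadget in reverse order (`step_succ`).

Unit number `k + 1` costs `k / 3` up to an error of at most `1 / 10` (`abs_unitCost_sub_le`). The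
reduced cost of the arc that sends it is this cost minus the potential gap between source and sink
(`residualCost_entering_leaving`). Every other residual non-tree arc of the gadget has nonnegative
reduced cost, is worse by at least `1 / 5`, or undoes a unit already sent (`residualCost_cases`). So
as long as `e` stays out, Dantzig's rule sends the cheapest next unit, and the two gadgets never
differ by more than one unit (`IsReachable`).

The perturbations turn the counter into an enumeration. When the exchange takes place at `c`, the
cost is `k / 3 ± w` up to `ε / 5`, where `w` is a signed sum of all `a_i` and the two gadgets carry
opposite signs. Sending through the inner gadget forwards contributes `+ a_m`; sending backwards
negates the lower signs and contributes `- a_m`. Hence every sign vector occurs at some `k`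
(`exists_center_of_signs`).

The reduced cost of `e` is the difference of the potentials at `c⁺` and `c⁻`. If both gadgets are in
the same state and the next exchange is at `c`, it is the average of the two competing reduced costs
minus `ε / 5` (`middleCost_center`). So `e` attains the minimum exactly when `|w| ≤ ε / 5`, which
means `w = 0` because all `a_i` are multiples of `ε`. In all other reachable situations `e` loses
(`middleCost_lower_bound`, `unitCost_lt_middleCost`, `middleCost_full`). Conversely, if `e` never
entered, both gadgets would reach the state belonging to a partition, and there `e` is cheaper by `ε
/ 5` than both gadgets. -/

theorem netOut_add (N : Network V E) (f h : E → ℚ) (v : V) :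
    N.netOut (fun b => f b + h b) v = N.netOut f v + N.netOut h v := by
  simp only [netOut, ite_add_zero, Finset.sum_add_distrib]
  ring

theorem netOut_smul (N : Network V E) (r : ℚ) (f : E → ℚ) (v : V) :
    N.netOut (fun b => r * f b) v = r * N.netOut f v := by
  simp only [netOut, mul_sub, Finset.mul_sum, mul_ite, mul_zero]

theorem netOut_sub (N : Network V E) (f h : E → ℚ) (v : V) :
    N.netOut (fun b => f b - h b) v = N.netOut f v - N.netOut h v := by
  have h1 := N.netOut_add f (fun b => (-1) * h b) v
  rw [netOut_smul] at h1
  have h2 : (fun b => f b + (-1) * h b) = fun b => f b - h b := by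
    funext b
    ring
  rw [h2] at h1
  linarith

theorem netOut_single [DecidableEq E] (N : Network V E) (a : E) (v : V) :
    N.netOut (fun b => if b = a then 1 else 0) v =
      (if N.src a = v then 1 else 0) - if N.dst a = v then 1 else 0 := by
  unfold netOut
  congr 1
  · rw [Finset.sum_eq_single a] <;> simp +contextual
  · rw [Finset.sum_eq_single a] <;> simp +contextual

/-- The reduced cost of an arc with respect to node potentials. -/
def reducedCost (N : Network V E) (p : V → ℚ) (b : E) : ℚ :=
  N.cost b + p (N.src b) - p (N.dst b)

/-- The potential differences along a circulation sum to zero: regrouped by nodes they give the sum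
of `p v` times the net outflow at `v`. -/
theorem flowCost_eq_sum_reducedCost [Fintype V] (N : Network V E) (p : V → ℚ) (χ : E → ℚ)
    (h : ∀ v, N.netOut χ v = 0) :
    N.flowCost χ = ∑ b, N.reducedCost p b * χ b := by
  have h0 : ∑ v, p v * N.netOut χ v = 0 := by simp [h]
  have h1 : ∑ v, p v * N.netOut χ v = ∑ b, (p (N.src b) - p (N.dst b)) * χ b := by
    simp only [netOut, mul_sub, Finset.mul_sum, Finset.sum_sub_distrib, sub_mul]
    congr 1 <;>
    · rw [Finset.sum_comm]
      refine Finset.sum_congr rfl fun b _ => ?_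
      simp
  unfold flowCost reducedCost
  rw [← add_zero (∑ b, N.cost b * χ b), ← h0, h1, ← Finset.sum_add_distrib]
  exact Finset.sum_congr rfl fun b _ => by ring

end

/-- The ratio test: `θ` is the least slack over the blocking arcs, and an arc attaining it becomes
tight. `hblock` rules out an unbounded step. -/
theorem exists_maximal_step {V E : Type*} [Fintype E] (N : Network V E) (f χ : E → ℚ)
    (hf : ∀ b, 0 ≤ f b ∧ (f b : WithTop ℚ) ≤ N.cap b)
    (hblock : ∃ b, χ b < 0 ∨ (0 < χ b ∧ N.cap b ≠ ⊤)) :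
    ∃ θ l, 0 ≤ θ ∧ (∀ b, 0 ≤ f b + θ * χ b ∧ ((f b + θ * χ b : ℚ) : WithTop ℚ) ≤ N.cap b) ∧
      N.IsTight (fun b => f b + θ * χ b) χ l := by
  classical
  -- The default `0` for an infinite capacity is harmless, since the minimum is taken only over arcs
  -- traversed backwards or of finite capacity.
  let slack : E → ℚ := fun b =>
    if χ b < 0 then f b / (-χ b) else ((N.cap b).untopD 0 - f b) / χ b
  obtain ⟨l, hl, hmin⟩ := Finset.exists_min_image
    (Finset.univ.filter fun b => χ b < 0 ∨ (0 < χ b ∧ N.cap b ≠ ⊤)) slack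
    (by obtain ⟨b, hb⟩ := hblock; exact ⟨b, by simpa using hb⟩)
  simp only [Finset.mem_filter, Finset.mem_univ, true_and] at hl hmin
  have hslack : ∀ b, (χ b < 0 ∨ (0 < χ b ∧ N.cap b ≠ ⊤)) → 0 ≤ slack b := by
    intro b hb
    rcases hb with hb | ⟨hb, hc⟩
    · simp only [slack, if_pos hb]
      exact div_nonneg (hf b).1 (by linarith)
    · simp only [slack, if_neg (not_lt.2 hb.le)]
      obtain ⟨c, hc⟩ := WithTop.ne_top_iff_exists.1 hc
      have h2 := (hf b).2
      rw [← hc, WithTop.coe_le_coe] at h2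
      rw [← hc, WithTop.untopD_coe]
      exact div_nonneg (by linarith) hb.le
  refine ⟨slack l, l, hslack l hl, fun b => ⟨?_, ?_⟩, ?_⟩
  · by_cases hb : χ b < 0
    · have h1 := hmin b (Or.inl hb)
      simp only [slack, if_pos hb] at h1 ⊢
      rw [le_div_iff₀ (by linarith)] at h1
      linarith
    · have := mul_nonneg (hslack l hl) (not_lt.1 hb)
      linarith [(hf b).1]
  · rcases eq_or_ne (N.cap b) ⊤ with hc | hc
    · simp [hc]
    · have h2 := (hf b).2
      obtain ⟨c, hc'⟩ := WithTop.ne_top_iff_exists.1 hc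
      rw [← hc', WithTop.coe_le_coe] at h2 ⊢
      rcases le_or_gt (χ b) 0 with hb | hb
      · have := mul_nonpos_of_nonneg_of_nonpos (hslack l hl) hb
        linarith
      · have h1 := hmin b (Or.inr ⟨hb, hc⟩)
        have h3 : slack b = (c - f b) / χ b := by
          simp only [slack, if_neg (not_lt.2 hb.le), ← hc', WithTop.untopD_coe]
        rw [h3, le_div_iff₀ hb] at h1
        linarith
  · rcases hl with hl | ⟨hl, hc⟩
    · right
      refine ⟨hl, ?_⟩
      simp only [slack, if_pos hl, div_neg, neg_mul]
      rw [div_mul_cancel₀ _ hl.ne, add_neg_cancel]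
    · left
      refine ⟨hl, ?_⟩
      obtain ⟨c, hc'⟩ := WithTop.ne_top_iff_exists.1 hc
      have h3 : slack l = (c - f l) / χ l := by
        simp only [slack, if_neg (not_lt.2 hl.le), ← hc', WithTop.untopD_coe]
      rw [h3, ← hc', WithTop.coe_inj]
      simp only
      rw [div_mul_cancel₀ _ hl.ne']
      ring

variable {V E : Type*} [DecidableEq V] [Fintype E] [DecidableEq E]

/-- If the tree arcs have reduced cost zero, the cost of a cycle flow is the reduced cost of the
non-tree arc. -/
theorem IsCycleFlow.flowCost_eq [Fintype V] {N : Network V E} {T : Finset E} {a : E} {d : Direction}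
    {χ : E → ℚ} (h : N.IsCycleFlow T a d χ) (p : V → ℚ)
    (hp : ∀ b ∈ T, N.reducedCost p b = 0) :
    N.flowCost χ = d.sign * N.reducedCost p a := by
  rw [N.flowCost_eq_sum_reducedCost p χ h.1, Finset.sum_eq_single a]
  · rw [h.2.1]
    ring
  · intro b _ hb
    by_cases hT : b ∈ T
    · rw [hp b hT, zero_mul]
    · rw [h.2.2 b (by simp [hb, hT]), mul_zero]
  · simp

/-- A unit is sent along a walk in `T`; each arc is added or subtracted according to the direction
in which it is used. -/
theorem exists_flow_of_connected (N : Network V E) (T : Finset E) (u v : V)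
    (h : Relation.ReflTransGen (N.Joined T) u v) :
    ∃ f : E → ℚ, (∀ b, b ∉ T → f b = 0) ∧
      ∀ w, N.netOut f w = (if u = w then 1 else 0) - if v = w then 1 else 0 := by
  induction h with
  | refl => exact ⟨fun _ => 0, fun _ _ => rfl, fun w => by simp [netOut]⟩
  | @tail x y _ hxy ih =>
    obtain ⟨f, hf, hfn⟩ := ih
    obtain ⟨a, ha, h⟩ := hxy
    rcases h with ⟨rfl, rfl⟩ | ⟨rfl, rfl⟩
    · refine ⟨fun b => f b + if b = a then 1 else 0, fun b hb => ?_, fun w => ?_⟩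
      · simp only
        rw [hf b hb, if_neg (by rintro rfl; exact hb ha), add_zero]
      · rw [netOut_add, netOut_single, hfn]
        ring
    · refine ⟨fun b => f b - if b = a then 1 else 0, fun b hb => ?_, fun w => ?_⟩
      · simp only
        rw [hf b hb, if_neg (by rintro rfl; exact hb ha), sub_zero]
      · rw [netOut_sub, netOut_single, hfn]
        ring

/-- The arc is closed up by a unit flow in the tree from its head back to its tail. -/
theorem exists_isCycleFlow (N : Network V E) (T : Finset E)
    (h : ∀ u v, Relation.ReflTransGen (N.Joined T) u v) (a : E) (ha : a ∉ T) (d : Direction) :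
    ∃ χ, N.IsCycleFlow T a d χ := by
  obtain ⟨f, hf, hfn⟩ := N.exists_flow_of_connected T (N.dst a) (N.src a) (h _ _)
  refine ⟨fun b => d.sign * (f b + if b = a then 1 else 0), fun v => ?_, ?_, fun b hb => ?_⟩
  · rw [netOut_smul, netOut_add, netOut_single, hfn]
    ring
  · simp [hf a ha]
  · simp only [Finset.mem_insert, not_or] at hb
    simp [hf b hb.2, hb.1]

/-- A pivot exists as long as some residual non-tree arc has negative reduced cost. -/
theorem exists_isPivot [Fintype V] (N : Network V E) (σ : Configuration E)
    (hconn : ∀ u v, Relation.ReflTransGen (N.Joined σ.tree) u v)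
    (hf : ∀ b, 0 ≤ σ.flow b ∧ (σ.flow b : WithTop ℚ) ≤ N.cap b)
    (hcap : ∀ b, b ∉ σ.tree → N.cap b ≠ ⊤)
    (p : V → ℚ) (hp : ∀ b ∈ σ.tree, N.reducedCost p b = 0)
    (b₀ : E) (d₀ : Direction) (hb₀ : b₀ ∉ σ.tree) (hres : N.IsResidual σ.flow b₀ d₀)
    (hneg : d₀.sign * N.reducedCost p b₀ < 0) : ∃ a τ, N.IsPivot σ a τ := by
  classical
  -- Directions are encoded by `Bool` so that Dantzig's minimum ranges over a finite type of pairs.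
  let dir : Bool → Direction := fun s => if s then .forward else .backward
  have hdir : ∀ d, ∃ s, dir s = d := by
    rintro (_ | _)
    · exact ⟨true, rfl⟩
    · exact ⟨false, rfl⟩
  obtain ⟨s₀, rfl⟩ := hdir d₀
  obtain ⟨⟨a, s⟩, hmem, hmin⟩ := Finset.exists_min_image
    (Finset.univ.filter fun x : E × Bool => x.1 ∉ σ.tree ∧ N.IsResidual σ.flow x.1 (dir x.2))
    (fun x => (dir x.2).sign * N.reducedCost p x.1) ⟨(b₀, s₀), by simp [hb₀, hres]⟩
  simp only [Finset.mem_filter, Finset.mem_univ, true_and, Prod.forall] at hmem hmin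
  obtain ⟨χ, hχ⟩ := N.exists_isCycleFlow σ.tree hconn a hmem.1 (dir s)
  obtain ⟨θ, l, hθ, hfeas, htight⟩ := N.exists_maximal_step σ.flow χ hf ⟨a, by
    rw [hχ.2.1]
    cases s
    · left
      norm_num [dir, Direction.sign]
    · right
      exact ⟨by norm_num [dir, Direction.sign], hcap a hmem.1⟩⟩
  refine ⟨a, ⟨(insert a σ.tree).erase l, fun b => σ.flow b + θ * χ b⟩, dir s, χ, θ, l,
    ⟨hmem.1, hmem.2, hχ⟩, ?_, ?_, hθ, rfl, hfeas, htight, rfl⟩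
  · rw [hχ.flowCost_eq p hp]
    exact (hmin b₀ s₀ ⟨hb₀, hres⟩).trans_lt hneg
  · intro b d' χ' hb hres' hχ'
    obtain ⟨s', rfl⟩ := hdir d'
    rw [hχ.flowCost_eq p hp, hχ'.flowCost_eq p hp]
    exact hmin b s' ⟨hb, hres'⟩

end Network

namespace PartitionNetwork

open Network

/-! ### Levels and states of a gadget -/

/-- The number of units that can be sent through a gadget with `m` levels. -/
def full : ℕ → ℕ
  | 0 => 1
  | m + 1 => 2 * full m + 2

/-- This ties the counter to the costs: `full m / 3` and `(full m + 1) / 3` are the unperturbed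
costs `2 ^ m - 2 / 3` and `2 ^ m - 1 / 3` of the inner and outer arcs, so these two units continue
the pattern `k / 3`. -/
theorem full_cast (m : ℕ) : (full m : ℚ) = 3 * 2 ^ m - 2 := by
  induction m with
  | zero => norm_num [full]
  | succ m ih =>
    simp only [full, Nat.cast_add, Nat.cast_mul, ih, pow_succ]
    push_cast
    ring

theorem full_pos (m : ℕ) : 0 < full m := by
  cases m <;> simp [full]

/-- Values at the levels `0, …, m` that are computed downwards from a value at level `m`. -/
def descend {α : Type*} (f : ℕ → α → α) : ℕ → α → ℕ → α
  | 0, x, _ => x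
  | m + 1, x, i => if i ≤ m then descend f m (f m x) i else x

theorem descend_self {α : Type*} (f : ℕ → α → α) (m : ℕ) (x : α) : descend f m x m = x := by
  cases m <;> simp [descend]

theorem descend_of_lt {α : Type*} (f : ℕ → α → α) (m : ℕ) (x : α) (i : ℕ) (hi : i < m) :
    descend f m x i = f i (descend f m x (i + 1)) := by
  induction m generalizing x with
  | zero => omega
  | succ m ih =>
    have h1 : i ≤ m := by omega
    rcases Nat.lt_or_ge i m with h | h
    · have h2 : i + 1 ≤ m := by omega
      simp only [descend, h1, h2, if_true]
      exact ih _ h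
    · obtain rfl : i = m := by omega
      simp [descend, descend_self]

/-- The state of the gadget with `i` levels inside the gadget with `i + 1` levels in state `k`. -/
def substate (i k : ℕ) : ℕ :=
  if k ≤ full i then k else if k ≤ full i + 1 then full i else 2 * full i + 2 - k

/-- The states `κ i` of the nested gadgets with `i ≤ m` levels fit together. -/
def Coherent (m : ℕ) (κ : ℕ → ℕ) : Prop :=
  (∀ i < m, κ i = substate i (κ (i + 1))) ∧ κ m ≤ full m

theorem Coherent.pred {m : ℕ} {κ : ℕ → ℕ} (h : Coherent (m + 1) κ) : Coherent m κ := by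
  refine ⟨fun i hi => h.1 i (by omega), ?_⟩
  have h1 := h.1 m (by omega)
  have h2 := h.2
  simp only [full] at h2
  rw [h1, substate]
  split_ifs <;> omega

theorem Coherent.le {m : ℕ} {κ : ℕ → ℕ} (h : Coherent m κ) : ∀ i ≤ m, κ i ≤ full i := by
  induction m with
  | zero =>
    intro i hi
    obtain rfl : i = 0 := by omega
    exact h.2
  | succ m ih =>
    intro i hi
    rcases Nat.lt_or_ge m i with h1 | h1
    · obtain rfl : i = m + 1 := by omega
      exact h.2
    · exact ih h.pred i h1

theorem Coherent.eq_of_le {m : ℕ} {κ κ' : ℕ → ℕ} (h : Coherent m κ) (h' : Coherent m κ')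
    (hm : κ m = κ' m) : ∀ i ≤ m, κ i = κ' i := by
  induction m with
  | zero =>
    intro i hi
    obtain rfl : i = 0 := by omega
    exact hm
  | succ m ih =>
    intro i hi
    rcases Nat.lt_or_ge m i with h1 | h1
    · obtain rfl : i = m + 1 := by omega
      exact hm
    · exact ih h.pred h'.pred (by rw [h.1 m (by omega), h'.1 m (by omega), hm]) i h1

/-- The states of the nested gadgets of a gadget with `n` levels in state `k`. -/
def levels (n k : ℕ) : ℕ → ℕ := descend substate n k

theorem coherent_levels {n k : ℕ} (hk : k ≤ full n) : Coherent n (levels n k) :=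
  ⟨fun i hi => descend_of_lt _ _ _ _ hi, by rwa [levels, descend_self]⟩

/-- The arcs of a gadget, with levels in `ℕ`. -/
inductive Piece
  | ss (i : ℕ)
  | tt (i : ℕ)
  | outer (i : ℕ)
  | inner (i : ℕ)
  | sc
  | ct

/-- The arcs of the gadget with `m` levels. -/
def Piece.InRange (m : ℕ) : Piece → Prop
  | .ss i => i < m
  | .tt i => i < m
  | .outer i => i < m
  | .inner i => i < m
  | .sc => True
  | .ct => True

/-- The flow in a gadget in the given states. -/
def pieceFlow (g : Side) (κ : ℕ → ℕ) : Piece → ℤ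
  | .ss i => if κ (i + 1) ≤ full i then 1 + κ i else full i + 2
  | .tt i => if κ (i + 1) ≤ full i + 1 then 1 + κ i else full i + 2
  | .outer i => if κ (i + 1) ≤ full i + 1 then 0 else 1 + full i - κ i
  | .inner i => if κ (i + 1) ≤ full i then 0 else 1 + full i - κ i
  | .sc => match g with
    | .plus => 1 + κ 0
    | .minus => κ 0
  | .ct => match g with
    | .plus => κ 0
    | .minus => 1 + κ 0

/-- The capacities in a gadget. -/
def pieceCap : Piece → ℤ
  | .ss i => full i + 2
  | .tt i => full i + 2
  | .outer i => full i + 2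
  | .inner i => full i + 2
  | .sc => 2
  | .ct => 2

/-- The tree arcs of a gadget in the given states. -/
def PieceInTree (g : Side) (κ : ℕ → ℕ) : Piece → Prop
  | .ss i => κ (i + 1) ≤ full i
  | .tt i => κ (i + 1) ≤ full i + 1
  | .outer i => ¬ κ (i + 1) ≤ full i + 1
  | .inner i => ¬ κ (i + 1) ≤ full i
  | .sc => match g with
    | .plus => κ 0 = 0
    | .minus => κ 0 ≠ 0
  | .ct => match g with
    | .plus => κ 0 ≠ 0
    | .minus => κ 0 = 0

theorem pieceFlow_congr (g : Side) {m : ℕ} {κ κ' : ℕ → ℕ} (h : ∀ i ≤ m, κ i = κ' i) (b : Piece)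
    (hb : b.InRange m) : pieceFlow g κ b = pieceFlow g κ' b := by
  have h0 := h 0 (by omega)
  cases b <;> simp only [Piece.InRange] at hb <;> simp only [pieceFlow, h0] <;>
    rw [h _ hb, h _ hb.le]

theorem pieceInTree_congr (g : Side) {m : ℕ} {κ κ' : ℕ → ℕ} (h : ∀ i ≤ m, κ i = κ' i) (b : Piece)
    (hb : b.InRange m) : PieceInTree g κ b ↔ PieceInTree g κ' b := by
  have h0 := h 0 (by omega)
  cases b <;> simp only [Piece.InRange] at hb <;> simp only [PieceInTree, h0] <;>
    rw [h _ hb]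

theorem pieceFlow_bounds (g : Side) {m : ℕ} {κ : ℕ → ℕ} (h : Coherent m κ) (b : Piece)
    (hb : b.InRange m) : 0 ≤ pieceFlow g κ b ∧ pieceFlow g κ b ≤ pieceCap b := by
  have hle := h.le
  have h0 := hle 0 (by omega)
  cases b <;> simp only [Piece.InRange] at hb <;> simp only [full] at h0 <;>
    simp only [pieceFlow, pieceCap]
  case sc => cases g <;> simp only <;> omega
  case ct => cases g <;> simp only <;> omega
  all_goals
    have := hle _ hb.le
    split_ifs <;> omega

theorem pieceCap_pos (b : Piece) : 0 < pieceCap b := by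
  cases b <;> simp only [pieceCap] <;> omega

/-- The possible changes of the basis: at the node `c`, or the subtree at the node `s_j` or at the
node `t_j` is moved. -/
inductive Exchange
  | center
  | left (j : ℕ)
  | right (j : ℕ)

/-- The arc of an exchange that is empty before. -/
def Exchange.low (g : Side) : Exchange → Piece
  | .center => match g with
    | .plus => .ct
    | .minus => .sc
  | .left j => .inner j
  | .right j => .outer j

/-- The arc of an exchange that is saturated afterwards. -/
def Exchange.high (g : Side) : Exchange → Piece
  | .center => match g with
    | .plus => .sc
    | .minus => .ct
  | .left j => .ss j
  | .right j => .tt j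

/-- The exchange that leads from state `k` to state `k + 1`. -/
def exchange : ℕ → ℕ → Exchange
  | 0, _ => .center
  | m + 1, k =>
    if k < full m then exchange m k else if k = full m then .left m
    else if k = full m + 1 then .right m else exchange m (2 * full m + 1 - k)

/-- Whether the exchange between the states `k` and `k + 1` goes forwards. -/
def orient : ℕ → ℕ → Bool
  | 0, _ => true
  | m + 1, k =>
    if k < full m then orient m k else if k ≤ full m + 1 then true
    else !orient m (2 * full m + 1 - k)

/-- The arc that enters the basis between the states `k` and `k + 1`. -/
def entering (g : Side) (m k : ℕ) : Piece :=
  if orient m k then (exchange m k).low g else (exchange m k).high g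

/-- The arc that leaves the basis between the states `k` and `k + 1`. -/
def leaving (g : Side) (m k : ℕ) : Piece :=
  if orient m k then (exchange m k).high g else (exchange m k).low g

theorem entering_succ (g : Side) (m k : ℕ) : entering g (m + 1) k =
    if k < full m then entering g m k else if k = full m then .inner m
    else if k = full m + 1 then .outer m else leaving g m (2 * full m + 1 - k) := by
  simp only [entering, leaving, exchange, orient]
  split_ifs <;> first | omega | simp_all [Exchange.low]

theorem leaving_succ (g : Side) (m k : ℕ) : leaving g (m + 1) k =
    if k < full m then leaving g m k else if k = full m then .ss m
    else if k = full m + 1 then .tt m else entering g m (2 * full m + 1 - k) := by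
  simp only [entering, leaving, exchange, orient]
  split_ifs <;> first | omega | simp_all [Exchange.high]

/-- How the flow and the tree change between two neighbouring states: `p` enters the tree, `q`
leaves it. The description is symmetric under reversal. -/
structure Step (g : Side) (m : ℕ) (κ κ' : ℕ → ℕ) (p q : Piece) : Prop where
  p_range : p.InRange m
  q_range : q.InRange m
  p_before : ¬ PieceInTree g κ p
  p_after : PieceInTree g κ' p
  q_before : PieceInTree g κ q
  q_after : ¬ PieceInTree g κ' q
  tree : ∀ b, b.InRange m → b ≠ p → b ≠ q → (PieceInTree g κ b ↔ PieceInTree g κ' b)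
  const : ∀ b, b.InRange m → ¬ PieceInTree g κ b → ¬ PieceInTree g κ' b →
    pieceFlow g κ' b = pieceFlow g κ b
  diff : ∀ b, b.InRange m → pieceFlow g κ' b = pieceFlow g κ b + 1 ∨
    pieceFlow g κ' b = pieceFlow g κ b ∨ pieceFlow g κ' b = pieceFlow g κ b - 1
  p_bound : (pieceFlow g κ' p = pieceFlow g κ p + 1 ∧ pieceFlow g κ p = 0) ∨
    (pieceFlow g κ' p = pieceFlow g κ p - 1 ∧ pieceFlow g κ p = pieceCap p)
  q_bound : (pieceFlow g κ' q = pieceFlow g κ q + 1 ∧ pieceFlow g κ' q = pieceCap q) ∨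
    (pieceFlow g κ' q = pieceFlow g κ q - 1 ∧ pieceFlow g κ' q = 0)
  slack_before : ∀ b, b.InRange m → b ≠ p →
    (pieceFlow g κ' b = pieceFlow g κ b + 1 → 0 < pieceFlow g κ b) ∧
    (pieceFlow g κ' b = pieceFlow g κ b - 1 → pieceFlow g κ b < pieceCap b)
  slack_after : ∀ b, b.InRange m → b ≠ q →
    (pieceFlow g κ' b = pieceFlow g κ b + 1 → pieceFlow g κ' b < pieceCap b) ∧
    (pieceFlow g κ' b = pieceFlow g κ b - 1 → 0 < pieceFlow g κ' b)

/-- Needed because the last phase of a gadget runs the next smaller one backwards. -/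
theorem Step.symm {g : Side} {m : ℕ} {κ κ' : ℕ → ℕ} {p q : Piece} (h : Step g m κ κ' p q) :
    Step g m κ' κ q p where
  p_range := h.q_range
  q_range := h.p_range
  p_before := h.q_after
  p_after := h.q_before
  q_before := h.p_after
  q_after := h.p_before
  tree b hb h1 h2 := (h.tree b hb h2 h1).symm
  const b hb h1 h2 := (h.const b hb h2 h1).symm
  diff b hb := by have := h.diff b hb; omega
  p_bound := by have := h.q_bound; omega
  q_bound := by have := h.p_bound; omega
  slack_before b hb h1 := by have := h.slack_after b hb h1; omega
  slack_after b hb h1 := by have := h.slack_before b hb h1; omega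

theorem Piece.InRange.succ {m : ℕ} {b : Piece} (h : b.InRange m) : b.InRange (m + 1) := by
  cases b <;> simp only [Piece.InRange] at h ⊢ <;> omega

theorem Piece.InRange.cases {m : ℕ} {b : Piece} (h : b.InRange (m + 1)) :
    b.InRange m ∨ b = .ss m ∨ b = .tt m ∨ b = .outer m ∨ b = .inner m := by
  cases b <;> simp only [Piece.InRange] at h ⊢ <;> simp <;> omega

/-- A step inside the gadget with `m` levels is a step of the gadget with `m + 1` levels. -/
theorem Step.lift {g : Side} {m : ℕ} {κ κ' : ℕ → ℕ} {p q : Piece} (h : Step g m κ κ' p q)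
    (hκ : κ m ≤ full m) (hκ' : κ' m ≤ full m) (hd : κ' m = κ m + 1 ∨ κ m = κ' m + 1)
    (hphase : (κ (m + 1) ≤ full m ∧ κ' (m + 1) ≤ full m) ∨
      (full m + 1 < κ (m + 1) ∧ full m + 1 < κ' (m + 1))) :
    Step g (m + 1) κ κ' p q where
  p_range := h.p_range.succ
  q_range := h.q_range.succ
  p_before := h.p_before
  p_after := h.p_after
  q_before := h.q_before
  q_after := h.q_after
  tree b hb h1 h2 := by
    rcases hb.cases with hb | rfl | rfl | rfl | rfl
    · exact h.tree b hb h1 h2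
    all_goals simp only [PieceInTree]; omega
  const b hb h1 h2 := by
    rcases hb.cases with hb | rfl | rfl | rfl | rfl
    · exact h.const b hb h1 h2
    all_goals simp only [PieceInTree] at h1 h2; simp only [pieceFlow]; split_ifs <;> omega
  diff b hb := by
    rcases hb.cases with hb | rfl | rfl | rfl | rfl
    · exact h.diff b hb
    all_goals simp only [pieceFlow]; split_ifs <;> omega
  p_bound := h.p_bound
  q_bound := h.q_bound
  slack_before b hb h1 := by
    rcases hb.cases with hb | rfl | rfl | rfl | rfl
    · exact h.slack_before b hb h1
    all_goals simp only [pieceFlow, pieceCap]; split_ifs <;> omega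
  slack_after b hb h1 := by
    rcases hb.cases with hb | rfl | rfl | rfl | rfl
    · exact h.slack_after b hb h1
    all_goals simp only [pieceFlow, pieceCap]; split_ifs <;> omega

/-- The inner gadget is full and rests. The unit travels `s_{m+1} → s_m → t_{m+1}`, which saturates
the arc into `s_m`. -/
theorem step_left {g : Side} {m : ℕ} {κ κ' : ℕ → ℕ} (h : ∀ i ≤ m, κ i = κ' i)
    (hm : κ m = full m) (hκ : κ (m + 1) = full m) (hκ' : κ' (m + 1) = full m + 1) :
    Step g (m + 1) κ κ' (.inner m) (.ss m) := by
  have hF := fun b hb => pieceFlow_congr g h b hb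
  have hT := fun b hb => pieceInTree_congr g h b hb
  have hm' := h m le_rfl
  constructor
  case tree =>
    intro b hb h1 h2
    rcases hb.cases with hb | rfl | rfl | rfl | rfl
    · exact hT b hb
    all_goals simp [PieceInTree, hκ, hκ'] at *
  case const =>
    intro b hb h1 h2
    rcases hb.cases with hb | rfl | rfl | rfl | rfl
    · exact (hF b hb).symm
    all_goals simp [PieceInTree, pieceFlow, hκ, hκ'] at *
  case diff =>
    intro b hb
    rcases hb.cases with hb | rfl | rfl | rfl | rfl
    · exact Or.inr (Or.inl (hF b hb).symm)
    all_goals simp only [pieceFlow]; split_ifs <;> omega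
  case slack_before =>
    intro b hb h1
    rcases hb.cases with hb | rfl | rfl | rfl | rfl
    · have := hF b hb
      omega
    all_goals simp only [pieceFlow, pieceCap]; split_ifs <;> first | omega | simp at h1
  case slack_after =>
    intro b hb h1
    rcases hb.cases with hb | rfl | rfl | rfl | rfl
    · have := hF b hb
      omega
    all_goals simp only [pieceFlow, pieceCap]; split_ifs <;> first | omega | simp at h1
  all_goals first
    | (simp only [pieceFlow, pieceCap]; split_ifs <;> omega)
    | simp [PieceInTree, Piece.InRange, hκ, hκ']

/-- The mirror image: the unit travels `s_{m+1} → t_m → t_{m+1}`, which saturates the arc out of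
`t_m`. -/
theorem step_right {g : Side} {m : ℕ} {κ κ' : ℕ → ℕ} (h : ∀ i ≤ m, κ i = κ' i)
    (hm : κ m = full m) (hκ : κ (m + 1) = full m + 1) (hκ' : κ' (m + 1) = full m + 2) :
    Step g (m + 1) κ κ' (.outer m) (.tt m) := by
  have hF := fun b hb => pieceFlow_congr g h b hb
  have hT := fun b hb => pieceInTree_congr g h b hb
  have hm' := h m le_rfl
  constructor
  case tree =>
    intro b hb h1 h2
    rcases hb.cases with hb | rfl | rfl | rfl | rfl
    · exact hT b hb
    all_goals simp [PieceInTree, hκ, hκ'] at *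
  case const =>
    intro b hb h1 h2
    rcases hb.cases with hb | rfl | rfl | rfl | rfl
    · exact (hF b hb).symm
    all_goals simp [PieceInTree, pieceFlow, hκ, hκ'] at *
  case diff =>
    intro b hb
    rcases hb.cases with hb | rfl | rfl | rfl | rfl
    · exact Or.inr (Or.inl (hF b hb).symm)
    all_goals simp only [pieceFlow]; split_ifs <;> omega
  case slack_before =>
    intro b hb h1
    rcases hb.cases with hb | rfl | rfl | rfl | rfl
    · have := hF b hb
      omega
    all_goals simp only [pieceFlow, pieceCap]; split_ifs <;> first | omega | simp at h1
  case slack_after =>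
    intro b hb h1
    rcases hb.cases with hb | rfl | rfl | rfl | rfl
    · have := hF b hb
      omega
    all_goals simp only [pieceFlow, pieceCap]; split_ifs <;> first | omega | simp at h1
  all_goals first
    | (simp only [pieceFlow, pieceCap]; split_ifs <;> omega)
    | simp [PieceInTree, Piece.InRange, hκ, hκ']

theorem step_center {g : Side} {κ κ' : ℕ → ℕ} (hκ : κ 0 = 0) (hκ' : κ' 0 = 1) :
    Step g 0 κ κ' (Exchange.center.low g) (Exchange.center.high g) := by
  constructor
  case tree => rintro (_ | _ | _ | _ | _ | _) hb <;> cases g <;> simp [Piece.InRange, Exchange.low, Exchange.high] at *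
  case const =>
    rintro (_ | _ | _ | _ | _ | _) hb <;> cases g <;> simp [Piece.InRange, PieceInTree, hκ, hκ'] at *
  case diff =>
    rintro (_ | _ | _ | _ | _ | _) hb <;> cases g <;> simp [Piece.InRange, pieceFlow, hκ, hκ'] at *
  case slack_before =>
    rintro (_ | _ | _ | _ | _ | _) hb <;> cases g <;>
      simp [Piece.InRange, pieceFlow, pieceCap, Exchange.low, hκ, hκ'] at *
  case slack_after =>
    rintro (_ | _ | _ | _ | _ | _) hb <;> cases g <;>
      simp [Piece.InRange, pieceFlow, pieceCap, Exchange.high, hκ, hκ'] at *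
  all_goals cases g <;> simp [Exchange.low, Exchange.high, pieceFlow, pieceCap, PieceInTree,
    Piece.InRange, hκ, hκ']

/-- Induction on the number of levels, following the phases of the counter: forwards through the
inner gadget, the two detours, backwards through the inner gadget. -/
theorem step_succ (g : Side) {m : ℕ} {κ κ' : ℕ → ℕ} (h : Coherent m κ) (h' : Coherent m κ')
    (hs : κ' m = κ m + 1) : Step g m κ κ' (entering g m (κ m)) (leaving g m (κ m)) := by
  induction m generalizing κ κ' with
  | zero =>
    have := h'.2
    simp only [full] at this
    exact step_center (by omega) (by omega)
  | succ m ih =>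
    have hm := h.1 m (by omega)
    have hm' := h'.1 m (by omega)
    have hf := h'.2
    have hk := h.pred.2
    have hk' := h'.pred.2
    have hcong := h.pred.eq_of_le h'.pred
    rw [entering_succ, leaving_succ]
    unfold substate at hm hm'
    simp only [full] at hf
    rcases lt_trichotomy (κ (m + 1)) (full m) with h1 | h1 | h1
    · rw [if_pos h1, if_pos h1]
      rw [if_pos (by omega)] at hm hm'
      rw [← hm]
      exact (ih h.pred h'.pred (by omega)).lift hk hk' (by omega) (by omega)
    · have h2 : ¬ κ (m + 1) < full m := by omega
      rw [if_neg h2, if_neg h2, if_pos h1, if_pos h1]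
      rw [if_pos (by omega)] at hm
      rw [if_neg (by omega), if_pos (by omega)] at hm'
      exact step_left (hcong (by omega)) (by omega) (by omega) (by omega)
    · have h2 : ¬ κ (m + 1) < full m := by omega
      have h3 : ¬ κ (m + 1) = full m := by omega
      rw [if_neg h2, if_neg h2, if_neg h3, if_neg h3]
      rw [if_neg (by omega)] at hm hm'
      by_cases h4 : κ (m + 1) = full m + 1
      · rw [if_pos h4, if_pos h4]
        rw [if_pos (by omega)] at hm
        rw [if_neg (by omega)] at hm'
        exact step_right (hcong (by omega)) (by omega) (by omega) (by omega)
      · rw [if_neg h4, if_neg h4]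
        rw [if_neg (by omega)] at hm hm'
        -- The inner gadget steps down from `κ m` to `κ' m = κ m - 1`. An exchange is indexed by the
        -- smaller of its two states, so the induction hypothesis is applied with `κ` and `κ'`
        -- swapped.
        have h5 : 2 * full m + 1 - κ (m + 1) = κ' m := by omega
        rw [h5]
        exact (ih h'.pred h.pred (by omega)).symm.lift hk hk' (by omega) (by omega)

end PartitionNetwork

namespace PartitionNetwork

open Network

/-! ### Potentials and reduced costs in a gadget -/

/-- The costs in a gadget. -/
def pieceCost (a : ℕ → ℚ) (ε : ℚ) (g : Side) : Piece → ℚ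
  | .ss i => g.sign * a i / 2
  | .tt i => g.sign * a i / 2
  | .outer i => 2 ^ i - 1 / 3 - g.sign * a i / 2
  | .inner i => 2 ^ i - (1 - 1 / 3) - g.sign * a i / 2
  | .sc => match g with
    | .plus => 0
    | .minus => ε / 5
  | .ct => match g with
    | .plus => ε / 5
    | .minus => 0

/-- `S i` and `T i` are potentials of `s_i` and `t_i` for which the tree arcs of the levels up to
`m` have reduced cost zero. -/
structure IsPotential (a : ℕ → ℚ) (g : Side) (m : ℕ) (κ : ℕ → ℕ) (S T : ℕ → ℚ) : Prop where
  left : ∀ i < m, S i = if κ (i + 1) ≤ full i then S (i + 1) + g.sign * a i / 2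
    else T (i + 1) - (full i / 3 - g.sign * a i / 2)
  right : ∀ i < m, T i = if κ (i + 1) ≤ full i + 1 then T (i + 1) - g.sign * a i / 2
    else S (i + 1) + ((full i + 1) / 3 - g.sign * a i / 2)

theorem IsPotential.pred {a : ℕ → ℚ} {g : Side} {m : ℕ} {κ : ℕ → ℕ} {S T : ℕ → ℚ}
    (h : IsPotential a g (m + 1) κ S T) : IsPotential a g m κ S T :=
  ⟨fun i hi => h.left i (by omega), fun i hi => h.right i (by omega)⟩

theorem exists_isPotential (a : ℕ → ℚ) (g : Side) (m : ℕ) (κ : ℕ → ℕ) (u v : ℚ) :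
    ∃ S T, IsPotential a g m κ S T ∧ S m = u ∧ T m = v := by
  let f : ℕ → ℚ × ℚ → ℚ × ℚ := fun i x =>
    (if κ (i + 1) ≤ full i then x.1 + g.sign * a i / 2 else x.2 - (full i / 3 - g.sign * a i / 2),
      if κ (i + 1) ≤ full i + 1 then x.2 - g.sign * a i / 2
      else x.1 + ((full i + 1) / 3 - g.sign * a i / 2))
  refine ⟨fun i => (descend f m (u, v) i).1, fun i => (descend f m (u, v) i).2,
    ⟨fun i hi => ?_, fun i hi => ?_⟩, by simp [descend_self], by simp [descend_self]⟩
  · rw [descend_of_lt _ _ _ _ hi]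
  · rw [descend_of_lt _ _ _ _ hi]

/-- The potential of the node `c`. -/
def centerPotential (ε : ℚ) (g : Side) (κ : ℕ → ℕ) (S T : ℕ → ℚ) : ℚ :=
  match g with
  | .plus => if κ 0 = 0 then S 0 else T 0 - ε / 5
  | .minus => if κ 0 = 0 then T 0 else S 0 + ε / 5

/-- The reduced costs in a gadget. -/
def pieceReduced (a : ℕ → ℚ) (ε : ℚ) (g : Side) (κ : ℕ → ℕ) (S T : ℕ → ℚ) : Piece → ℚ
  | .ss i => pieceCost a ε g (.ss i) + S (i + 1) - S i
  | .tt i => pieceCost a ε g (.tt i) + T i - T (i + 1)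
  | .outer i => pieceCost a ε g (.outer i) + S (i + 1) - T i
  | .inner i => pieceCost a ε g (.inner i) + S i - T (i + 1)
  | .sc => pieceCost a ε g .sc + S 0 - centerPotential ε g κ S T
  | .ct => pieceCost a ε g .ct + centerPotential ε g κ S T - T 0

/-- The direction in which a non-tree arc of a gadget is residual. -/
def pieceDirection (g : Side) : Piece → Direction
  | .ss _ => .backward
  | .tt _ => .backward
  | .outer _ => .forward
  | .inner _ => .forward
  | .sc => match g with
    | .plus => .backward
    | .minus => .forward
  | .ct => match g with
    | .plus => .forward
    | .minus => .backward

/-- Hence each non-tree arc of a gadget competes in Dantzig's rule in a single direction, which does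
not depend on the state. -/
theorem pieceFlow_of_not_inTree {g : Side} {m : ℕ} {κ : ℕ → ℕ} (h : Coherent m κ) {b : Piece}
    (ht : ¬ PieceInTree g κ b) :
    (pieceDirection g b = .forward ∧ pieceFlow g κ b = 0) ∨
      (pieceDirection g b = .backward ∧ pieceFlow g κ b = pieceCap b) := by
  have h0 := h.le 0 (by omega)
  simp only [full] at h0
  cases b <;> simp only [PieceInTree] at ht
  case sc => cases g <;> simp only [pieceDirection, pieceFlow, pieceCap] at ht ⊢ <;> simp <;> omega
  case ct => cases g <;> simp only [pieceDirection, pieceFlow, pieceCap] at ht ⊢ <;> simp <;> omega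
  all_goals
    simp [pieceDirection, pieceFlow, pieceCap]
    omega

/-- The reduced cost of a residual non-tree arc of a gadget. -/
def residualCost (a : ℕ → ℚ) (ε : ℚ) (g : Side) (κ : ℕ → ℕ) (S T : ℕ → ℚ) (b : Piece) : ℚ :=
  (pieceDirection g b).sign * pieceReduced a ε g κ S T b

theorem pieceReduced_eq_zero {a : ℕ → ℚ} {ε : ℚ} {g : Side} {m : ℕ} {κ : ℕ → ℕ} {S T : ℕ → ℚ}
    (h : IsPotential a g m κ S T) (b : Piece) (hb : b.InRange m) (ht : PieceInTree g κ b) :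
    pieceReduced a ε g κ S T b = 0 := by
  cases b <;> simp only [Piece.InRange] at hb <;> simp only [PieceInTree] at ht <;>
    simp only [pieceReduced, pieceCost]
  case sc =>
    cases g <;> simp only at ht
    · simp [centerPotential, ht]
    · simp only [centerPotential, if_neg ht]
      ring
  case ct => cases g <;> simp only at ht <;> simp [centerPotential, ht]
  case ss i => rw [h.left i hb, if_pos ht]; ring
  case tt i => rw [h.right i hb, if_pos ht]; ring
  case outer i => rw [h.right i hb, if_neg ht, full_cast]; ring
  case inner i => rw [h.left i hb, if_neg ht, full_cast]; ring

/-- The cost of sending the unit number `k + 1` through the gadget with `m` levels. -/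
def unitCost (a : ℕ → ℚ) (ε : ℚ) (g : Side) : ℕ → ℕ → ℚ
  | 0, _ => ε / 5
  | m + 1, k =>
    if k < full m then unitCost a ε g m k + g.sign * a m
    else if k = full m then full m / 3
    else if k = full m + 1 then (full m + 1) / 3
    else (2 * full m + 1) / 3 - g.sign * a m - unitCost a ε g m (2 * full m + 1 - k)

theorem Side.sign_mul_le (g : Side) {r : ℚ} (hr : 0 ≤ r) : -r ≤ g.sign * r ∧ g.sign * r ≤ r := by
  cases g <;> simp only [Side.sign] <;> constructor <;> linarith

/-- Each level shifts the cost by `± a m`. The reflection `k ↦ 2 * full m + 1 - k` of the last phase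
preserves the pattern `k / 3`, and the two detours fit it exactly. -/
theorem abs_unitCost_sub_le {a : ℕ → ℚ} {ε : ℚ} (ha : ∀ i, 0 ≤ a i) (hε : 0 ≤ ε) (g : Side)
    (m k : ℕ) (hk : k < full m) :
    |unitCost a ε g m k - k / 3| ≤ ε / 5 + ∑ i ∈ Finset.range m, a i := by
  induction m generalizing k with
  | zero =>
    simp only [full] at hk
    obtain rfl : k = 0 := by omega
    simp only [unitCost, Nat.cast_zero, zero_div, sub_zero, Finset.range_zero, Finset.sum_empty,
      add_zero]
    rw [abs_of_nonneg (by linarith)]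
  | succ m ih =>
    have h0 : 0 ≤ ∑ i ∈ Finset.range m, a i := Finset.sum_nonneg fun i _ => ha i
    have h1 := g.sign_mul_le (ha m)
    have h2 := ha m
    simp only [full] at hk
    rw [Finset.sum_range_succ]
    simp only [unitCost]
    split_ifs with c1 c2 c3
    · have h3 := abs_le.1 (ih k c1)
      rw [abs_le]
      constructor <;> linarith
    · rw [c2, sub_self, abs_zero]
      linarith
    · rw [c3]
      push_cast
      rw [sub_self, abs_zero]
      linarith
    · obtain ⟨j, hj⟩ : ∃ j, j = 2 * full m + 1 - k := ⟨_, rfl⟩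
      have h3 := abs_le.1 (ih j (by omega))
      have h4 : (k : ℚ) + j = 2 * full m + 1 := by
        have : k + j = 2 * full m + 1 := by omega
        exact_mod_cast this
      rw [← hj, abs_le]
      constructor <;> linarith

/-- In the first phase the inner gap is the outer gap minus `± a m`. In the last phase it is `(2 *
full m + 1) / 3 - (± a m)` minus the outer gap, and sending and undoing trade places. This is the
recursion of `unitCost`, and the exchange of roles is why both claims are proved together. -/
theorem residualCost_entering_leaving (a : ℕ → ℚ) (ε : ℚ) (g : Side) (m : ℕ) (κ : ℕ → ℕ)
    (S T : ℕ → ℚ) (hκ : Coherent m κ) (h : IsPotential a g m κ S T) :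
    (κ m < full m →
      residualCost a ε g κ S T (entering g m (κ m)) = unitCost a ε g m (κ m) - (T m - S m)) ∧
    ∀ j, κ m = j + 1 →
      residualCost a ε g κ S T (leaving g m j) = T m - S m - unitCost a ε g m j := by
  induction m with
  | zero =>
    constructor
    · intro h1
      simp only [full, Nat.lt_one_iff] at h1
      cases g <;> simp [entering, orient, exchange, Exchange.low, residualCost, pieceDirection,
        Direction.sign, pieceReduced, pieceCost, centerPotential, h1, unitCost] <;> ring
    · intro j hj
      cases g <;> simp [leaving, orient, exchange, Exchange.high, residualCost, pieceDirection,
        Direction.sign, pieceReduced, pieceCost, centerPotential, hj, unitCost] <;> ring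
  | succ m ih =>
    obtain ⟨ih1, ih2⟩ := ih hκ.pred h.pred
    have hm := hκ.1 m (by omega)
    have hk := hκ.2
    have hS := h.left m (by omega)
    have hT := h.right m (by omega)
    simp only [full] at hk
    have hp := full_cast m
    unfold substate at hm
    simp only [full]
    constructor
    · intro h1
      rw [entering_succ]
      simp only [unitCost]
      split_ifs with c1 c2 c3
      · rw [if_pos (by omega)] at hm hS hT
        rw [← hm, ih1 (by omega), hS, hT]
        ring
      · rw [if_pos (by omega)] at hS hT
        simp only [residualCost, pieceDirection, Direction.sign, pieceReduced, pieceCost, hS, hp]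
        ring
      · rw [if_neg (by omega)] at hS
        rw [if_pos (by omega)] at hT
        simp only [residualCost, pieceDirection, Direction.sign, pieceReduced, pieceCost, hT, hp]
        ring
      · rw [if_neg (by omega)] at hm hS hT
        rw [if_neg (by omega)] at hm
        rw [ih2 _ (by omega), hS, hT]
        ring
    · intro j hj
      rw [leaving_succ]
      simp only [unitCost]
      split_ifs with c1 c2 c3
      · rw [if_pos (by omega)] at hm hS hT
        rw [ih2 j (by omega), hS, hT]
        ring
      · rw [if_neg (by omega)] at hS
        simp only [residualCost, pieceDirection, Direction.sign, pieceReduced, pieceCost, hS, hp]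
        ring
      · rw [if_neg (by omega)] at hT
        simp only [residualCost, pieceDirection, Direction.sign, pieceReduced, pieceCost, hT, hp]
        ring
      · rw [if_neg (by omega)] at hm hS hT
        rw [if_neg (by omega)] at hm
        have h3 : 2 * full m + 1 - j = κ m := by omega
        rw [h3, ih1 (by omega), hS, hT]
        ring

/-- The non-tree arcs of a gadget with gap `D` between the potentials of `t_m` and `s_m` have
a reduced cost that is nonnegative or sufficiently larger than that of the two neighbouring
exchanges. -/
theorem residualCost_cases {a : ℕ → ℚ} {ε : ℚ} (ha : ∀ i, 0 ≤ a i) (hε : 0 ≤ ε) (g : Side) (m : ℕ)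
    (hsum : ε / 5 + ∑ i ∈ Finset.range m, a i ≤ 1 / 10) (κ : ℕ → ℕ) (S T : ℕ → ℚ)
    (hκ : Coherent m κ) (h : IsPotential a g m κ S T) (b : Piece) (hb : b.InRange m)
    (ht : ¬ PieceInTree g κ b) :
    0 ≤ residualCost a ε g κ S T b ∨
    (κ m < full m ∧ (unitCost a ε g m (κ m) + 1 / 5 - (T m - S m) ≤ residualCost a ε g κ S T b ∨
      b = entering g m (κ m))) ∨
    ∃ j, κ m = j + 1 ∧ (T m - S m - unitCost a ε g m j + 1 / 5 ≤ residualCost a ε g κ S T b ∨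
      b = leaving g m j) := by
  induction m with
  | zero =>
    have h1 := hκ.2
    simp only [full] at h1
    rcases Nat.lt_or_ge (κ 0) 1 with h2 | h2
    · refine Or.inr (Or.inl ⟨h2, Or.inr ?_⟩)
      cases b <;> simp only [Piece.InRange] at hb <;>
        cases g <;> simp [PieceInTree, entering, orient, exchange, Exchange.low] at * <;> omega
    · refine Or.inr (Or.inr ⟨0, by omega, Or.inr ?_⟩)
      cases b <;> simp only [Piece.InRange] at hb <;>
        cases g <;> simp [PieceInTree, leaving, orient, exchange, Exchange.high] at * <;> omega
  | succ m ih =>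
    have hbound := fun k (hk : k < full (m + 1)) =>
      abs_le.1 ((abs_unitCost_sub_le ha hε g (m + 1) k hk).trans hsum)
    rw [Finset.sum_range_succ] at hsum
    have ham := ha m
    have hga := g.sign_mul_le ham
    have ih := ih (by linarith) hκ.pred h.pred
    have hrl := residualCost_entering_leaving a ε g m κ S T hκ.pred h.pred
    have hm := hκ.1 m (by omega)
    have hk := hκ.2
    have hS := h.left m (by omega)
    have hT := h.right m (by omega)
    have hfp := full_pos m
    simp only [full] at hk hbound
    have hp := full_cast m
    unfold substate at hm
    simp only [full]
    have hboundm := fun k (hk : k < full m) =>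
      abs_le.1 ((abs_unitCost_sub_le ha hε g m k hk).trans (by linarith : _ ≤ (1 / 10 - a m)))
    have key : ∀ k, κ (m + 1) = k → k ≤ full m ∨ k = full m + 1 ∨ full m + 1 < k := by
      intro k _
      omega
    rcases key _ rfl with c | c | c
    · -- both arcs of the level are as in the beginning
      rw [if_pos (by omega)] at hm hS hT
      rcases hb.cases with hb | rfl | rfl | rfl | rfl
      · rcases ih hb with h1 | ⟨h1, h2⟩ | ⟨j, h1, h2⟩
        · exact Or.inl h1
        · refine Or.inr (Or.inl ⟨by omega, ?_⟩)
          rw [entering_succ]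
          simp only [unitCost]
          rw [if_pos (by omega), if_pos (by omega), ← hm]
          refine h2.imp_left fun h2 => ?_
          linarith
        · refine Or.inr (Or.inr ⟨j, by omega, ?_⟩)
          rw [leaving_succ]
          simp only [unitCost]
          rw [if_pos (by omega), if_pos (by omega)]
          refine h2.imp_left fun h2 => ?_
          linarith
      · exact absurd c ht
      · exact absurd (show κ (m + 1) ≤ full m + 1 by omega) ht
      · refine Or.inr (Or.inl ⟨by omega, Or.inl ?_⟩)
        -- The perturbations cancel and this arc costs `(full m + 1) / 3` minus the gap. Consecutive
        -- multiples of `1 / 3` with an error of `1 / 10` leave `1 / 3 - 1 / 10 ≥ 1 / 5`, the source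
        -- of the margin.
        have h1 := (hbound (κ (m + 1)) (by omega)).2
        have h2 : (κ (m + 1) : ℚ) ≤ full m := by exact_mod_cast c
        simp only [residualCost, pieceDirection, Direction.sign, pieceReduced, pieceCost, hT]
        linarith
      · refine Or.inr (Or.inl ⟨by omega, ?_⟩)
        rcases c.lt_or_eq with c | c
        · left
          have h1 := (hbound (κ (m + 1)) (by omega)).2
          have h2 : (κ (m + 1) : ℚ) + 1 ≤ full m := by exact_mod_cast c
          simp only [residualCost, pieceDirection, Direction.sign, pieceReduced, pieceCost, hS]
          linarith
        · right
          rw [entering_succ, if_neg (by omega), if_pos c]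
    · -- `s_m` has been moved
      rw [if_neg (by omega)] at hm hS
      rw [if_pos (by omega)] at hm hT
      rcases hb.cases with hb | rfl | rfl | rfl | rfl
      · left
        -- The inner gadget is full, and its gap is `full m / 3` up to `a m`, whatever the outer
        -- gap. Undoing its last unit, of cost about `(full m - 1) / 3`, does not pay; the `a m`
        -- saved in `hboundm` absorbs the perturbation.
        rcases ih hb with h1 | ⟨h1, h2⟩ | ⟨j, h1, h2⟩
        · exact h1
        · omega
        · have h3 := (hboundm j (by omega)).2
          have h4 : (j : ℚ) + 1 = full m := by
            have : j + 1 = full m := by omega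
            exact_mod_cast this
          rcases h2 with h2 | rfl
          · linarith
          · rw [hrl.2 j h1]
            linarith
      · refine Or.inr (Or.inr ⟨full m, by omega, Or.inr ?_⟩)
        rw [leaving_succ, if_neg (by omega), if_pos rfl]
      · exact absurd (show κ (m + 1) ≤ full m + 1 by omega) ht
      · refine Or.inr (Or.inl ⟨by omega, Or.inr ?_⟩)
        rw [entering_succ, if_neg (by omega), if_neg (by omega), if_pos c]
      · exact absurd (show ¬ κ (m + 1) ≤ full m by omega) ht
    · -- both `s_m` and `t_m` have been moved
      rw [if_neg (by omega)] at hm hS hT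
      rw [if_neg (by omega)] at hm
      rcases hb.cases with hb | rfl | rfl | rfl | rfl
      · rcases ih hb with h1 | ⟨h1, h2⟩ | ⟨j, h1, h2⟩
        · exact Or.inl h1
        · refine Or.inr (Or.inr ⟨κ (m + 1) - 1, by omega, ?_⟩)
          rw [leaving_succ]
          simp only [unitCost]
          rw [if_neg (by omega), if_neg (by omega), if_neg (by omega), if_neg (by omega),
            if_neg (by omega), if_neg (by omega)]
          rw [show 2 * full m + 1 - (κ (m + 1) - 1) = κ m by omega]
          refine h2.imp_left fun h2 => ?_
          linarith
        · refine Or.inr (Or.inl ⟨by omega, ?_⟩)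
          rw [entering_succ]
          simp only [unitCost]
          rw [if_neg (by omega), if_neg (by omega), if_neg (by omega), if_neg (by omega),
            if_neg (by omega), if_neg (by omega)]
          rw [show 2 * full m + 1 - κ (m + 1) = j by omega]
          refine h2.imp_left fun h2 => ?_
          linarith
      · refine Or.inr (Or.inr ⟨κ (m + 1) - 1, by omega, Or.inl ?_⟩)
        have h1 := (hbound (κ (m + 1) - 1) (by omega)).1
        have h2 : (full m : ℚ) + 1 ≤ (κ (m + 1) - 1 : ℕ) := by
          have : full m + 1 ≤ κ (m + 1) - 1 := by omega
          exact_mod_cast this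
        simp only [residualCost, pieceDirection, Direction.sign, pieceReduced, pieceCost, hS]
        linarith
      · refine Or.inr (Or.inr ⟨κ (m + 1) - 1, by omega, ?_⟩)
        by_cases c2 : κ (m + 1) - 1 = full m + 1
        · right
          rw [leaving_succ, if_neg (by omega), if_neg (by omega), if_pos c2]
        · left
          have h1 := (hbound (κ (m + 1) - 1) (by omega)).1
          have h2 : (full m : ℚ) + 2 ≤ (κ (m + 1) - 1 : ℕ) := by
            have : full m + 2 ≤ κ (m + 1) - 1 := by omega
            exact_mod_cast this
          simp only [residualCost, pieceDirection, Direction.sign, pieceReduced, pieceCost, hT]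
          linarith
      · exact absurd (show ¬ κ (m + 1) ≤ full m + 1 by omega) ht
      · exact absurd (show ¬ κ (m + 1) ≤ full m by omega) ht

end PartitionNetwork

namespace PartitionNetwork

open Network

/-! ### Exchanges at the node `c` and signed sums -/

theorem exchange_succ (m k : ℕ) : exchange (m + 1) k =
    if k < full m then exchange m k else if k = full m then .left m
    else if k = full m + 1 then .right m else exchange m (2 * full m + 1 - k) := rfl

theorem orient_succ (m k : ℕ) : orient (m + 1) k =
    if k < full m then orient m k else if k ≤ full m + 1 then true
    else !orient m (2 * full m + 1 - k) := rfl

/-- The cost of an exchange at the node `c` in terms of the signed sum `w`. -/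
def IsCenterCost (a : ℕ → ℚ) (ε : ℚ) (m k : ℕ) (w : ℚ) : Prop :=
  ∀ g : Side, unitCost a ε g m k = k / 3 + g.sign * w + (if orient m k then 1 else -1) * (ε / 5)

theorem IsCenterCost.of_lt {a : ℕ → ℚ} {ε : ℚ} {m k : ℕ} {w : ℚ} (h : IsCenterCost a ε m k w)
    (hk : k < full m) : IsCenterCost a ε (m + 1) k (w + a m) := by
  intro g
  simp only [unitCost, orient_succ, if_pos hk, h g]
  ring

/-- The unit undoes inner unit `j`, so both `w` and the orientation change sign; the inner and outer
arcs of the level together contribute `- a m`. -/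
theorem IsCenterCost.of_gt {a : ℕ → ℚ} {ε : ℚ} {m k j : ℕ} {w : ℚ} (h : IsCenterCost a ε m j w)
    (hk : full m + 1 < k) (hj : j + k = 2 * full m + 1) :
    IsCenterCost a ε (m + 1) k (-w - a m) := by
  intro g
  have h1 : 2 * full m + 1 - k = j := by omega
  have h2 : (j : ℚ) + k = 2 * full m + 1 := by exact_mod_cast hj
  simp only [unitCost, orient_succ, if_neg (show ¬ k < full m by omega),
    if_neg (show ¬ k = full m by omega), if_neg (show ¬ k = full m + 1 by omega),
    if_neg (show ¬ k ≤ full m + 1 by omega), h1, h g]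
  have h3 : (k : ℚ) = 2 * full m + 1 - j := by linarith
  rw [h3]
  cases orient m j <;> simp <;> ring

/-- The phase of each level decides the sign of its `a m`, and a reversed phase flips all lower
signs. -/
theorem exists_signs_of_center (a : ℕ → ℚ) (ε : ℚ) (m k : ℕ) (hk : k < full m)
    (hx : exchange m k = .center) :
    ∃ s : ℕ → Bool, IsCenterCost a ε m k (∑ i ∈ Finset.range m, if s i then a i else -a i) := by
  induction m generalizing k with
  | zero =>
    simp only [full, Nat.lt_one_iff] at hk
    subst hk
    exact ⟨fun _ => true, fun g => by simp [unitCost, orient]⟩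
  | succ m ih =>
    have hsum : ∀ (s : ℕ → Bool) (c : Bool),
        ∑ i ∈ Finset.range m, (if (if i = m then c else s i) then a i else -a i) =
          ∑ i ∈ Finset.range m, if s i then a i else -a i := by
      intro s c
      refine Finset.sum_congr rfl fun i hi => ?_
      rw [if_neg (Finset.mem_range.1 hi).ne]
    simp only [full] at hk
    rw [exchange_succ] at hx
    split_ifs at hx with c1 c2 c3
    obtain ⟨s, hs⟩ := ih k c1 hx
    · refine ⟨fun i => if i = m then true else s i, ?_⟩
      rw [Finset.sum_range_succ, hsum]
      simpa using hs.of_lt c1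
    · obtain ⟨s, hs⟩ := ih _ (by omega) hx
      refine ⟨fun i => if i = m then false else !s i, ?_⟩
      have h1 := hs.of_gt (k := k) (by omega) (by omega)
      rw [Finset.sum_range_succ, hsum]
      convert h1 using 1
      rw [← Finset.sum_neg_distrib]
      simp only [if_true, Bool.false_eq_true, if_false]
      rw [sub_eq_add_neg]
      congr 1
      refine Finset.sum_congr rfl fun i _ => ?_
      cases s i <;> simp

theorem exists_center_of_signs (a : ℕ → ℚ) (ε : ℚ) (m : ℕ) (s : ℕ → Bool) :
    ∃ k < full m, exchange m k = .center ∧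
      IsCenterCost a ε m k (∑ i ∈ Finset.range m, if s i then a i else -a i) := by
  induction m generalizing s with
  | zero => exact ⟨0, by simp [full], rfl, fun g => by simp [unitCost, orient]⟩
  | succ m ih =>
    cases hsm : s m
    -- A negative top sign requires the reversed phase, which negates the inner sum; so the flipped
    -- signs are requested there.
    · obtain ⟨k, hk, hx, hc⟩ := ih (fun i => !s i)
      refine ⟨2 * full m + 1 - k, by simp only [full]; omega, ?_, ?_⟩
      · rw [exchange_succ, if_neg (by omega), if_neg (by omega), if_neg (by omega)]
        rw [show 2 * full m + 1 - (2 * full m + 1 - k) = k by omega, hx]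
      · have h1 := hc.of_gt (k := 2 * full m + 1 - k) (by omega) (by omega)
        rw [Finset.sum_range_succ, hsm]
        convert h1 using 1
        rw [← Finset.sum_neg_distrib]
        simp only [Bool.false_eq_true, if_false]
        rw [sub_eq_add_neg]
        congr 1
        refine Finset.sum_congr rfl fun i _ => ?_
        cases s i <;> simp
    · obtain ⟨k, hk, hx, hc⟩ := ih s
      refine ⟨k, by simp only [full]; omega, by rw [exchange_succ, if_pos hk, hx], ?_⟩
      rw [Finset.sum_range_succ, hsm]
      simpa using hc.of_lt hk

/-- A detour has an unperturbed cost free of `ε`, and all further perturbations carry the sign of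
the gadget, so they cancel in the sum over both gadgets. -/
theorem unitCost_of_ne_center {a : ℕ → ℚ} (ha : ∀ i, 0 ≤ a i) (ε : ℚ) (m k : ℕ) (hk : k < full m)
    (hx : exchange m k ≠ .center) :
    unitCost a ε .plus m k + unitCost a ε .minus m k = 2 * k / 3 ∧
      ∀ g, |unitCost a ε g m k - k / 3| ≤ ∑ i ∈ Finset.range m, a i := by
  induction m generalizing k with
  | zero => exact absurd rfl hx
  | succ m ih =>
    have h0 : 0 ≤ ∑ i ∈ Finset.range m, a i := Finset.sum_nonneg fun i _ => ha i
    have h2 := ha m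
    simp only [full] at hk
    rw [Finset.sum_range_succ]
    rw [exchange_succ] at hx
    simp only [unitCost]
    split_ifs at hx ⊢ with c1 c2 c3
    · obtain ⟨h3, h4⟩ := ih k c1 hx
      refine ⟨?_, fun g => ?_⟩
      · simp only [Side.sign]
        linarith
      · have h5 := abs_le.1 (h4 g)
        have h1 := g.sign_mul_le (ha m)
        rw [abs_le]
        constructor <;> linarith
    · subst c2
      refine ⟨by ring, fun g => ?_⟩
      rw [sub_self, abs_zero]
      linarith
    · rw [c3]
      push_cast
      refine ⟨by ring, fun g => ?_⟩
      rw [sub_self, abs_zero]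
      linarith
    · obtain ⟨j, hj⟩ : ∃ j, j = 2 * full m + 1 - k := ⟨_, rfl⟩
      have h4 : (k : ℚ) + j = 2 * full m + 1 := by
        have : k + j = 2 * full m + 1 := by omega
        exact_mod_cast this
      rw [← hj] at hx ⊢
      obtain ⟨h3, h5⟩ := ih j (by omega) hx
      refine ⟨?_, fun g => ?_⟩
      · simp only [Side.sign]
        linarith
      · have h5 := abs_le.1 (h5 g)
        have h1 := g.sign_mul_le (ha m)
        rw [abs_le]
        constructor <;> linarith

/-! ### The potentials at the node `c` -/

/-- Gadgets in equal states have trees of the same shape above `c`, so a level changes the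
difference by at most `a m`. The maximum is needed because a moved node takes its potential from the
other side. -/
theorem potential_sub_le {a : ℕ → ℚ} (ha : ∀ i, 0 ≤ a i) (m : ℕ) (κ : ℕ → ℕ) (S T : Side → ℕ → ℚ)
    (h : ∀ g, IsPotential a g m κ (S g) (T g)) :
    |S .plus 0 - S .minus 0| ≤
        max |S .plus m - S .minus m| |T .plus m - T .minus m| + ∑ i ∈ Finset.range m, a i ∧
      |T .plus 0 - T .minus 0| ≤
        max |S .plus m - S .minus m| |T .plus m - T .minus m| + ∑ i ∈ Finset.range m, a i := by
  induction m with
  | zero => simp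
  | succ m ih =>
    obtain ⟨h1, h2⟩ := ih fun g => (h g).pred
    have key : max |S .plus m - S .minus m| |T .plus m - T .minus m| ≤
        max |S .plus (m + 1) - S .minus (m + 1)| |T .plus (m + 1) - T .minus (m + 1)| + a m := by
      have e1 := abs_le.1 (le_max_left |S .plus (m + 1) - S .minus (m + 1)|
        |T .plus (m + 1) - T .minus (m + 1)|)
      have e2 := abs_le.1 (le_max_right |S .plus (m + 1) - S .minus (m + 1)|
        |T .plus (m + 1) - T .minus (m + 1)|)
      have := ha m
      refine max_le ?_ ?_
      · rw [(h .plus).left m (by omega), (h .minus).left m (by omega), abs_le]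
        simp only [Side.sign]
        split_ifs <;> constructor <;> linarith
      · rw [(h .plus).right m (by omega), (h .minus).right m (by omega), abs_le]
        simp only [Side.sign]
        split_ifs <;> constructor <;> linarith
    rw [Finset.sum_range_succ]
    constructor <;> linarith

/-- Next to an exchange at `c`, every level has either none or both of its inner end nodes moved. In
both cases the perturbations of `S` and `T` cancel in the sum. -/
theorem potential_add_eq (a : ℕ → ℚ) (m k : ℕ) (κ : ℕ → ℕ) (S T : Side → ℕ → ℚ)
    (h : ∀ g, IsPotential a g m κ (S g) (T g)) (hκ : Coherent m κ) (hk : k < full m)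
    (hx : exchange m k = .center) (hkm : κ m = k ∨ κ m = k + 1) :
    S .plus 0 - S .minus 0 + (T .plus 0 - T .minus 0) =
      S .plus m - S .minus m + (T .plus m - T .minus m) := by
  induction m generalizing k with
  | zero => rfl
  | succ m ih =>
    have hm := hκ.1 m (by omega)
    have hf := hκ.2
    simp only [full] at hf hk
    unfold substate at hm
    rw [exchange_succ] at hx
    have e1 := (h .plus).left m (by omega)
    have e2 := (h .minus).left m (by omega)
    have e3 := (h .plus).right m (by omega)
    have e4 := (h .minus).right m (by omega)
    simp only [Side.sign] at e1 e2 e3 e4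
    split_ifs at hx with c1 c2 c3
    · rw [if_pos (by omega)] at hm
      rw [ih k (fun g => (h g).pred) hκ.pred c1 hx (by omega)]
      rw [if_pos (by omega)] at e1 e2 e3 e4
      rw [e1, e2, e3, e4]
      ring
    · rw [if_neg (by omega), if_neg (by omega)] at hm
      rw [ih _ (fun g => (h g).pred) hκ.pred (by omega) hx (by omega)]
      rw [if_neg (by omega)] at e1 e2 e3 e4
      rw [e1, e2, e3, e4]
      ring

/-- In an empty gadget `c⁺` hangs on the chain of the `s_i` and `c⁻` on that of the `t_i`, so only
one boundary potential matters. -/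
theorem centerPotential_eq_of_zero (a : ℕ → ℚ) (ε : ℚ) (g : Side) (m : ℕ) (κ κ' : ℕ → ℕ)
    (S T S' T' : ℕ → ℚ) (h : IsPotential a g m κ S T) (h' : IsPotential a g m κ' S' T')
    (hκ : Coherent m κ) (he : ∀ i ≤ m, κ i = κ' i) (hm : κ m = 0)
    (hst : match g with
      | .plus => S m = S' m
      | .minus => T m = T' m) :
    centerPotential ε g κ S T = centerPotential ε g κ' S' T' := by
  induction m with
  | zero =>
    have h0 := he 0 le_rfl
    have h0' : κ' 0 = 0 := by omega
    cases g <;> simp only at hst <;> simp [centerPotential, hm, h0', hst]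
  | succ m ih =>
    have hm1 := hκ.1 m (by omega)
    have hf := full_pos m
    have h1 := he (m + 1) le_rfl
    unfold substate at hm1
    rw [if_pos (by omega)] at hm1
    refine ih h.pred h'.pred hκ.pred (fun i hi => he i (by omega)) (by omega) ?_
    cases g <;> simp only at hst ⊢
    · rw [h.left m (by omega), h'.left m (by omega), if_pos (by omega), if_pos (by omega), hst]
    · rw [h.right m (by omega), h'.right m (by omega), if_pos (by omega), if_pos (by omega), hst]

/-- A full gadget is an empty one with crossed connections at the top level, so the opposite
boundary potential matters. -/
theorem centerPotential_eq_of_full (a : ℕ → ℚ) (ε : ℚ) (g : Side) (m : ℕ) (κ κ' : ℕ → ℕ)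
    (S T S' T' : ℕ → ℚ) (h : IsPotential a g m κ S T) (h' : IsPotential a g m κ' S' T')
    (hκ : Coherent m κ) (he : ∀ i ≤ m, κ i = κ' i) (hm : κ m = full m)
    (hst : match g with
      | .plus => T m = T' m
      | .minus => S m = S' m) :
    centerPotential ε g κ S T = centerPotential ε g κ' S' T' := by
  cases m with
  | zero =>
    have h0 := he 0 le_rfl
    simp only [full] at hm
    have h0' : κ' 0 = 1 := by omega
    cases g <;> simp only at hst <;> simp [centerPotential, hm, h0', hst]
  | succ m =>
    have hm1 := hκ.1 m (by omega)
    have hf := full_pos m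
    have h1 := he (m + 1) le_rfl
    simp only [full] at hm
    unfold substate at hm1
    rw [if_neg (by omega), if_neg (by omega)] at hm1
    refine centerPotential_eq_of_zero a ε g m κ κ' S T S' T' h.pred h'.pred hκ.pred
      (fun i hi => he i (by omega)) (by omega) ?_
    cases g <;> simp only at hst ⊢
    · rw [h.left m (by omega), h'.left m (by omega), if_neg (by omega), if_neg (by omega), hst]
    · rw [h.right m (by omega), h'.right m (by omega), if_neg (by omega), if_neg (by omega), hst]

/-- How an exchange affects the potential of the node `c`. -/
def CenterChange (ε : ℚ) (g : Side) (κ κ' : ℕ → ℕ) (S T S' T' : ℕ → ℚ) : Exchange → Prop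
  | .center => S 0 = S' 0 ∧ T 0 = T' 0 ∧ ((κ 0 = 0 ∧ κ' 0 ≠ 0) ∨ (κ 0 ≠ 0 ∧ κ' 0 = 0))
  | .left _ => g = .plus → centerPotential ε g κ S T = centerPotential ε g κ' S' T'
  | .right _ => g = .minus → centerPotential ε g κ S T = centerPotential ε g κ' S' T'

theorem CenterChange.symm {ε : ℚ} {g : Side} {κ κ' : ℕ → ℕ} {S T S' T' : ℕ → ℚ} {x : Exchange}
    (h : CenterChange ε g κ κ' S T S' T' x) : CenterChange ε g κ' κ S' T' S T x := by
  cases x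
  · exact ⟨h.1.symm, h.2.1.symm, by have := h.2.2; tauto⟩
  · exact fun hg => (h hg).symm
  · exact fun hg => (h hg).symm

/-- A detour happens while the inner gadget is full. Then `c⁺` hangs on the `t` side and does not
notice that `s_m` moves; likewise `c⁻` does not notice that `t_m` moves. -/
theorem centerChange_exchange (a : ℕ → ℚ) (ε : ℚ) (g : Side) (m : ℕ) (κ κ' : ℕ → ℕ)
    (S T S' T' : ℕ → ℚ) (h : IsPotential a g m κ S T) (h' : IsPotential a g m κ' S' T')
    (hκ : Coherent m κ) (hκ' : Coherent m κ') (hs : κ' m = κ m + 1) (hS : S m = S' m)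
    (hT : T m = T' m) : CenterChange ε g κ κ' S T S' T' (exchange m (κ m)) := by
  induction m generalizing κ κ' S T S' T' with
  | zero =>
    have := hκ'.2
    simp only [full] at this
    exact ⟨hS, hT, by omega⟩
  | succ m ih =>
    have hm := hκ.1 m (by omega)
    have hm' := hκ'.1 m (by omega)
    have hf := hκ'.2
    have e1 := h.left m (by omega)
    have e2 := h'.left m (by omega)
    have e3 := h.right m (by omega)
    have e4 := h'.right m (by omega)
    have hcong := hκ.pred.eq_of_le hκ'.pred
    rw [exchange_succ]
    unfold substate at hm hm'
    simp only [full] at hf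
    split_ifs with c1 c2 c3
    · rw [if_pos (by omega)] at hm hm' e1 e2 e3 e4
      rw [← hm]
      exact ih κ κ' S T S' T' h.pred h'.pred hκ.pred hκ'.pred (by omega) (by rw [e1, e2, hS])
        (by rw [e3, e4, hT])
    · rintro rfl
      rw [if_pos (by omega)] at hm
      rw [if_neg (by omega), if_pos (by omega)] at hm'
      rw [if_pos (by omega)] at e3 e4
      exact centerPotential_eq_of_full a ε .plus m κ κ' S T S' T' h.pred h'.pred hκ.pred
        (hcong (by omega)) (by omega) (by simp only; rw [e3, e4, hT])
    · rintro rfl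
      rw [if_neg (by omega), if_pos (by omega)] at hm
      rw [if_neg (by omega), if_neg (by omega)] at hm'
      rw [if_neg (by omega)] at e1 e2
      exact centerPotential_eq_of_full a ε .minus m κ κ' S T S' T' h.pred h'.pred hκ.pred
        (hcong (by omega)) (by omega) (by simp only; rw [e1, e2, hT])
    · rw [if_neg (by omega), if_neg (by omega)] at hm hm'
      rw [if_neg (by omega)] at e1 e2 e3 e4
      rw [show 2 * full m + 1 - κ (m + 1) = κ' m by omega]
      exact (ih κ' κ S' T' S T h'.pred h.pred hκ'.pred hκ.pred (by omega) (by rw [e1, e2, hT])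
        (by rw [e3, e4, hS])).symm

/-! ### The reduced cost of the arc `e` -/

/-- The non-tree arc at the node `c`. -/
def centerArc (g : Side) (κ : ℕ → ℕ) : Piece :=
  if κ 0 = 0 then Exchange.center.low g else Exchange.center.high g

theorem centerArc_inRange (g : Side) (κ : ℕ → ℕ) (m : ℕ) : (centerArc g κ).InRange m := by
  unfold centerArc
  cases g <;> split_ifs <;> simp [Exchange.low, Exchange.high, Piece.InRange]

theorem centerArc_not_mem (g : Side) (κ : ℕ → ℕ) : ¬ PieceInTree g κ (centerArc g κ) := by
  unfold centerArc
  cases g <;> split_ifs with h <;> simp [Exchange.low, Exchange.high, PieceInTree, h]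

/-- Expresses the reduced cost of `e` through the two non-tree arcs at `c⁺` and `c⁻`, whose reduced
costs are controlled. The gain of `ε / 5` arises because `e` bypasses the two arcs of cost `ε / 5`.
-/
theorem centerPotential_sub (a : ℕ → ℚ) (ε : ℚ) (κ : ℕ → ℕ) (S T : Side → ℕ → ℚ) :
    centerPotential ε .plus κ (S .plus) (T .plus) - centerPotential ε .minus κ (S .minus) (T .minus)
      = (residualCost a ε .plus κ (S .plus) (T .plus) (centerArc .plus κ) +
          residualCost a ε .minus κ (S .minus) (T .minus) (centerArc .minus κ)) / 2 - ε / 5 +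
        (S .plus 0 - S .minus 0 + (T .plus 0 - T .minus 0)) / 2 := by
  by_cases h : κ 0 = 0
  · simp only [centerPotential, residualCost, centerArc, Exchange.low, pieceDirection,
      Direction.sign, pieceReduced, pieceCost, if_pos h]
    ring
  · simp only [centerPotential, residualCost, centerArc, Exchange.high, pieceDirection,
      Direction.sign, pieceReduced, pieceCost, if_neg h]
    ring

theorem exchange_eq_center_of_entering {g : Side} {m k : ℕ} {κ : ℕ → ℕ}
    (h : centerArc g κ = entering g m k ∨ centerArc g κ = leaving g m k) :
    exchange m k = .center := by
  unfold centerArc entering leaving at h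
  cases hx : exchange m k
  · rfl
  all_goals
    rw [hx] at h
    cases g <;> split_ifs at h <;> simp [Exchange.low, Exchange.high] at h

/-- The entering arc lies outside the tree, and only one of the two gadget arcs at `c` does. This
avoids computing `orient`. -/
theorem entering_eq_centerArc (g : Side) (m : ℕ) (κ : ℕ → ℕ) (hκ : Coherent m κ)
    (hk : κ m < full m) (hx : exchange m (κ m) = .center) :
    entering g m (κ m) = centerArc g κ := by
  have h1 := (step_succ g hκ (coherent_levels (k := κ m + 1) (by omega))
    (by simp [levels, descend_self])).p_before
  unfold entering centerArc at *
  rw [hx] at h1 ⊢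
  generalize orient m (κ m) = o at h1 ⊢
  cases g <;> cases o <;> by_cases h0 : κ 0 = 0 <;>
    simp_all [Exchange.low, Exchange.high, PieceInTree]

theorem leaving_eq_centerArc (g : Side) (m k : ℕ) (κ : ℕ → ℕ) (hκ : Coherent m κ)
    (hk : κ m = k + 1) (hx : exchange m k = .center) :
    leaving g m k = centerArc g κ := by
  have hf := hκ.2
  have h2 : levels m k m = k := by simp [levels, descend_self]
  have h1 := (step_succ g (coherent_levels (n := m) (k := k) (by omega)) hκ
    (by rw [h2, hk])).q_after
  rw [h2] at h1
  unfold leaving centerArc at *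
  rw [hx] at h1 ⊢
  generalize orient m k = o at h1 ⊢
  cases g <;> cases o <;> by_cases h0 : κ 0 = 0 <;>
    simp_all [Exchange.low, Exchange.high, PieceInTree]

end PartitionNetwork

namespace PartitionNetwork

open Network

/-! ### Bounds for the reduced cost of the arc `e` -/

/-- The perturbations of the costs are small. -/
structure IsSmall (a : ℕ → ℚ) (ε : ℚ) (n : ℕ) : Prop where
  nonneg : ∀ i, 0 ≤ a i
  pos : 0 < ε
  le : ε ≤ 1 / 12
  sum : ∑ i ∈ Finset.range n, a i < 1 / 12

theorem IsSmall.sum_le {a : ℕ → ℚ} {ε : ℚ} {n : ℕ} (h : IsSmall a ε n) :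
    ε / 5 + ∑ i ∈ Finset.range n, a i ≤ 1 / 10 := by
  linarith [h.le, h.sum]

theorem IsSmall.unitCost_bounds {a : ℕ → ℚ} {ε : ℚ} {n : ℕ} (h : IsSmall a ε n) (g : Side) {k : ℕ}
    (hk : k < full n) :
    k / 3 - 1 / 10 ≤ unitCost a ε g n k ∧ unitCost a ε g n k ≤ k / 3 + 1 / 10 := by
  have := abs_le.1 ((abs_unitCost_sub_le h.nonneg h.pos.le g n k hk).trans h.sum_le)
  constructor <;> linarith

theorem IsPotential.eq_zero {a : ℕ → ℚ} {g : Side} {m : ℕ} {κ : ℕ → ℕ} {S T S' T' : ℕ → ℚ}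
    (h : IsPotential a g m κ S T) (h' : IsPotential a g m κ S' T') (hS : S m = S' m)
    (hT : T m = T' m) : S 0 = S' 0 ∧ T 0 = T' 0 := by
  induction m with
  | zero => exact ⟨hS, hT⟩
  | succ m ih =>
    refine ih h.pred h'.pred ?_ ?_
    · rw [h.left m (by omega), h'.left m (by omega), hS, hT]
    · rw [h.right m (by omega), h'.right m (by omega), hS, hT]

/-- The potentials of a pair of gadgets with a gap `z` between source and sink. -/
structure IsPotentialPair (a : ℕ → ℚ) (n : ℕ) (z : ℚ) (κ : Side → ℕ → ℕ) (S T : Side → ℕ → ℚ) :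
    Prop where
  pot : ∀ g, IsPotential a g n (κ g) (S g) (T g)
  source : ∀ g, S g n = 0
  sink : ∀ g, T g n = z

theorem exists_isPotentialPair (a : ℕ → ℚ) (n : ℕ) (z : ℚ) (κ : Side → ℕ → ℕ) :
    ∃ S T, IsPotentialPair a n z κ S T := by
  choose S T h using fun g => exists_isPotential a g n (κ g) 0 z
  exact ⟨S, T, fun g => (h g).1, fun g => (h g).2.1, fun g => (h g).2.2⟩

/-- The reduced cost of the arc `e`. -/
def middleCost (ε : ℚ) (κ : Side → ℕ → ℕ) (S T : Side → ℕ → ℚ) : ℚ :=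
  centerPotential ε .plus (κ .plus) (S .plus) (T .plus) -
    centerPotential ε .minus (κ .minus) (S .minus) (T .minus)

section

variable {a : ℕ → ℚ} {ε : ℚ} {n : ℕ} {z : ℚ}

theorem IsPotentialPair.diff_bounds {κ : ℕ → ℕ} {S T : Side → ℕ → ℚ}
    (h : IsPotentialPair a n z (fun _ => κ) S T) (ha : ∀ i, 0 ≤ a i) :
    |S .plus 0 - S .minus 0| ≤ ∑ i ∈ Finset.range n, a i ∧
      |T .plus 0 - T .minus 0| ≤ ∑ i ∈ Finset.range n, a i := by
  have h1 := potential_sub_le ha n κ S T h.pot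
  simpa [h.source, h.sink] using h1

/-- Away from exchanges at `c`, both arcs at the centres are worse by `1 / 5` than the next
exchange; `centerPotential_sub` averages the two bounds. -/
theorem middleCost_lower_bound (hs : IsSmall a ε n) (hz : (full n : ℚ) / 3 + 1 ≤ z) {κ : ℕ → ℕ}
    {S T : Side → ℕ → ℚ} (h : IsPotentialPair a n z (fun _ => κ) S T) (hκ : Coherent n κ)
    (hx : κ n < full n → exchange n (κ n) ≠ .center) :
    (κ n : ℚ) / 3 + 1 / 5 - ε / 5 - ∑ i ∈ Finset.range n, a i - z ≤
      middleCost ε (fun _ => κ) S T := by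
  have hkn : (κ n : ℚ) ≤ full n := by exact_mod_cast hκ.2
  -- `v` is the cost of the next unit; when the gadgets are full, `k / 3` replaces it.
  obtain ⟨v, hv, hvu⟩ : ∃ v : Side → ℚ, v .plus + v .minus = 2 * κ n / 3 ∧ ∀ g,
      (κ n < full n → v g = unitCost a ε g n (κ n)) ∧ v g ≤ κ n / 3 + 1 / 10 := by
    by_cases hk : κ n < full n
    · exact ⟨fun g => unitCost a ε g n (κ n),
        (unitCost_of_ne_center hs.nonneg ε n _ hk (hx hk)).1,
        fun g => ⟨fun _ => rfl, (hs.unitCost_bounds g hk).2⟩⟩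
    · exact ⟨fun _ => κ n / 3, by ring, fun g => ⟨fun h => absurd h hk, by linarith⟩⟩
  have key : ∀ g, v g + 1 / 5 - z ≤ residualCost a ε g κ (S g) (T g) (centerArc g κ) := by
    intro g
    have hg := (hvu g).2
    rcases residualCost_cases hs.nonneg hs.pos.le g n hs.sum_le κ (S g) (T g) hκ (h.pot g)
      (centerArc g κ) (centerArc_inRange g κ n) (centerArc_not_mem g κ) with h1 | ⟨h1, h2⟩ |
      ⟨j, h1, h2⟩
    · linarith
    · rcases h2 with h2 | h2
      · rw [(hvu g).1 h1]
        rw [h.source, h.sink] at h2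
        linarith
      · exact absurd (exchange_eq_center_of_entering (Or.inl h2)) (hx h1)
    · have hj : j < full n := by have := hκ.2; omega
      have h3 := (hs.unitCost_bounds g hj).2
      have h4 : (κ n : ℚ) = j + 1 := by exact_mod_cast h1
      rcases h2 with h2 | h2
      · rw [h.source, h.sink] at h2
        linarith
      · rw [h2, (residualCost_entering_leaving a ε g n κ (S g) (T g) hκ (h.pot g)).2 j h1,
          h.source, h.sink]
        linarith
  have h1 := key .plus
  have h2 := key .minus
  have h3 := abs_le.1 (h.diff_bounds hs.nonneg).1
  have h4 := abs_le.1 (h.diff_bounds hs.nonneg).2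
  unfold middleCost
  rw [centerPotential_sub a ε κ S T]
  linarith

/-- The signed sums cancel in the average. The arc of gadget `g` therefore exceeds `e` by `g.sign *
w + ε / 5`, which is nonnegative for both signs exactly when `|w| ≤ ε / 5`. -/
theorem middleCost_center {κ : ℕ → ℕ} {S T : Side → ℕ → ℚ}
    (h : IsPotentialPair a n z (fun _ => κ) S T) (hκ : Coherent n κ) (hk : κ n < full n)
    (hx : exchange n (κ n) = .center) {w : ℚ} (hw : IsCenterCost a ε n (κ n) w) :
    middleCost ε (fun _ => κ) S T =
      κ n / 3 + (if orient n (κ n) then 1 else -1) * (ε / 5) - ε / 5 - z := by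
  have h1 := potential_add_eq a n (κ n) κ S T h.pot hκ hk hx (Or.inl rfl)
  have h2 := fun g => (residualCost_entering_leaving a ε g n κ (S g) (T g) hκ (h.pot g)).1 hk
  simp only [h.source, h.sink] at h1 h2
  unfold middleCost
  rw [centerPotential_sub a ε κ S T, h1, ← entering_eq_centerArc .plus n κ hκ hk hx,
    ← entering_eq_centerArc .minus n κ hκ hk hx, h2, h2, hw, hw]
  simp only [Side.sign]
  ring

theorem middleCost_weak_lower_bound (hs : IsSmall a ε n) (hz : (full n : ℚ) / 3 + 1 ≤ z)
    {κ : ℕ → ℕ} {S T : Side → ℕ → ℚ} (h : IsPotentialPair a n z (fun _ => κ) S T)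
    (hκ : Coherent n κ) :
    (κ n : ℚ) / 3 - 2 * ε / 5 - z ≤ middleCost ε (fun _ => κ) S T := by
  by_cases hx : κ n < full n ∧ exchange n (κ n) = .center
  · obtain ⟨s, hw⟩ := exists_signs_of_center a ε n (κ n) hx.1 hx.2
    rw [middleCost_center h hκ hx.1 hx.2 hw]
    have := hs.pos
    split_ifs <;> linarith
  · have := middleCost_lower_bound hs hz h hκ fun h1 h2 => hx ⟨h1, h2⟩
    linarith [hs.sum, hs.le, hs.pos]

/-- If the gadgets are in the same state and the arc `e` has minimum reduced cost, then the next
exchange is at `c`, and the signed sum vanishes up to `ε / 5`. -/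
theorem exists_signs_of_middleCost_le (hs : IsSmall a ε n) (hz : (full n : ℚ) / 3 + 1 ≤ z)
    {κ : ℕ → ℕ} {S T : Side → ℕ → ℚ} (h : IsPotentialPair a n z (fun _ => κ) S T)
    (hκ : Coherent n κ) (hk : κ n < full n)
    (hle : ∀ g, middleCost ε (fun _ => κ) S T ≤ unitCost a ε g n (κ n) - z) :
    ∃ s : ℕ → Bool, |∑ i ∈ Finset.range n, if s i then a i else -a i| ≤ ε / 5 := by
  by_cases hx : exchange n (κ n) = .center
  · obtain ⟨s, hw⟩ := exists_signs_of_center a ε n (κ n) hk hx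
    refine ⟨s, ?_⟩
    have h1 := hle .plus
    have h2 := hle .minus
    rw [middleCost_center h hκ hk hx hw, hw] at h1 h2
    simp only [Side.sign] at h1 h2
    rw [abs_le]
    constructor <;> linarith
  · have h1 := middleCost_lower_bound hs hz h hκ fun _ => hx
    have h2 := (unitCost_of_ne_center hs.nonneg ε n _ hk hx).1
    linarith [hle .plus, hle .minus, hs.sum, hs.le]

/-- If one gadget is one unit ahead, then the arc `e` does not have minimum reduced cost. -/
theorem unitCost_lt_middleCost (hs : IsSmall a ε n) (hz : (full n : ℚ) / 3 + 1 ≤ z)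
    (κ κ' : ℕ → ℕ) (hκ : Coherent n κ) (hκ' : Coherent n κ') (hstep : κ' n = κ n + 1) (g : Side)
    {S T : Side → ℕ → ℚ} (h : IsPotentialPair a n z (fun g' => if g' = g then κ else κ') S T) :
    unitCost a ε g n (κ n) - z < middleCost ε (fun g' => if g' = g then κ else κ') S T := by
  have hk : κ n < full n := by have := hκ'.2; omega
  have hk' : (κ n : ℚ) + 1 ≤ full n := by exact_mod_cast hk
  -- The mixed state is compared with the two uniform states, both gadgets before or both after the
  -- exchange.
  obtain ⟨S₀, T₀, h₀⟩ := exists_isPotentialPair a n z fun _ => κ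
  obtain ⟨S₁, T₁, h₁⟩ := exists_isPotentialPair a n z fun _ => κ'
  have hb := (hs.unitCost_bounds g hk).2
  have hcast : (κ' n : ℚ) = κ n + 1 := by exact_mod_cast hstep
  have hl₁ := middleCost_weak_lower_bound hs hz h₁ hκ'
  have hpos := hs.pos
  have hle := hs.le
  have hsum := hs.sum
  have hcp : ∀ (g' : Side) (κ₁ : ℕ → ℕ) (S T S' T' : ℕ → ℚ), S 0 = S' 0 → T 0 = T' 0 →
      centerPotential ε g' κ₁ S T = centerPotential ε g' κ₁ S' T' := by
    intro g' κ₁ S T S' T' h1 h2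
    cases g' <;> simp [centerPotential, h1, h2]
  have hchange := fun g' => centerChange_exchange a ε g' n κ κ' (S₀ g') (T₀ g') (S₁ g') (T₁ g')
    (h₀.pot g') (h₁.pot g') hκ hκ' hstep (by rw [h₀.source, h₁.source]) (by rw [h₀.sink, h₁.sink])
  have hd := h₀.diff_bounds hs.nonneg
  have hd1 := abs_le.1 hd.1
  have hd2 := abs_le.1 hd.2
  have hpot := h.pot
  have hgs : ∀ g', S g' 0 = (if g' = g then S₀ else S₁) g' 0 ∧
      T g' 0 = (if g' = g then T₀ else T₁) g' 0 := by
    intro g'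
    have h1 := hpot g'
    by_cases hg : g' = g
    · simp only [if_pos hg] at h1 ⊢
      exact h1.eq_zero (h₀.pot g') (by rw [h.source, h₀.source])
        (by rw [h.sink, h₀.sink])
    · simp only [if_neg hg] at h1 ⊢
      exact h1.eq_zero (h₁.pot g') (by rw [h.source, h₁.source])
        (by rw [h.sink, h₁.sink])
  have hplus := hcp .plus (if Side.plus = g then κ else κ') _ _ _ _ (hgs .plus).1 (hgs .plus).2
  have hminus := hcp .minus (if Side.minus = g then κ else κ') _ _ _ _ (hgs .minus).1
    (hgs .minus).2
  have hl₀ : exchange n (κ n) ≠ .center →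
      unitCost a ε g n (κ n) - z < middleCost ε (fun _ => κ) S₀ T₀ := by
    intro hx
    have h1 := middleCost_lower_bound hs hz h₀ hκ fun _ => hx
    have h2 := abs_le.1 ((unitCost_of_ne_center hs.nonneg ε n _ hk hx).2 g)
    linarith
  unfold middleCost at *
  rw [hplus, hminus]
  cases hx : exchange n (κ n) with
  | center =>
    rw [hx] at hchange
    -- Exactly one centre has switched, so `c⁺` and `c⁻` both hang on `s_0` or both on `t_0`. Their
    -- potentials nearly agree, and `e` has reduced cost close to `0`.
    obtain ⟨c1, c2, c3⟩ := hchange .plus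
    obtain ⟨c4, c5, -⟩ := hchange .minus
    cases g
    · simp only [reduceCtorEq, if_true, if_false, centerPotential, ← c4, ← c5]
      rcases c3 with ⟨c3, c3'⟩ | ⟨c3, c3'⟩ <;> simp only [c3, c3', if_true, if_false] <;> linarith
    · simp only [reduceCtorEq, if_true, if_false, centerPotential, ← c1, ← c2]
      rcases c3 with ⟨c3, c3'⟩ | ⟨c3, c3'⟩ <;> simp only [c3, c3', if_true, if_false] <;> linarith
  | left j =>
    rw [hx] at hchange
    -- The potential of `c⁺` is the same before and after, so the mixed state has the value of
    -- whichever uniform state the minus gadget is in.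
    have c := hchange .plus rfl
    have h1 := hl₀ (by simp [hx])
    cases g
    · simp only [reduceCtorEq, if_true, if_false]
      rw [c]
      linarith
    · simp only [reduceCtorEq, if_true, if_false]
      rw [← c]
      exact h1
  | right j =>
    rw [hx] at hchange
    have c := hchange .minus rfl
    have h1 := hl₀ (by simp [hx])
    cases g
    · simp only [reduceCtorEq, if_true, if_false]
      rw [← c]
      exact h1
    · simp only [reduceCtorEq, if_true, if_false]
      rw [c]
      linarith

/-- The last unit undoes the first unit of the inner gadget, and exchange `0` is always at the
centre. -/
theorem exchange_last (n : ℕ) : ∃ j, full (n + 1) = j + 1 ∧ exchange (n + 1) j = .center := by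
  refine ⟨2 * full n + 1, rfl, ?_⟩
  have h0 : ∀ m, exchange m 0 = .center := by
    intro m
    induction m with
    | zero => rfl
    | succ m ih => rw [exchange_succ, if_pos (full_pos m), ih]
  rw [exchange_succ, if_neg (by omega), if_neg (by omega), if_neg (by have := full_pos n; omega),
    show 2 * full n + 1 - (2 * full n + 1) = 0 by omega, h0]

/-- The reduced cost of the arc `e` when both gadgets are full. -/
theorem middleCost_full {κ : ℕ → ℕ} {S T : Side → ℕ → ℚ} (hn : 0 < n)
    (h : IsPotentialPair a n z (fun _ => κ) S T) (hκ : Coherent n κ) (hk : κ n = full n) :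
    middleCost ε (fun _ => κ) S T = z -
      (unitCost a ε .plus n (full n - 1) + unitCost a ε .minus n (full n - 1)) / 2 - ε / 5 := by
  obtain ⟨m, rfl⟩ : ∃ m, n = m + 1 := ⟨n - 1, by omega⟩
  obtain ⟨j, hj, hx⟩ := exchange_last m
  rw [hj, Nat.add_sub_cancel]
  rw [hj] at hk
  have h1 := potential_add_eq a (m + 1) j κ S T h.pot hκ (by omega) hx (Or.inr hk)
  have h2 := fun g => (residualCost_entering_leaving a ε g (m + 1) κ (S g) (T g) hκ (h.pot g)).2 j hk
  simp only [h.source, h.sink] at h1 h2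
  unfold middleCost
  rw [centerPotential_sub a ε κ S T, h1, ← leaving_eq_centerArc .plus (m + 1) j κ hκ hk hx,
    ← leaving_eq_centerArc .minus (m + 1) j κ hκ hk hx, h2, h2]
  ring

end

end PartitionNetwork

namespace PartitionNetwork

open Network

/-! ### Configurations of the whole network -/

/-- Extension of a finite family by zero. -/
def extend {n : ℕ} (F : Fin n → ℚ) (i : ℕ) : ℚ := if h : i < n then F ⟨i, h⟩ else 0

theorem extend_of_lt {n : ℕ} (F : Fin n → ℚ) {i : ℕ} (h : i < n) : extend F i = F ⟨i, h⟩ :=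
  dif_pos h

theorem extend_self {n : ℕ} (F : Fin n → ℚ) : extend F n = 0 := dif_neg (lt_irrefl n)

theorem extend_val {n : ℕ} (F : Fin n → ℚ) (i : Fin n) : extend F i = F i := dif_pos i.2

/-- Extension of a finite family by zero, shifted by one. -/
def extendPred {n : ℕ} (F : Fin n → ℚ) : ℕ → ℚ
  | 0 => 0
  | i + 1 => extend F i

theorem sum_castSucc_ite {n : ℕ} (F : Fin n → ℚ) (j : Fin (n + 1)) :
    (∑ i : Fin n, if i.castSucc = j then F i else 0) = extend F j := by
  cases j using Fin.lastCases with
  | last => simp [Fin.castSucc_ne_last, extend]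
  | cast j => simp [extend]

theorem sum_succ_ite {n : ℕ} (F : Fin n → ℚ) (j : Fin (n + 1)) :
    (∑ i : Fin n, if i.succ = j then F i else 0) = extendPred F j := by
  cases j using Fin.cases with
  | zero => simp [Fin.succ_ne_zero, extendPred]
  | succ j => simp [extendPred, extend]

section

variable {n : ℕ} (a : Fin n → ℚ) (ε : ℚ) (f : Arc n → ℚ)

theorem netOut_s (g : Side) (j : Fin (n + 1)) : (network a ε).netOut f (.s g j) =
    extendPred (fun i => f (.ss g i)) j + extendPred (fun i => f (.outer g i)) j +
      extend (fun i => f (.inner g i)) j + (if (j : ℕ) = 0 then f (.sc g) else 0) -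
      extend (fun i => f (.ss g i)) j - if (j : ℕ) = n then f (.feed g) else 0 := by
  have h0 : ((0 : Fin (n + 1)) = j) ↔ (j : ℕ) = 0 := by
    rw [eq_comm, Fin.ext_iff]
    rfl
  have h1 : (Fin.last n = j) ↔ (j : ℕ) = n := by
    rw [eq_comm, Fin.ext_iff]
    rfl
  cases g <;>
  · simp [Network.netOut, sum_arc, sum_side, network, arcSrc, arcDst, sum_castSucc_ite,
      sum_succ_ite, h0, h1]
    ring

theorem netOut_t (g : Side) (j : Fin (n + 1)) : (network a ε).netOut f (.t g j) =
    extend (fun i => f (.tt g i)) j + (if (j : ℕ) = n then f (.drain g) else 0) -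
      extendPred (fun i => f (.tt g i)) j - extendPred (fun i => f (.inner g i)) j -
      extend (fun i => f (.outer g i)) j - if (j : ℕ) = 0 then f (.ct g) else 0 := by
  have h0 : ((0 : Fin (n + 1)) = j) ↔ (j : ℕ) = 0 := by
    rw [eq_comm, Fin.ext_iff]
    rfl
  have h1 : (Fin.last n = j) ↔ (j : ℕ) = n := by
    rw [eq_comm, Fin.ext_iff]
    rfl
  cases g <;>
  · simp [Network.netOut, sum_arc, sum_side, network, arcSrc, arcDst, sum_castSucc_ite,
      sum_succ_ite, h0, h1]
    ring

theorem netOut_c (g : Side) : (network a ε).netOut f (.c g) =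
    f (.ct g) - f (.sc g) + g.sign * f .e := by
  cases g <;>
  · simp [Network.netOut, sum_arc, network, arcSrc, arcDst, Side.sign]
    try ring

theorem netOut_source : (network a ε).netOut f .source =
    f (.feed .plus) + f (.feed .minus) + f .direct := by
  simp [Network.netOut, sum_arc, sum_side, network, arcSrc, arcDst]

theorem netOut_sink : (network a ε).netOut f .sink =
    -(f (.drain .plus) + f (.drain .minus) + f .direct) := by
  simp [Network.netOut, sum_arc, sum_side, network, arcSrc, arcDst]

end

/-- The arc of the network for an arc of a gadget. -/
def pieceArc (n : ℕ) (g : Side) : (b : Piece) → b.InRange n → Arc n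
  | .ss i, h => .ss g ⟨i, h⟩
  | .tt i, h => .tt g ⟨i, h⟩
  | .outer i, h => .outer g ⟨i, h⟩
  | .inner i, h => .inner g ⟨i, h⟩
  | .sc, _ => .sc g
  | .ct, _ => .ct g

theorem pieceArc_inj {n : ℕ} {g g' : Side} {b b' : Piece} (h : b.InRange n) (h' : b'.InRange n) :
    pieceArc n g b h = pieceArc n g' b' h' ↔ g = g' ∧ b = b' := by
  cases b <;> cases b' <;> simp [pieceArc]
  all_goals exact fun _ => Fin.mk_eq_mk

theorem arc_cases {n : ℕ} (b : Arc n) : (∃ g p h, b = pieceArc n g p h) ∨ (∃ g, b = .feed g) ∨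
    (∃ g, b = .drain g) ∨ b = .direct ∨ b = .e := by
  rcases b with ⟨g, i⟩ | ⟨g, i⟩ | ⟨g, i⟩ | ⟨g, i⟩ | g | g | g | g | _ | _
  · exact Or.inl ⟨g, .ss i, i.2, rfl⟩
  · exact Or.inl ⟨g, .tt i, i.2, rfl⟩
  · exact Or.inl ⟨g, .outer i, i.2, rfl⟩
  · exact Or.inl ⟨g, .inner i, i.2, rfl⟩
  · exact Or.inl ⟨g, .sc, trivial, rfl⟩
  · exact Or.inl ⟨g, .ct, trivial, rfl⟩
  · simp
  · simp
  · simp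
  · simp

/-- The flow when `k g` units have been sent through gadget `g`. -/
def stateFlow {n : ℕ} (k : Side → ℕ) : Arc n → ℚ
  | .ss g i => pieceFlow g (levels n (k g)) (.ss i)
  | .tt g i => pieceFlow g (levels n (k g)) (.tt i)
  | .outer g i => pieceFlow g (levels n (k g)) (.outer i)
  | .inner g i => pieceFlow g (levels n (k g)) (.inner i)
  | .sc g => pieceFlow g (levels n (k g)) .sc
  | .ct g => pieceFlow g (levels n (k g)) .ct
  | .feed g => 1 + k g
  | .drain g => 1 + k g
  | .direct => 2 * full n - k .plus - k .minus
  | .e => 0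

/-- The tree arcs when `k g` units have been sent through gadget `g`. -/
def InStateTree {n : ℕ} (k : Side → ℕ) : Arc n → Prop
  | .ss g i => PieceInTree g (levels n (k g)) (.ss i)
  | .tt g i => PieceInTree g (levels n (k g)) (.tt i)
  | .outer g i => PieceInTree g (levels n (k g)) (.outer i)
  | .inner g i => PieceInTree g (levels n (k g)) (.inner i)
  | .sc g => PieceInTree g (levels n (k g)) .sc
  | .ct g => PieceInTree g (levels n (k g)) .ct
  | .feed _ => True
  | .drain _ => True
  | .direct => True
  | .e => False

open Classical in
/-- The configuration when `k g` units have been sent through gadget `g`. -/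
noncomputable def stateConfiguration (n : ℕ) (k : Side → ℕ) : Configuration (Arc n) where
  tree := Finset.univ.filter (InStateTree k)
  flow := stateFlow k

theorem mem_stateConfiguration {n : ℕ} {k : Side → ℕ} {b : Arc n} :
    b ∈ (stateConfiguration n k).tree ↔ InStateTree k b := by
  simp [stateConfiguration]

theorem stateFlow_pieceArc {n : ℕ} (k : Side → ℕ) (g : Side) (b : Piece) (h : b.InRange n) :
    stateFlow k (pieceArc n g b h) = pieceFlow g (levels n (k g)) b := by
  cases b <;> rfl

theorem inStateTree_pieceArc {n : ℕ} (k : Side → ℕ) (g : Side) (b : Piece) (h : b.InRange n) :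
    InStateTree k (pieceArc n g b h) ↔ PieceInTree g (levels n (k g)) b := by
  cases b <;> rfl

theorem cap_pieceArc {n : ℕ} (a : Fin n → ℚ) (ε : ℚ) (g : Side) (b : Piece) (h : b.InRange n) :
    (network a ε).cap (pieceArc n g b h) = ((pieceCap b : ℚ) : WithTop ℚ) := by
  cases b
  case sc => simp [pieceArc, network, arcCap, pieceCap]
  case ct => simp [pieceArc, network, arcCap, pieceCap]
  all_goals
    simp only [pieceArc, network, arcCap, pieceCap, WithTop.coe_inj]
    push_cast
    rw [full_cast]
    ring

theorem levels_self (n k : ℕ) : levels n k n = k := descend_self _ _ _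

theorem levels_zero (n i : ℕ) : levels n 0 i = 0 := by
  unfold levels
  have h : ∀ m, substate m 0 = 0 := fun m => by simp [substate]
  induction n with
  | zero => rfl
  | succ n ih => simp only [descend, h, ih, ite_self]

theorem initial_eq {n : ℕ} (hn : 0 < n) : initial n = stateConfiguration n fun _ => 0 := by
  have h1 : (initial n).tree = (stateConfiguration n fun _ => 0).tree := by
    ext b
    have h : b ∈ (initial n).tree ↔ isInitialTreeArc b = true := by simp [initial]
    rw [mem_stateConfiguration, h]
    rcases b with ⟨g, i⟩ | ⟨g, i⟩ | ⟨g, i⟩ | ⟨g, i⟩ | (_ | _) | (_ | _) | g | g | _ | _ <;>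
      simp [isInitialTreeArc, InStateTree, PieceInTree, levels_zero]
  have h2 : (initial n).flow = (stateConfiguration n fun _ => 0).flow := by
    funext b
    rcases b with ⟨g, i⟩ | ⟨g, i⟩ | ⟨g, i⟩ | ⟨g, i⟩ | (_ | _) | (_ | _) | g | g | _ | _ <;>
      simp [initial, initialFlow, stateConfiguration, stateFlow, pieceFlow, levels_zero]
    obtain ⟨m, rfl⟩ : ∃ m, n = m + 1 := ⟨n - 1, by omega⟩
    rw [full_cast, x, Nat.add_sub_cancel, pow_succ]
    ring
  cases h : initial n
  rw [h] at h1 h2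
  cases h' : stateConfiguration n fun _ => 0
  rw [h'] at h1 h2
  exact congrArg₂ _ h1 h2

/-- A gadget in state `k` passes `1 + k` units, and inside it the next smaller gadget does the same
for its own state. -/
theorem pieceFlow_conservation {n : ℕ} {κ : ℕ → ℕ} (hκ : Coherent n κ) (g : Side) {i : ℕ}
    (hi : i < n) :
    pieceFlow g κ (.ss i) + pieceFlow g κ (.outer i) = 1 + κ (i + 1) ∧
    pieceFlow g κ (.tt i) + pieceFlow g κ (.inner i) = 1 + κ (i + 1) ∧
    pieceFlow g κ (.ss i) - pieceFlow g κ (.inner i) = 1 + κ i ∧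
    pieceFlow g κ (.tt i) - pieceFlow g κ (.outer i) = 1 + κ i := by
  have h1 := hκ.le (i + 1) (by omega)
  have h2 := hκ.1 i hi
  simp only [full] at h1
  unfold substate at h2
  simp only [pieceFlow]
  split_ifs at h2 ⊢ <;> omega

theorem netOut_stateFlow {n : ℕ} (hn : 0 < n) (a : Fin n → ℚ) (ε : ℚ) (k : Side → ℕ)
    (hk : ∀ g, k g ≤ full n) (v : Node n) :
    (network a ε).netOut (stateFlow k) v = nodeSupply v := by
  have hx : 4 * x n = 2 * full n := by
    obtain ⟨m, rfl⟩ : ∃ m, n = m + 1 := ⟨n - 1, by omega⟩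
    rw [full_cast, x, Nat.add_sub_cancel, pow_succ]
    ring
  have hcons : ∀ g i (hi : i < n),
      (stateFlow k (.ss g ⟨i, hi⟩ : Arc n) + stateFlow k (.outer g ⟨i, hi⟩ : Arc n) =
        1 + (levels n (k g) (i + 1) : ℚ)) ∧
      (stateFlow k (.tt g ⟨i, hi⟩ : Arc n) + stateFlow k (.inner g ⟨i, hi⟩ : Arc n) =
        1 + (levels n (k g) (i + 1) : ℚ)) ∧
      (stateFlow k (.ss g ⟨i, hi⟩ : Arc n) - stateFlow k (.inner g ⟨i, hi⟩ : Arc n) =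
        1 + (levels n (k g) i : ℚ)) ∧
      (stateFlow k (.tt g ⟨i, hi⟩ : Arc n) - stateFlow k (.outer g ⟨i, hi⟩ : Arc n) =
        1 + (levels n (k g) i : ℚ)) := by
    intro g i hi
    obtain ⟨h1, h2, h3, h4⟩ := pieceFlow_conservation (coherent_levels (hk g)) g hi
    simp only [stateFlow]
    exact ⟨by exact_mod_cast h1, by exact_mod_cast h2, by exact_mod_cast h3, by exact_mod_cast h4⟩
  have hsc : ∀ g, stateFlow k (.sc g : Arc n) = (match g with
      | .plus => 1
      | .minus => 0) + (levels n (k g) 0 : ℚ) := by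
    rintro (_ | _) <;> simp [stateFlow, pieceFlow]
  have hct : ∀ g, stateFlow k (.ct g : Arc n) = (match g with
      | .plus => 0
      | .minus => 1) + (levels n (k g) 0 : ℚ) := by
    rintro (_ | _) <;> simp [stateFlow, pieceFlow]
  have hfeed : ∀ g, stateFlow k (.feed g : Arc n) = 1 + (levels n (k g) n : ℚ) := by
    intro g
    rw [levels_self]
    rfl
  have hdrain : ∀ g, stateFlow k (.drain g : Arc n) = 1 + (levels n (k g) n : ℚ) := by
    intro g
    rw [levels_self]
    rfl
  rcases v with _ | _ | ⟨g, ⟨j, hj⟩⟩ | ⟨g, ⟨j, hj⟩⟩ | g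
  · rw [netOut_source]
    simp only [stateFlow, nodeSupply, hx]
    ring
  · rw [netOut_sink]
    simp only [stateFlow, nodeSupply, hx]
    ring
  · rw [netOut_s]
    have h1 : extend (fun i => stateFlow k (.ss g i : Arc n)) j -
        extend (fun i => stateFlow k (.inner g i : Arc n)) j +
        (if j = n then stateFlow k (.feed g : Arc n) else 0) = 1 + levels n (k g) j := by
      rcases Nat.lt_or_ge j n with h | h
      · rw [extend_of_lt _ h, extend_of_lt _ h, if_neg h.ne]
        linarith [(hcons g j h).2.2.1]
      · obtain rfl : j = n := by omega
        rw [extend_self, extend_self, if_pos rfl, hfeed]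
        ring
    cases j with
    | zero =>
      simp only [extendPred, if_true, hsc] at h1 ⊢
      cases g <;> simp only [nodeSupply] <;> simp at h1 ⊢ <;> linarith
    | succ j =>
      have h2 := (hcons g j (by omega)).1
      simp only [extendPred] at h1 ⊢
      rw [extend_of_lt _ (show j < n by omega), extend_of_lt _ (show j < n by omega)]
      cases g <;> simp only [nodeSupply] <;> simp [Fin.ext_iff] at h1 ⊢ <;> linarith
  · rw [netOut_t]
    have h1 : extend (fun i => stateFlow k (.tt g i : Arc n)) j -
        extend (fun i => stateFlow k (.outer g i : Arc n)) j +
        (if j = n then stateFlow k (.drain g : Arc n) else 0) = 1 + levels n (k g) j := by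
      rcases Nat.lt_or_ge j n with h | h
      · rw [extend_of_lt _ h, extend_of_lt _ h, if_neg h.ne]
        linarith [(hcons g j h).2.2.2]
      · obtain rfl : j = n := by omega
        rw [extend_self, extend_self, if_pos rfl, hdrain]
        ring
    cases j with
    | zero =>
      simp only [extendPred, if_true, hct] at h1 ⊢
      cases g <;> simp only [nodeSupply] <;> simp at h1 ⊢ <;> linarith
    | succ j =>
      have h2 := (hcons g j (by omega)).2.1
      simp only [extendPred] at h1 ⊢
      rw [extend_of_lt _ (show j < n by omega), extend_of_lt _ (show j < n by omega)]
      cases g <;> simp only [nodeSupply] <;> simp [Fin.ext_iff] at h1 ⊢ <;> linarith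
  · rw [netOut_c, hsc, hct]
    cases g <;> simp [Side.sign, stateFlow, nodeSupply]

end PartitionNetwork

namespace PartitionNetwork

open Network

/-! ### The trees of the configurations -/

section

variable {n : ℕ} (a : Fin n → ℚ) (ε : ℚ)

theorem stateTree_connected (k : Side → ℕ) (u v : Node n) :
    Relation.ReflTransGen ((network a ε).Joined (stateConfiguration n k).tree) u v := by
  set R := (network a ε).Joined (stateConfiguration n k).tree with hR
  have sym : ∀ u v, R u v → R v u := by
    rintro u v ⟨b, hb, h⟩
    exact ⟨b, hb, h.symm⟩
  have arc : ∀ b : Arc n, InStateTree k b → R (arcSrc b) (arcDst b) := fun b hb =>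
    ⟨b, mem_stateConfiguration.2 hb, Or.inl ⟨rfl, rfl⟩⟩
  have key : ∀ v, Relation.ReflTransGen R .source v := by
    have hsink : Relation.ReflTransGen R (.source : Node n) .sink := .single (arc .direct trivial)
    have hst : ∀ g i, Relation.ReflTransGen R (.source : Node n) (.s g i) ∧
        Relation.ReflTransGen R (.source : Node n) (.t g i) := by
      intro g i
      induction i using Fin.reverseInduction with
      | last =>
        exact ⟨.single (arc (.feed g) trivial), hsink.tail (sym _ _ (arc (.drain g) trivial))⟩
      | cast i ih =>
        constructor
        · by_cases h : levels n (k g) (i + 1) ≤ full i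
          · exact ih.1.tail (arc (.ss g i) h)
          · exact ih.2.tail (sym _ _ (arc (.inner g i) h))
        · by_cases h : levels n (k g) (i + 1) ≤ full i + 1
          · exact ih.2.tail (sym _ _ (arc (.tt g i) h))
          · exact ih.1.tail (arc (.outer g i) h)
    rintro (_ | _ | ⟨g, i⟩ | ⟨g, i⟩ | g)
    · exact .refl
    · exact hsink
    · exact (hst g i).1
    · exact (hst g i).2
    · by_cases h : levels n (k g) 0 = 0
      · cases g
        · exact (hst _ 0).1.tail (arc (.sc _) h)
        · exact (hst _ 0).2.tail (sym _ _ (arc (.ct _) h))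
      · cases g
        · exact (hst _ 0).2.tail (sym _ _ (arc (.ct _) h))
        · exact (hst _ 0).1.tail (arc (.sc _) h)
  have hsymm : ∀ u, Relation.ReflTransGen R .source u → Relation.ReflTransGen R u .source := by
    intro u hu
    induction hu with
    | refl => exact .refl
    | tail _ h ih => exact ih.head (sym _ _ h)
  exact (hsymm u (key u)).trans (key v)

/-- A circulation on the tree vanishes. -/
theorem eq_zero_of_netOut_eq_zero (k : Side → ℕ) (f : Arc n → ℚ)
    (hf : ∀ v, (network a ε).netOut f v = 0)
    (hT : ∀ b, b ∉ (stateConfiguration n k).tree → f b = 0) (b : Arc n) : f b = 0 := by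
  have hT' : ∀ b, ¬ InStateTree k b → f b = 0 := fun b hb =>
    hT b fun h => hb (mem_stateConfiguration.1 h)
  have he : f .e = 0 := hT' .e (by simp [InStateTree])
  have hc : ∀ g, f (.sc g) = 0 ∧ f (.ct g) = 0 := by
    intro g
    have h1 := hf (.c g)
    rw [netOut_c, he] at h1
    by_cases h : levels n (k g) 0 = 0
    · cases g
      · have h2 := hT' (.ct .plus) (not_not.2 h)
        exact ⟨by linarith, h2⟩
      · have h2 := hT' (.sc .minus) (not_not.2 h)
        exact ⟨h2, by linarith⟩
    · cases g
      · have h2 := hT' (.sc .plus) h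
        exact ⟨h2, by linarith⟩
      · have h2 := hT' (.ct .minus) h
        exact ⟨by linarith, h2⟩
  -- Induction outwards from the centre: once the arcs below vanish, `s_i` and `t_i` each have two
  -- remaining level arcs, one of which is outside the tree.
  have key : ∀ g (i : ℕ), i ≤ n → (extendPred (fun j => f (.ss g j)) i = 0 ∧
      extendPred (fun j => f (.outer g j)) i = 0 ∧ extendPred (fun j => f (.tt g j)) i = 0 ∧
      extendPred (fun j => f (.inner g j)) i = 0) := by
    intro g i
    induction i with
    | zero => exact fun _ => ⟨rfl, rfl, rfl, rfl⟩
    | succ i ih =>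
      intro hi
      obtain ⟨h1, h2, h3, h4⟩ := ih (by omega)
      have hs := hf (.s g ⟨i, by omega⟩)
      have ht := hf (.t g ⟨i, by omega⟩)
      rw [netOut_s] at hs
      rw [netOut_t] at ht
      simp only [h1, h2, (hc g).1, ite_self, show i ≠ n by omega, if_false,
        extend_of_lt _ (show i < n by omega)] at hs
      simp only [h3, h4, (hc g).2, ite_self, show i ≠ n by omega, if_false,
        extend_of_lt _ (show i < n by omega)] at ht
      simp only [extendPred, extend_of_lt _ (show i < n by omega)]
      have e1 : f (.ss g ⟨i, by omega⟩) = 0 ∧ f (.inner g ⟨i, by omega⟩) = 0 := by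
        by_cases h : levels n (k g) (i + 1) ≤ full i
        · have := hT' (.inner g ⟨i, by omega⟩) (not_not.2 h)
          exact ⟨by linarith, this⟩
        · have := hT' (.ss g ⟨i, by omega⟩) h
          exact ⟨this, by linarith⟩
      have e2 : f (.tt g ⟨i, by omega⟩) = 0 ∧ f (.outer g ⟨i, by omega⟩) = 0 := by
        by_cases h : levels n (k g) (i + 1) ≤ full i + 1
        · have := hT' (.outer g ⟨i, by omega⟩) (not_not.2 h)
          exact ⟨by linarith, this⟩
        · have := hT' (.tt g ⟨i, by omega⟩) h
          exact ⟨this, by linarith⟩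
      exact ⟨e1.1, e2.2, e2.1, e1.2⟩
  have hlev : ∀ g (i : Fin n), f (.ss g i) = 0 ∧ f (.outer g i) = 0 ∧ f (.tt g i) = 0 ∧
      f (.inner g i) = 0 := by
    intro g i
    have h := key g (i + 1) i.2
    simp only [extendPred, extend_val] at h
    exact h
  have hfeed : ∀ g, f (.feed g) = 0 := by
    intro g
    have h1 := hf (.s g (Fin.last n))
    obtain ⟨h2, h3, -, -⟩ := key g n le_rfl
    rw [netOut_s] at h1
    simp only [Fin.val_last, h2, h3, extend_self, (hc g).1, ite_self, if_true] at h1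
    linarith
  have hdrain : ∀ g, f (.drain g) = 0 := by
    intro g
    have h1 := hf (.t g (Fin.last n))
    obtain ⟨-, -, h2, h3⟩ := key g n le_rfl
    rw [netOut_t] at h1
    simp only [Fin.val_last, h2, h3, extend_self, (hc g).2, ite_self, if_true] at h1
    linarith
  have hdirect : f .direct = 0 := by
    have h1 := hf .source
    rw [netOut_source, hfeed, hfeed] at h1
    linarith
  rcases b with ⟨g, i⟩ | ⟨g, i⟩ | ⟨g, i⟩ | ⟨g, i⟩ | g | g | g | g | _ | _
  · exact (hlev g i).1
  · exact (hlev g i).2.2.1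
  · exact (hlev g i).2.1
  · exact (hlev g i).2.2.2
  · exact (hc g).1
  · exact (hc g).2
  · exact hfeed g
  · exact hdrain g
  · exact hdirect
  · exact he

/-- Identifies the cycle flow of a pivot with the difference of two consecutive state flows. -/
theorem isCycleFlow_unique (k : Side → ℕ) {b : Arc n} {d : Direction} {χ χ' : Arc n → ℚ}
    (h : (network a ε).IsCycleFlow (stateConfiguration n k).tree b d χ)
    (h' : (network a ε).IsCycleFlow (stateConfiguration n k).tree b d χ') : χ = χ' := by
  funext c
  have := eq_zero_of_netOut_eq_zero a ε k (fun b => χ b - χ' b)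
    (fun v => by rw [netOut_sub, h.1, h'.1, sub_zero])
    (fun c hc => by
      by_cases hcb : c = b
      · simp only [hcb]
        rw [h.2.1, h'.2.1, sub_self]
      · have : c ∉ insert b (stateConfiguration n k).tree := by simp [hcb, hc]
        rw [h.2.2 c this, h'.2.2 c this, sub_self]) c
  linarith

/-- The potentials of all nodes. -/
def nodePotential (ε z : ℚ) (κ : Side → ℕ → ℕ) (S T : Side → ℕ → ℚ) : Node n → ℚ
  | .source => 0
  | .sink => z
  | .s g i => S g i
  | .t g i => T g i
  | .c g => centerPotential ε g (κ g) (S g) (T g)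

variable (z : ℚ) (κ : Side → ℕ → ℕ) (S T : Side → ℕ → ℚ)

theorem reducedCost_pieceArc (g : Side) (b : Piece) (hb : b.InRange n) :
    (network a ε).reducedCost (nodePotential ε z κ S T) (pieceArc n g b hb) =
      pieceReduced (extend a) ε g (κ g) (S g) (T g) b := by
  cases b
  case sc => cases g <;> simp [pieceArc, reducedCost, network, arcCost, arcSrc, arcDst,
    nodePotential, pieceReduced, pieceCost]
  case ct => cases g <;> simp [pieceArc, reducedCost, network, arcCost, arcSrc, arcDst,
    nodePotential, pieceReduced, pieceCost]
  all_goals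
    simp only [Piece.InRange] at hb
    simp [pieceArc, reducedCost, network, arcCost, arcSrc, arcDst, nodePotential, pieceReduced,
      pieceCost, extend_of_lt _ hb]

theorem reducedCost_e :
    (network a ε).reducedCost (nodePotential ε z κ S T) .e = middleCost ε κ S T := by
  simp [reducedCost, network, arcCost, arcSrc, arcDst, nodePotential, middleCost]

theorem reducedCost_direct :
    (network a ε).reducedCost (nodePotential ε z κ S T) .direct = 2 ^ (n + 1) - z := by
  simp [reducedCost, network, arcCost, arcSrc, arcDst, nodePotential]

theorem reducedCost_feed (g : Side) (hS : S g n = 0) :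
    (network a ε).reducedCost (nodePotential ε z κ S T) (.feed g) = 0 := by
  simp [reducedCost, network, arcCost, arcSrc, arcDst, nodePotential, hS]

theorem reducedCost_drain (g : Side) (hT : T g n = z) :
    (network a ε).reducedCost (nodePotential ε z κ S T) (.drain g) = 0 := by
  simp [reducedCost, network, arcCost, arcSrc, arcDst, nodePotential, hT]

theorem reducedCost_of_inStateTree {a : Fin n → ℚ} {ε z : ℚ} {k : Side → ℕ} {S T : Side → ℕ → ℚ}
    (h : IsPotentialPair (extend a) n z (fun g => levels n (k g)) S T) {b : Arc n}
    (hb : InStateTree k b) (hd : b ≠ .direct) :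
    (network a ε).reducedCost (nodePotential ε z (fun g => levels n (k g)) S T) b = 0 := by
  rcases arc_cases b with ⟨g, p, hp, rfl⟩ | ⟨g, rfl⟩ | ⟨g, rfl⟩ | rfl | rfl
  · rw [reducedCost_pieceArc]
    exact pieceReduced_eq_zero (h.pot g) p hp ((inStateTree_pieceArc _ _ _ _).1 hb)
  · exact reducedCost_feed a ε z _ S T g (h.source g)
  · exact reducedCost_drain a ε z _ S T g (h.sink g)
  · exact absurd rfl hd
  · simp [InStateTree] at hb

end

end PartitionNetwork

namespace PartitionNetwork

open Network

/-! ### The pivots -/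

section

variable {n : ℕ} {a : Fin n → ℚ} {ε : ℚ}

/-- One more unit is sent through the gadget `g`. -/
def advance (k : Side → ℕ) (g : Side) : Side → ℕ := fun g' => if g' = g then k g + 1 else k g'

theorem advance_self (k : Side → ℕ) (g : Side) : advance k g g = k g + 1 := if_pos rfl

theorem stateFlow_bounds (k : Side → ℕ) (hk : ∀ g, k g ≤ full n) (b : Arc n) :
    0 ≤ stateFlow k b ∧ (stateFlow k b : WithTop ℚ) ≤ (network a ε).cap b := by
  rcases arc_cases b with ⟨g, p, hp, rfl⟩ | ⟨g, rfl⟩ | ⟨g, rfl⟩ | rfl | rfl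
  · have h := pieceFlow_bounds g (coherent_levels (hk g)) p hp
    rw [stateFlow_pieceArc, cap_pieceArc, WithTop.coe_le_coe]
    exact ⟨by exact_mod_cast h.1, by exact_mod_cast h.2⟩
  · exact ⟨by simp only [stateFlow]; positivity, by simp [network, arcCap]⟩
  · exact ⟨by simp only [stateFlow]; positivity, by simp [network, arcCap]⟩
  · refine ⟨?_, by simp [network, arcCap]⟩
    have h1 : (k .plus : ℚ) ≤ full n := by exact_mod_cast hk .plus
    have h2 : (k .minus : ℚ) ≤ full n := by exact_mod_cast hk .minus
    simp only [stateFlow]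
    linarith
  · simp only [stateFlow, network, arcCap]
    norm_num

theorem stateTree_cap (k : Side → ℕ) (b : Arc n) (hb : b ∉ (stateConfiguration n k).tree) :
    (network a ε).cap b ≠ ⊤ := by
  rw [mem_stateConfiguration] at hb
  rcases arc_cases b with ⟨g, p, hp, rfl⟩ | ⟨g, rfl⟩ | ⟨g, rfl⟩ | rfl | rfl
  · rw [cap_pieceArc]
    exact WithTop.coe_ne_top
  · exact absurd trivial hb
  · exact absurd trivial hb
  · exact absurd trivial hb
  · exact WithTop.coe_ne_top

theorem isResidual_pieceArc_iff {k : Side → ℕ} (hk : ∀ g, k g ≤ full n) {g : Side} {p : Piece}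
    (hp : p.InRange n) (ht : ¬ PieceInTree g (levels n (k g)) p) (d : Direction) :
    (network a ε).IsResidual (stateFlow k) (pieceArc n g p hp) d ↔ d = pieceDirection g p := by
  rcases pieceFlow_of_not_inTree (coherent_levels (hk g)) ht with ⟨h1, h2⟩ | ⟨h1, h2⟩ <;>
    cases d <;>
    simp only [IsResidual, cap_pieceArc, stateFlow_pieceArc, h1, h2, WithTop.coe_lt_coe] <;>
    simp [pieceCap_pos p]

theorem isResidual_e_iff (k : Side → ℕ) (d : Direction) :
    (network a ε).IsResidual (stateFlow k) .e d ↔ d = .forward := by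
  cases d <;> simp [IsResidual, stateFlow, network, arcCap]

theorem entering_inRange (g : Side) {k : ℕ} (hk : k < full n) : (entering g n k).InRange n := by
  have h := (step_succ g (coherent_levels hk.le) (coherent_levels (k := k + 1) hk)
    (by simp only [levels_self])).p_range
  rwa [levels_self] at h

theorem leaving_inRange (g : Side) {k : ℕ} (hk : k < full n) : (leaving g n k).InRange n := by
  have h := (step_succ g (coherent_levels hk.le) (coherent_levels (k := k + 1) hk)
    (by simp only [levels_self])).q_range
  rwa [levels_self] at h

theorem step_levels (g : Side) {k : ℕ} (hk : k < full n) :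
    Step g n (levels n k) (levels n (k + 1)) (entering g n k) (leaving g n k) := by
  have h := step_succ g (coherent_levels hk.le) (coherent_levels (k := k + 1) hk)
    (by simp only [levels_self])
  rwa [levels_self] at h

theorem advance_le {k : Side → ℕ} (hk : ∀ g, k g ≤ full n) {g : Side} (hg : k g < full n)
    (g' : Side) : advance k g g' ≤ full n := by
  unfold advance
  split_ifs
  · exact hg
  · exact hk g'

theorem stateFlow_advance_pieceArc (k : Side → ℕ) (g : Side) (p : Piece) (hp : p.InRange n) :
    stateFlow (advance k g) (pieceArc n g p hp) = pieceFlow g (levels n (k g + 1)) p := by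
  rw [stateFlow_pieceArc, advance, if_pos rfl]

theorem stateFlow_advance_of_ne (k : Side → ℕ) {g g' : Side} (hg : g' ≠ g) (p : Piece)
    (hp : p.InRange n) :
    stateFlow (advance k g) (pieceArc n g' p hp) = stateFlow k (pieceArc n g' p hp) := by
  rw [stateFlow_pieceArc, stateFlow_pieceArc, advance, if_neg hg]

theorem stateFlow_advance_direct (k : Side → ℕ) (g : Side) :
    stateFlow (advance k g) (.direct : Arc n) = stateFlow k (.direct : Arc n) - 1 := by
  cases g <;> simp [stateFlow, advance] <;> ring

/-- The cycle flow of the next exchange of the gadget `g`. -/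
theorem isCycleFlow_advance (hn : 0 < n) (k : Side → ℕ) (hk : ∀ g, k g ≤ full n) (g : Side)
    (hg : k g < full n) :
    (network a ε).IsCycleFlow (stateConfiguration n k).tree
      (pieceArc n g (entering g n (k g)) (entering_inRange g hg))
      (pieceDirection g (entering g n (k g)))
      (fun b => stateFlow (advance k g) b - stateFlow k b) := by
  have hstep := step_levels g hg
  refine ⟨fun v => ?_, ?_, fun b hb => ?_⟩
  · rw [netOut_sub, netOut_stateFlow hn a ε k hk, netOut_stateFlow hn a ε _ (advance_le hk hg),
      sub_self]
  · simp only
    rw [stateFlow_advance_pieceArc, stateFlow_pieceArc]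
    have h0 := pieceCap_pos (entering g n (k g))
    rcases pieceFlow_of_not_inTree (coherent_levels (hk g)) hstep.p_before with ⟨h1, h2⟩ | ⟨h1, h2⟩
    · have h3 := hstep.p_bound
      rw [h1, (by omega : pieceFlow g (levels n (k g + 1)) (entering g n (k g)) =
        pieceFlow g (levels n (k g)) (entering g n (k g)) + 1)]
      simp [Direction.sign]
    · have h3 := hstep.p_bound
      rw [h1, (by omega : pieceFlow g (levels n (k g + 1)) (entering g n (k g)) =
        pieceFlow g (levels n (k g)) (entering g n (k g)) - 1)]
      simp [Direction.sign]
  · simp only [Finset.mem_insert, mem_stateConfiguration, not_or] at hb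
    rcases arc_cases b with ⟨g', p, hp, rfl⟩ | ⟨g', rfl⟩ | ⟨g', rfl⟩ | rfl | rfl
    · simp only
      by_cases hgg : g' = g
      · subst hgg
        rw [stateFlow_advance_pieceArc, stateFlow_pieceArc]
        have h1 : p ≠ entering g' n (k g') := fun h => hb.1 ((pieceArc_inj _ _).2 ⟨rfl, h⟩)
        have h2 : ¬ PieceInTree g' (levels n (k g')) p :=
          fun h => hb.2 ((inStateTree_pieceArc _ _ _ _).2 h)
        have h3 : p ≠ leaving g' n (k g') := by
          rintro rfl
          exact h2 hstep.q_before
        have h4 := hstep.const p hp h2 fun h => h2 ((hstep.tree p hp h1 h3).2 h)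
        rw [h4, sub_self]
      · rw [stateFlow_advance_of_ne k hgg, sub_self]
    · exact absurd trivial hb.2
    · exact absurd trivial hb.2
    · exact absurd trivial hb.2
    · simp [stateFlow]

/-- Which configurations can follow when the exchange of the gadget `g` is carried out. -/
theorem advance_of_isTight (k : Side → ℕ) (hk : ∀ g, k g ≤ full n) (g : Side)
    (hg : k g < full n) {θ : ℚ} {l : Arc n}
    (hfeas : ∀ b, 0 ≤ stateFlow k b + θ * (stateFlow (advance k g) b - stateFlow k b) ∧
      ((stateFlow k b + θ * (stateFlow (advance k g) b - stateFlow k b) : ℚ) : WithTop ℚ) ≤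
        (network a ε).cap b)
    (htight : (network a ε).IsTight
      (fun b => stateFlow k b + θ * (stateFlow (advance k g) b - stateFlow k b))
      (fun b => stateFlow (advance k g) b - stateFlow k b) l) :
    θ = 1 ∧ (l = pieceArc n g (leaving g n (k g)) (leaving_inRange g hg) ∨
      (l = .direct ∧ ∀ g', advance k g g' = full n)) := by
  have hstep := step_levels g hg
  -- The arc that is to leave reaches its bound exactly at `θ = 1`.
  have hle : θ ≤ 1 := by
    have h1 := hfeas (pieceArc n g (leaving g n (k g)) (leaving_inRange g hg))
    rw [stateFlow_advance_pieceArc, stateFlow_pieceArc, cap_pieceArc, WithTop.coe_le_coe] at h1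
    rcases hstep.q_bound with ⟨h2, h3⟩ | ⟨h2, h3⟩
    · rw [← h3, h2] at h1
      push_cast at h1
      linarith [h1.2]
    · rw [h2] at h1
      rw [h2] at h3
      have h4 : (pieceFlow g (levels n (k g)) (leaving g n (k g)) : ℚ) - 1 = 0 := by
        exact_mod_cast h3
      push_cast at h1
      linarith [h1.1]
  rcases arc_cases l with ⟨g', p, hp, rfl⟩ | ⟨g', rfl⟩ | ⟨g', rfl⟩ | rfl | rfl
  · by_cases hgg : g' = g
    · subst hgg
      have hb := pieceFlow_bounds g' (coherent_levels (k := k g' + 1) hg) p hp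
      unfold IsTight at htight
      simp only [stateFlow_pieceArc, cap_pieceArc, WithTop.coe_inj, advance_self] at htight
      rcases hstep.diff p hp with h | h | h
      · have hc : (pieceFlow g' (levels n (k g')) p : ℚ) + 1 ≤ pieceCap p := by
          have := hb.2
          rw [h] at this
          exact_mod_cast this
        rw [h] at htight
        push_cast at htight
        rcases htight with ⟨-, ht⟩ | ⟨ht, -⟩
        · have h1 : θ = 1 := by linarith
          refine ⟨h1, Or.inl ((pieceArc_inj _ _).2 ⟨rfl, ?_⟩)⟩
          by_contra hne
          have h2 := (hstep.slack_after p hp hne).1 h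
          rw [h] at h2
          have h3 : (pieceFlow g' (levels n (k g')) p : ℚ) + 1 < pieceCap p := by exact_mod_cast h2
          rw [h1] at ht
          linarith
        · exact absurd ht (by linarith)
      · rw [h] at htight
        simp at htight
      · have hc : (0 : ℚ) ≤ (pieceFlow g' (levels n (k g')) p : ℚ) - 1 := by
          have := hb.1
          rw [h] at this
          exact_mod_cast this
        rw [h] at htight
        push_cast at htight
        rcases htight with ⟨ht, -⟩ | ⟨-, ht⟩
        · exact absurd ht (by linarith)
        · have h1 : θ = 1 := by linarith
          refine ⟨h1, Or.inl ((pieceArc_inj _ _).2 ⟨rfl, ?_⟩)⟩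
          by_contra hne
          have h2 := (hstep.slack_after p hp hne).2 h
          rw [h] at h2
          have h3 : (0 : ℚ) < (pieceFlow g' (levels n (k g')) p : ℚ) - 1 := by exact_mod_cast h2
          rw [h1] at ht
          linarith
    · unfold IsTight at htight
      simp [stateFlow_advance_of_ne k hgg] at htight
  · exfalso
    rcases htight with ⟨-, ht⟩ | ⟨ht, -⟩
    · exact WithTop.coe_ne_top ht
    · simp only [stateFlow, advance] at ht
      split_ifs at ht with h
      · rw [h] at ht
        push_cast at ht
        linarith
      · linarith
  · exfalso
    rcases htight with ⟨-, ht⟩ | ⟨ht, -⟩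
    · exact WithTop.coe_ne_top ht
    · simp only [stateFlow, advance] at ht
      split_ifs at ht with h
      · rw [h] at ht
        push_cast at ht
        linarith
      · linarith
  -- The arc from source to sink loses one unit per pivot and is empty only after all `2 * full n`
  -- units, when both gadgets are full. There it ties for leaving.
  · rcases htight with ⟨-, ht⟩ | ⟨-, ht⟩
    · exact absurd ht WithTop.coe_ne_top
    · simp only [stateFlow_advance_direct] at ht
      have h1 : (0 : ℚ) ≤ stateFlow k (.direct : Arc n) - 1 := by
        rw [← stateFlow_advance_direct k g]
        exact (stateFlow_bounds (a := a) (ε := ε) _ (advance_le hk hg) _).1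
      have h2 : θ = 1 := by linarith
      refine ⟨h2, Or.inr ⟨rfl, ?_⟩⟩
      have h3 : stateFlow (advance k g) (.direct : Arc n) = 0 := by
        rw [stateFlow_advance_direct]
        rw [h2] at ht
        linarith
      have h4 := advance_le hk hg
      simp only [stateFlow] at h3
      have h5 : advance k g .plus + advance k g .minus = 2 * full n := by
        have : ((advance k g .plus + advance k g .minus : ℕ) : ℚ) = (2 * full n : ℕ) := by
          push_cast
          linarith
        exact_mod_cast this
      have h6 := h4 .plus
      have h7 := h4 .minus
      rintro (_ | _) <;> omega
  · exfalso
    unfold IsTight at htight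
    simp [stateFlow] at htight

theorem mem_stateTree_advance (k : Side → ℕ) (g : Side) (hg : k g < full n) (b : Arc n) :
    InStateTree (advance k g) b ↔
      (b = pieceArc n g (entering g n (k g)) (entering_inRange g hg) ∨ InStateTree k b) ∧
        b ≠ pieceArc n g (leaving g n (k g)) (leaving_inRange g hg) := by
  have hstep := step_levels g hg
  rcases arc_cases b with ⟨g', p, hp, rfl⟩ | ⟨g', rfl⟩ | ⟨g', rfl⟩ | rfl | rfl
  · rw [inStateTree_pieceArc, inStateTree_pieceArc, pieceArc_inj, Ne, pieceArc_inj]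
    by_cases hgg : g' = g
    · subst hgg
      rw [advance, if_pos rfl]
      by_cases h1 : p = entering g' n (k g')
      · have h2 : entering g' n (k g') ≠ leaving g' n (k g') := fun h =>
          hstep.p_before (h ▸ hstep.q_before)
        rw [h1]
        simp [hstep.p_after, h2]
      · by_cases h2 : p = leaving g' n (k g')
        · rw [h2]
          simp [hstep.q_after]
        · simp [h1, h2, hstep.tree p hp h1 h2]
    · rw [advance, if_neg hgg]
      simp [hgg]
  · generalize entering g n (k g) = p, entering_inRange g hg = hp
    generalize leaving g n (k g) = q, leaving_inRange g hg = hq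
    cases p <;> cases q <;> simp [InStateTree, pieceArc]
  · generalize entering g n (k g) = p, entering_inRange g hg = hp
    generalize leaving g n (k g) = q, leaving_inRange g hg = hq
    cases p <;> cases q <;> simp [InStateTree, pieceArc]
  · generalize entering g n (k g) = p, entering_inRange g hg = hp
    generalize leaving g n (k g) = q, leaving_inRange g hg = hq
    cases p <;> cases q <;> simp [InStateTree, pieceArc]
  · generalize entering g n (k g) = p, entering_inRange g hg = hp
    generalize leaving g n (k g) = q, leaving_inRange g hg = hq
    cases p <;> cases q <;> simp [InStateTree, pieceArc]

end

end PartitionNetwork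

/-! ### Reachable states and the choices of Dantzig's rule -/

namespace PartitionNetwork

open Network

section

variable {n : ℕ} {a : Fin n → ℚ} {ε : ℚ}

/-- In the states that are reached, the units that have been sent are not more expensive than those
that are still to be sent. -/
structure IsReachable (a : Fin n → ℚ) (ε : ℚ) (k : Side → ℕ) : Prop where
  le : ∀ g, k g ≤ full n
  cost : ∀ g g' j, k g < full n → k g' = j + 1 →
    unitCost (extend a) ε g' n j ≤ unitCost (extend a) ε g n (k g)

/-- Otherwise a sent unit would be at least `1 / 3` dearer than an unsent one, up to errors of `1 /
10` each. -/
theorem IsReachable.le_add_one {k : Side → ℕ} (h : IsReachable a ε k)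
    (hs : IsSmall (extend a) ε n) (g g' : Side) : k g' ≤ k g + 1 := by
  by_contra! hlt
  obtain ⟨j, hj⟩ : ∃ j, k g' = j + 1 := ⟨k g' - 1, by omega⟩
  have h1 := h.le g'
  have h2 := h.cost g g' j (by omega) hj
  have h3 := (hs.unitCost_bounds g' (show j < full n by omega)).1
  have h4 := (hs.unitCost_bounds g (show k g < full n by omega)).2
  have h5 : (k g : ℚ) + 1 ≤ j := by
    have : k g + 1 ≤ j := by omega
    exact_mod_cast this
  linarith

/-- Units are sent in order of cost: the chosen one is the cheapest available, and its successor in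
the same gadget is dearer. -/
theorem isReachable_advance {k : Side → ℕ} (h : IsReachable a ε k) (hs : IsSmall (extend a) ε n)
    {g : Side} (hg : k g < full n)
    (hmin : ∀ g', k g' < full n →
      unitCost (extend a) ε g n (k g) ≤ unitCost (extend a) ε g' n (k g')) :
    IsReachable a ε (advance k g) := by
  refine ⟨advance_le h.le hg, fun g₁ g₂ j h1 h2 => ?_⟩
  unfold advance at h1 h2 ⊢
  by_cases c1 : g₁ = g
  · rw [if_pos c1] at h1 ⊢
    rw [c1]
    have h3 : unitCost (extend a) ε g n (k g) ≤ unitCost (extend a) ε g n (k g + 1) := by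
      have h4 := (hs.unitCost_bounds g hg).2
      have h5 := (hs.unitCost_bounds g h1).1
      push_cast at h5
      linarith
    refine le_trans ?_ h3
    by_cases c2 : g₂ = g
    · rw [if_pos c2] at h2
      rw [c2, show j = k g by omega]
    · rw [if_neg c2] at h2
      exact h.cost g g₂ j hg h2
  · rw [if_neg c1] at h1 ⊢
    by_cases c2 : g₂ = g
    · rw [if_pos c2] at h2
      rw [c2, show j = k g by omega]
      exact hmin g₁ h1
    · rw [if_neg c2] at h2
      exact h.cost g₁ g₂ j h1 h2

/-- The direct arc is dearer than every unit through a gadget, so rerouting always pays until both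
gadgets are full. -/
theorem full_add_one_le_gap (n : ℕ) : (full n : ℚ) / 3 + 1 ≤ 2 ^ (n + 1) := by
  have : (1 : ℚ) ≤ 2 ^ n := one_le_pow₀ (by norm_num)
  rw [full_cast, pow_succ]
  linarith

/-- The potentials for the tree of a configuration. -/
abbrev IsTreePotential (a : Fin n → ℚ) (k : Side → ℕ) (S T : Side → ℕ → ℚ) : Prop :=
  IsPotentialPair (extend a) n (2 ^ (n + 1)) (fun g => levels n (k g)) S T

/-- The potentials of the nodes for the tree of a configuration. -/
abbrev treePotential (ε : ℚ) (k : Side → ℕ) (S T : Side → ℕ → ℚ) : Node n → ℚ :=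
  nodePotential ε (2 ^ (n + 1)) (fun g => levels n (k g)) S T

theorem IsTreePotential.reducedCost_eq_zero {k : Side → ℕ} {S T : Side → ℕ → ℚ}
    (h : IsTreePotential a k S T) (b : Arc n) (hb : b ∈ (stateConfiguration n k).tree) :
    (network a ε).reducedCost (treePotential ε k S T) b = 0 := by
  by_cases hd : b = .direct
  · rw [hd, reducedCost_direct, sub_self]
  · exact reducedCost_of_inStateTree h (mem_stateConfiguration.1 hb) hd

theorem IsTreePotential.reducedCost_entering {k : Side → ℕ} {S T : Side → ℕ → ℚ}
    (h : IsTreePotential a k S T) {g : Side} (hg : k g < full n) :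
    (pieceDirection g (entering g n (k g))).sign *
      (network a ε).reducedCost (treePotential ε k S T)
        (pieceArc n g (entering g n (k g)) (entering_inRange g hg)) =
      unitCost (extend a) ε g n (k g) - 2 ^ (n + 1) := by
  have h1 := (residualCost_entering_leaving (extend a) ε g n (levels n (k g)) (S g) (T g)
    (coherent_levels hg.le) (h.pot g)).1 (by rwa [levels_self])
  rw [levels_self, h.source, h.sink, sub_zero] at h1
  rw [reducedCost_pieceArc]
  exact h1

theorem entering_not_mem {k : Side → ℕ} {g : Side} (hg : k g < full n) :
    pieceArc n g (entering g n (k g)) (entering_inRange g hg) ∉ (stateConfiguration n k).tree := by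
  rw [mem_stateConfiguration, inStateTree_pieceArc]
  exact (step_levels g hg).p_before

theorem entering_isResidual {k : Side → ℕ} (hk : ∀ g, k g ≤ full n) {g : Side} (hg : k g < full n) :
    (network a ε).IsResidual (stateFlow k)
      (pieceArc n g (entering g n (k g)) (entering_inRange g hg))
      (pieceDirection g (entering g n (k g))) :=
  (isResidual_pieceArc_iff hk _ (step_levels g hg).p_before _).2 rfl

/-- The pivots of a configuration, in terms of potentials. -/
theorem exists_of_isPivot {k : Side → ℕ} {S T : Side → ℕ → ℚ} (h : IsTreePotential a k S T)
    {b : Arc n} {τ : Configuration (Arc n)}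
    (hp : (network a ε).IsPivot (stateConfiguration n k) b τ) :
    ∃ d χ θ l, b ∉ (stateConfiguration n k).tree ∧ (network a ε).IsResidual (stateFlow k) b d ∧
      (network a ε).IsCycleFlow (stateConfiguration n k).tree b d χ ∧
      d.sign * (network a ε).reducedCost (treePotential ε k S T) b < 0 ∧
      (∀ c d', c ∉ (stateConfiguration n k).tree → (network a ε).IsResidual (stateFlow k) c d' →
        d.sign * (network a ε).reducedCost (treePotential ε k S T) b ≤
          d'.sign * (network a ε).reducedCost (treePotential ε k S T) c) ∧
      τ.flow = (fun b => stateFlow k b + θ * χ b) ∧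
      (∀ b, 0 ≤ τ.flow b ∧ (τ.flow b : WithTop ℚ) ≤ (network a ε).cap b) ∧
      (network a ε).IsTight τ.flow χ l ∧
      τ.tree = (insert b (stateConfiguration n k).tree).erase l := by
  obtain ⟨d, χ, θ, l, ⟨h1, h2, h3⟩, h4, h5, -, h7, h8, h9, h10⟩ := hp
  refine ⟨d, χ, θ, l, h1, h2, h3, ?_, fun c d' hc hd' => ?_, h7, h8, h9, h10⟩
  · rwa [h3.flowCost_eq _ h.reducedCost_eq_zero] at h4
  · obtain ⟨χ', hχ'⟩ := (network a ε).exists_isCycleFlow _ (stateTree_connected a ε k) c hc d'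
    have h6 := h5 c d' χ' hc hd' hχ'
    rwa [h3.flowCost_eq _ h.reducedCost_eq_zero, hχ'.flowCost_eq _ h.reducedCost_eq_zero] at h6

theorem IsReachable.exists_isPivot {k : Side → ℕ} (hk : IsReachable a ε k)
    (hs : IsSmall (extend a) ε n) {g : Side} (hg : k g < full n) :
    ∃ b τ, (network a ε).IsPivot (stateConfiguration n k) b τ := by
  obtain ⟨S, T, h⟩ := exists_isPotentialPair (extend a) n (2 ^ (n + 1)) fun g => levels n (k g)
  have h : IsTreePotential a k S T := h
  refine Network.exists_isPivot _ _ (stateTree_connected a ε k) (stateFlow_bounds k hk.le)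
    (stateTree_cap k) _ h.reducedCost_eq_zero _ _ (entering_not_mem hg)
    (entering_isResidual hk.le hg) ?_
  rw [h.reducedCost_entering hg]
  have h1 := (hs.unitCost_bounds g hg).2
  have h2 := full_add_one_le_gap n
  have h3 : (k g : ℚ) ≤ full n := by exact_mod_cast hg.le
  linarith

/-- If the arc `e` enters, then some signed sum vanishes up to `ε / 5`. -/
theorem IsReachable.exists_signs {k : Side → ℕ} (hk : IsReachable a ε k) (hn : 0 < n)
    (hs : IsSmall (extend a) ε n) {τ : Configuration (Arc n)}
    (hp : (network a ε).IsPivot (stateConfiguration n k) .e τ) :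
    ∃ s : ℕ → Bool, |∑ i ∈ Finset.range n, if s i then extend a i else -extend a i| ≤ ε / 5 := by
  obtain ⟨S, T, h⟩ := exists_isPotentialPair (extend a) n (2 ^ (n + 1)) fun g => levels n (k g)
  obtain ⟨d, χ, θ, l, -, h2, -, h4, h5, -⟩ := exists_of_isPivot (h : IsTreePotential a k S T) hp
  rw [isResidual_e_iff] at h2
  subst h2
  have hz := full_add_one_le_gap n
  rw [reducedCost_e] at h4
  have hle : ∀ g, k g < full n →
      middleCost ε (fun g => levels n (k g)) S T ≤ unitCost (extend a) ε g n (k g) - 2 ^ (n + 1) := by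
    intro g hg
    have h6 := h5 _ _ (entering_not_mem hg) (entering_isResidual hk.le hg)
    rw [(show IsTreePotential a k S T from h).reducedCost_entering hg, reducedCost_e] at h6
    simpa [Direction.sign] using h6
  have h4 : middleCost ε (fun g => levels n (k g)) S T < 0 := by
    simpa [Direction.sign] using h4
  -- If one gadget were ahead, the next exchange of the other would beat `e`; so the states agree.
  have key : ∀ g g', g ≠ g' → k g' ≠ k g + 1 := by
    intro g g' hgg hne
    have hg : k g < full n := by have := hk.le g'; omega
    have e : (fun g => levels n (k g)) =
        fun g₁ => if g₁ = g then levels n (k g) else levels n (k g') := by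
      funext g₁
      split_ifs with c
      · rw [c]
      · have : g₁ = g' := by
          revert c hgg
          cases g₁ <;> cases g <;> cases g' <;> simp
        rw [this]
    have h7 := hle g hg
    rw [e] at h h7
    have h8 := unitCost_lt_middleCost hs hz _ _ (coherent_levels (hk.le g))
      (coherent_levels (hk.le g')) (by simp only [levels_self, hne]) g h
    rw [levels_self] at h8
    linarith
  have h1 := hk.le_add_one hs .plus .minus
  have h2 := hk.le_add_one hs .minus .plus
  have h3 := key .plus .minus (by simp)
  have h6 := key .minus .plus (by simp)
  have heq : k .minus = k .plus := by omega
  have e : (fun g => levels n (k g)) = fun _ => levels n (k .plus) := by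
    funext g
    cases g <;> simp [heq]
  have heq' : ∀ g, k g = k .plus := by
    intro g
    cases g
    · rfl
    · exact heq
  rw [e] at h hle h4
  have hcoh := coherent_levels (hk.le .plus)
  by_cases hfull : k .plus < full n
  · refine exists_signs_of_middleCost_le hs hz h hcoh (by rwa [levels_self]) fun g => ?_
    have h7 := hle g (by rwa [heq'])
    rw [levels_self]
    rwa [heq' g] at h7
  · have h7 := hk.le .plus
    rw [middleCost_full hn h hcoh (by rw [levels_self]; omega)] at h4
    have h8 := full_pos n
    have h9 : ((full n - 1 : ℕ) : ℚ) = full n - 1 := by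
      rw [Nat.cast_sub h8]
      simp
    have b1 := (hs.unitCost_bounds .plus (show full n - 1 < full n by omega)).2
    have b2 := (hs.unitCost_bounds .minus (show full n - 1 < full n by omega)).2
    rw [h9] at b1 b2
    exfalso
    linarith [hs.le]

/-- A pivot that does not use the arc `e` advances one of the gadgets. -/
theorem IsReachable.exists_advance {k : Side → ℕ} (hk : IsReachable a ε k) (hn : 0 < n)
    (hs : IsSmall (extend a) ε n) {S T : Side → ℕ → ℚ} (h : IsTreePotential a k S T) {b : Arc n}
    {τ : Configuration (Arc n)} (hp : (network a ε).IsPivot (stateConfiguration n k) b τ)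
    (hb : b ≠ .e) :
    ∃ g, ∃ hg : k g < full n, IsReachable a ε (advance k g) ∧
      unitCost (extend a) ε g n (k g) - 2 ^ (n + 1) ≤
        middleCost ε (fun g => levels n (k g)) S T ∧
      τ.flow = stateFlow (advance k g) ∧
      (τ = stateConfiguration n (advance k g) ∨ ((∀ g', advance k g g' = full n) ∧
        ∀ c, c ∈ τ.tree ↔ c ≠ .direct ∧ (InStateTree (advance k g) c ∨
          c = pieceArc n g (leaving g n (k g)) (leaving_inRange g hg)))) := by
  obtain ⟨d, χ, θ, l, h1, h2, h3, h4, h5, h7, h8, h9, h10⟩ := exists_of_isPivot h hp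
  have hz := full_add_one_le_gap n
  have hle : ∀ g, k g < full n →
      d.sign * (network a ε).reducedCost (treePotential ε k S T) b ≤
        unitCost (extend a) ε g n (k g) - 2 ^ (n + 1) := by
    intro g hg
    rw [← h.reducedCost_entering hg]
    exact h5 _ _ (entering_not_mem hg) (entering_isResidual hk.le hg)
  have h1' := h1
  rw [mem_stateConfiguration] at h1'
  rcases arc_cases b with ⟨g, p, hpr, rfl⟩ | ⟨g, rfl⟩ | ⟨g, rfl⟩ | rfl | rfl
  · rw [inStateTree_pieceArc] at h1'
    rw [isResidual_pieceArc_iff hk.le hpr h1'] at h2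
    have hrc : d.sign * (network a ε).reducedCost (treePotential ε k S T) (pieceArc n g p hpr) =
        residualCost (extend a) ε g (levels n (k g)) (S g) (T g) p := by
      rw [reducedCost_pieceArc, h2]
      rfl
    simp only [hrc] at h4 hle
    have hcoh := coherent_levels (hk.le g)
    have hcases :=
      residualCost_cases hs.nonneg hs.pos.le g n hs.sum_le _ _ _ hcoh (h.pot g) p hpr h1'
    rw [levels_self, h.source, h.sink] at hcases
    -- An arc worse by `1 / 5` than the next exchange contradicts minimality, and undoing a unit has
    -- positive cost at the gap `2 ^ (n + 1)`.
    have hent : ∃ hg : k g < full n, p = entering g n (k g) := by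
      rcases hcases with hc | ⟨hc, hc'⟩ | ⟨j, hc, hc'⟩
      · linarith
      · refine ⟨hc, hc'.resolve_left fun hc' => ?_⟩
        linarith [hle g hc]
      · exfalso
        have hj : j < full n := by have := hk.le g; omega
        have b1 := (hs.unitCost_bounds g hj).2
        have b2 : (j : ℚ) + 1 ≤ full n := by exact_mod_cast hj
        rcases hc' with hc' | hc'
        · linarith
        · have hlv := (residualCost_entering_leaving (extend a) ε g n _ _ _ hcoh (h.pot g)).2 j
            (by rw [levels_self, hc])
          rw [h.source, h.sink, ← hc'] at hlv
          linarith
    obtain ⟨hg, rfl⟩ := hent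
    have hu : residualCost (extend a) ε g (levels n (k g)) (S g) (T g) (entering g n (k g)) =
        unitCost (extend a) ε g n (k g) - 2 ^ (n + 1) := by
      rw [← hrc, h2]
      exact h.reducedCost_entering hg
    rw [h2] at h3
    have hχ := isCycleFlow_unique a ε k h3 (isCycleFlow_advance hn k hk.le g hg)
    subst hχ
    rw [h7] at h8 h9
    obtain ⟨rfl, hl⟩ := advance_of_isTight k hk.le g hg h8 h9
    have hflow : τ.flow = stateFlow (advance k g) := by
      rw [h7]
      funext c
      ring
    have he := h5 .e .forward (by simp [mem_stateConfiguration, InStateTree])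
      ((isResidual_e_iff k _).2 rfl)
    rw [hrc, hu, reducedCost_e, Direction.sign, one_mul] at he
    refine ⟨g, hg, isReachable_advance hk hs hg fun g' hg' => ?_, he, hflow, ?_⟩
    · have := hle g' hg'
      rw [hu] at this
      linarith
    · rcases hl with rfl | ⟨rfl, hfull⟩
      · left
        have htree : τ.tree = (stateConfiguration n (advance k g)).tree := by
          rw [h10]
          ext c
          rw [mem_stateConfiguration, mem_stateTree_advance k g hg, Finset.mem_erase,
            Finset.mem_insert, mem_stateConfiguration, and_comm]
        cases τ
        simp only at hflow htree
        rw [hflow, htree]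
        rfl
      · right
        refine ⟨hfull, fun c => ?_⟩
        rw [h10, Finset.mem_erase, Finset.mem_insert, mem_stateConfiguration,
          mem_stateTree_advance k g hg]
        have hq : InStateTree k (pieceArc n g (leaving g n (k g)) (leaving_inRange g hg)) :=
          (inStateTree_pieceArc _ _ _ _).2 (step_levels g hg).q_before
        by_cases hc : c = pieceArc n g (leaving g n (k g)) (leaving_inRange g hg)
        · rw [hc]
          simp [hq]
        · simp [hc]
  · exact absurd trivial h1'
  · exact absurd trivial h1'
  · exact absurd trivial h1'
  · exact absurd rfl hb

/-- No pivot is possible when both gadgets are full, if the potentials of the tree have a suitable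
gap between source and sink. -/
theorem not_isPivot_of_full (hn : 0 < n) (hs : IsSmall (extend a) ε n) {k : Side → ℕ}
    (hk : ∀ g, k g = full n) {σ : Configuration (Arc n)} (hflow : σ.flow = stateFlow k)
    (htree : ∀ c, c ≠ .direct → InStateTree k c → c ∈ σ.tree) {z : ℚ} {S T : Side → ℕ → ℚ}
    (h : IsPotentialPair (extend a) n z (fun g => levels n (k g)) S T)
    (hzero : ∀ b ∈ σ.tree,
      (network a ε).reducedCost (nodePotential ε z (fun g => levels n (k g)) S T) b = 0)
    (hz : z ≤ 2 ^ (n + 1)) (hzu : ∀ g, unitCost (extend a) ε g n (full n - 1) ≤ z)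
    (hze : ε / 5 ≤ z - (unitCost (extend a) ε .plus n (full n - 1) +
      unitCost (extend a) ε .minus n (full n - 1)) / 2)
    (b : Arc n) (τ : Configuration (Arc n)) : ¬ (network a ε).IsPivot σ b τ := by
  rintro ⟨d, χ, θ, l, ⟨h1, h2, h3⟩, h4, -⟩
  rw [h3.flowCost_eq _ hzero] at h4
  rw [hflow] at h2
  have hkle : ∀ g, k g ≤ full n := fun g => (hk g).le
  rcases arc_cases b with ⟨g, p, hpr, rfl⟩ | ⟨g, rfl⟩ | ⟨g, rfl⟩ | rfl | rfl
  · have h1' : ¬ PieceInTree g (levels n (k g)) p := fun hc =>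
      h1 (htree _ (by cases p <;> simp [pieceArc]) ((inStateTree_pieceArc _ _ _ _).2 hc))
    rw [isResidual_pieceArc_iff hkle hpr h1'] at h2
    rw [h2, reducedCost_pieceArc] at h4
    have h4 : residualCost (extend a) ε g (levels n (k g)) (S g) (T g) p < 0 := h4
    have hcoh := coherent_levels (hkle g)
    rcases residualCost_cases hs.nonneg hs.pos.le g n hs.sum_le _ _ _ hcoh (h.pot g) p hpr h1' with
      hc | ⟨hc, -⟩ | ⟨j, hc, hc'⟩
    · linarith
    · rw [levels_self, hk] at hc
      exact lt_irrefl _ hc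
    · have hj : full n - 1 = j := by
        rw [levels_self, hk] at hc
        omega
      have h5 := hzu g
      rw [hj] at h5
      rcases hc' with hc' | hc'
      · rw [h.source, h.sink] at hc'
        linarith
      · have h6 := (residualCost_entering_leaving (extend a) ε g n _ _ _ hcoh (h.pot g)).2 j hc
        rw [h.source, h.sink, ← hc'] at h6
        linarith
  · exact h1 (htree _ (by simp) trivial)
  · exact h1 (htree _ (by simp) trivial)
  · rw [reducedCost_direct] at h4
    cases d
    · simp only [Direction.sign] at h4
      linarith
    · simp only [IsResidual, stateFlow, hk] at h2
      linarith
  · rw [isResidual_e_iff] at h2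
    rw [h2, reducedCost_e] at h4
    have e : (fun g => levels n (k g)) = fun _ => levels n (full n) := by
      funext g
      rw [hk]
    rw [e] at h h4
    rw [middleCost_full hn h (coherent_levels le_rfl) (levels_self _ _)] at h4
    simp only [Direction.sign] at h4
    linarith

end

end PartitionNetwork

namespace PartitionNetwork

open Network

/-! ### Signed sums and partitions -/

section

variable {n : ℕ} {a : Fin n → ℚ} {ε : ℚ}

theorem sum_extend (a : Fin n → ℚ) : ∑ i ∈ Finset.range n, extend a i = ∑ i, a i := by
  rw [← Fin.sum_univ_eq_sum_range]
  exact Finset.sum_congr rfl fun i _ => extend_val a i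

theorem signedSum_eq (a : Fin n → ℚ) (s : ℕ → Bool) :
    ∑ i ∈ Finset.range n, (if s i then extend a i else -extend a i) =
      ∑ i ∈ Finset.univ.filter (fun i : Fin n => s i = true), a i -
        ∑ i ∈ (Finset.univ.filter fun i : Fin n => s i = true)ᶜ, a i := by
  rw [← Fin.sum_univ_eq_sum_range (fun i => if s i then extend a i else -extend a i), Finset.sum_ite,
    Finset.compl_filter, Finset.sum_neg_distrib, ← sub_eq_add_neg]
  simp only [extend_val]

theorem hasPartition_of_signedSum_eq_zero {s : ℕ → Bool}
    (h : ∑ i ∈ Finset.range n, (if s i then extend a i else -extend a i) = 0) : HasPartition a := by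
  rw [signedSum_eq] at h
  exact ⟨_, sub_eq_zero.1 h⟩

theorem exists_signedSum_eq_zero_of_hasPartition (h : HasPartition a) :
    ∃ s : ℕ → Bool, ∑ i ∈ Finset.range n, (if s i then extend a i else -extend a i) = 0 := by
  classical
  obtain ⟨I, hI⟩ := h
  refine ⟨fun i => decide (∃ h : i < n, (⟨i, h⟩ : Fin n) ∈ I), ?_⟩
  have h1 : (Finset.univ.filter fun i : Fin n =>
      decide (∃ h : (i : ℕ) < n, (⟨i, h⟩ : Fin n) ∈ I) = true) = I := by
    ext i
    simp
  rw [signedSum_eq, h1, hI, sub_self]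

/-- The signed sum is an integer multiple of `ε`, hence zero as soon as it is smaller than `ε`. -/
theorem hasPartition_of_abs_signedSum_le (hε : 0 < ε) (ha : ∀ i, ∃ m : ℕ, a i = m * ε)
    {s : ℕ → Bool}
    (h : |∑ i ∈ Finset.range n, (if s i then extend a i else -extend a i)| ≤ ε / 5) :
    HasPartition a := by
  refine hasPartition_of_signedSum_eq_zero (s := s) ?_
  choose m hm using ha
  obtain ⟨z, hz⟩ : ∃ z : ℤ,
      ∑ i ∈ Finset.range n, (if s i then extend a i else -extend a i) = z * ε := by
    refine ⟨∑ i : Fin n, if s i then (m i : ℤ) else -m i, ?_⟩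
    rw [← Fin.sum_univ_eq_sum_range (fun i => if s i then extend a i else -extend a i)]
    push_cast
    rw [Finset.sum_mul]
    refine Finset.sum_congr rfl fun i _ => ?_
    rw [extend_val, hm]
    split_ifs <;> ring
  rw [hz] at h ⊢
  rw [abs_mul, abs_of_pos hε] at h
  have h1 : |(z : ℚ)| < 1 := by
    by_contra! hge
    nlinarith
  have h2 : z = 0 := by
    rw [← Int.cast_abs] at h1
    exact Int.abs_lt_one_iff.1 (by exact_mod_cast h1)
  simp [h2]

/-! ### Executions -/

/-- Without a partition no pivot is possible after the arc from source to sink has left the tree. -/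
theorem IsReachable.not_isPivot_of_last (hn : 0 < n) (hs : IsSmall (extend a) ε n)
    (hmult : ∀ i, ∃ m : ℕ, a i = m * ε) (hpart : ¬ HasPartition a) {k : Side → ℕ}
    (hk : IsReachable a ε k) {g : Side} (hg : k g < full n) {σ : Configuration (Arc n)}
    (hflow : σ.flow = stateFlow (advance k g)) (hfull : ∀ g', advance k g g' = full n)
    (htree : ∀ c, c ∈ σ.tree ↔ c ≠ .direct ∧ (InStateTree (advance k g) c ∨
      c = pieceArc n g (leaving g n (k g)) (leaving_inRange g hg)))
    (b : Arc n) (τ : Configuration (Arc n)) : ¬ (network a ε).IsPivot σ b τ := by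
  have hkg : k g + 1 = full n := by rw [← hfull g, advance_self]
  have hkg' : full n - 1 = k g := by omega
  -- The last exchanged arc stays in the tree in place of the direct arc. Its zero reduced cost
  -- forces the gap to equal the cost of the last unit.
  obtain ⟨S, T, h⟩ := exists_isPotentialPair (extend a) n (unitCost (extend a) ε g n (k g))
    fun g' => levels n (advance k g g')
  have hother : ∀ g', g' ≠ g → k g' = full n := by
    intro g' hne
    rw [← hfull g', advance, if_neg hne]
  have hu : ∀ g', unitCost (extend a) ε g' n (k g) ≤ unitCost (extend a) ε g n (k g) := by
    intro g'
    by_cases hne : g' = g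
    · rw [hne]
    · exact hk.cost g g' _ hg (by rw [hother g' hne, hkg])
  refine not_isPivot_of_full hn hs hfull hflow (fun c hc1 hc2 => (htree c).2 ⟨hc1, Or.inl hc2⟩) h
    (fun c hc => ?_) ?_ (fun g' => by rw [hkg']; exact hu g') ?_ b τ
  · obtain ⟨hc1, hc2⟩ := (htree c).1 hc
    rcases hc2 with hc2 | rfl
    · exact reducedCost_of_inStateTree h hc2 hc1
    · have h1 := (residualCost_entering_leaving (extend a) ε g n _ _ _
        (coherent_levels (hfull g).le) (h.pot g)).2 (k g) (by rw [levels_self, advance_self])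
      rw [h.source, h.sink, sub_zero, sub_self, residualCost] at h1
      rw [reducedCost_pieceArc]
      rcases mul_eq_zero.1 h1 with h2 | h2
      · cases hd : pieceDirection g (leaving g n (k g)) <;> rw [hd] at h2 <;>
          norm_num [Direction.sign] at h2
      · exact h2
  · have h1 := (hs.unitCost_bounds g hg).2
    have h2 := full_add_one_le_gap n
    have h3 : (k g : ℚ) ≤ full n := by exact_mod_cast hg.le
    linarith
  -- The last exchange is at `c`, and the gap is the larger of the two last unit costs. It exceeds
  -- their average by `|w|`, which is more than `ε / 5` without a partition, so `e` does not pay.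
  · obtain ⟨m, rfl⟩ : ∃ m, n = m + 1 := ⟨n - 1, by omega⟩
    obtain ⟨j, hj, hx⟩ := exchange_last m
    have hjk : j = k g := by omega
    rw [hjk] at hx
    obtain ⟨s, hw⟩ := exists_signs_of_center (extend a) ε (m + 1) (k g) hg hx
    have hnot : ¬ |∑ i ∈ Finset.range (m + 1), (if s i then extend a i else -extend a i)| ≤ ε / 5 :=
      fun hc => hpart (hasPartition_of_abs_signedSum_le hs.pos hmult hc)
    rw [hkg']
    have h1 := hu .plus
    have h2 := hu .minus
    rw [hw, hw] at h1 h2 ⊢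
    rw [hw]
    by_contra! hlt
    refine hnot (abs_le.2 ?_)
    cases g <;> simp only [Side.sign] at h1 h2 hlt <;> constructor <;> linarith

/-- The second entry is a positive multiple of `ε`, which bounds `ε` by the sum. With one level
nothing bounds `ε`. -/
theorem isSmall_extend (hn : 1 < n) (ha_nonneg : ∀ i, 0 ≤ a i)
    (ha_pos : ∀ i : Fin n, (i : ℕ) ≠ 0 → 0 < a i) (ha_sum : ∑ i, a i < 1 / 12) (hε : 0 < ε)
    (ha_mult : ∀ i, ∃ m : ℕ, a i = m * ε) : IsSmall (extend a) ε n where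
  nonneg i := by
    unfold extend
    split_ifs
    · exact ha_nonneg _
    · exact le_rfl
  pos := hε
  le := by
    obtain ⟨m, hm⟩ := ha_mult ⟨1, hn⟩
    have h1 := ha_pos ⟨1, hn⟩ (by simp)
    have h2 := Finset.single_le_sum (fun i _ => ha_nonneg i) (Finset.mem_univ (⟨1, hn⟩ : Fin n))
    have h3 : (1 : ℚ) ≤ m := by
      have : m ≠ 0 := by
        rintro rfl
        simp [hm] at h1
      exact_mod_cast Nat.one_le_iff_ne_zero.2 this
    nlinarith
  sum := by rwa [sum_extend]

theorem hasPartition_of_enter_e (hn : 0 < n) (hs : IsSmall (extend a) ε n)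
    (hmult : ∀ i, ∃ m : ℕ, a i = m * ε) {σ : ℕ → Configuration (Arc n)}
    {enter : ℕ → Option (Arc n)} (hexec : (network a ε).IsExecution (initial n) σ enter)
    (he : ∃ t, enter t = some .e) : HasPartition a := by
  by_contra hpart
  have hne : ∀ (k : Side → ℕ) τ, IsReachable a ε k →
      ¬ (network a ε).IsPivot (stateConfiguration n k) .e τ := by
    intro k τ hk hp
    obtain ⟨s, hs'⟩ := hk.exists_signs hn hs hp
    exact hpart (hasPartition_of_abs_signedSum_le hs.pos hmult hs')
  -- The second alternative covers termination with the direct arc out of the tree.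
  have key : ∀ t, (∃ k, IsReachable a ε k ∧ σ t = stateConfiguration n k) ∨
      ∀ b τ, ¬ (network a ε).IsPivot (σ t) b τ := by
    intro t
    induction t with
    | zero =>
      left
      refine ⟨fun _ => 0, ⟨fun g => Nat.zero_le _, fun g g' j _ hj => ?_⟩, ?_⟩
      · simp at hj
      · rw [hexec.start, initial_eq hn]
    | succ t ih =>
      rcases hexec.step t with ⟨b, -, hp⟩ | ⟨-, -, h⟩
      · rcases ih with ⟨k, hk, hσ⟩ | ih
        · rw [hσ] at hp
          have hb : b ≠ .e := by
            rintro rfl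
            exact hne k _ hk hp
          obtain ⟨S, T, h⟩ :=
            exists_isPotentialPair (extend a) n (2 ^ (n + 1)) fun g => levels n (k g)
          obtain ⟨g, hg, hk', -, hflow, hτ⟩ := hk.exists_advance hn hs h hp hb
          rcases hτ with hτ | ⟨hfull, htree⟩
          · exact Or.inl ⟨_, hk', hτ⟩
          · exact Or.inr (hk.not_isPivot_of_last hn hs hmult hpart hg hflow hfull htree)
        · exact absurd hp (ih b _)
      · rw [h]
        exact ih
  obtain ⟨t, ht⟩ := he
  rcases hexec.step t with ⟨b, hb, hp⟩ | ⟨h, -⟩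
  · rw [ht, Option.some.injEq] at hb
    subst hb
    rcases key t with ⟨k, hk, hσ⟩ | h
    · rw [hσ] at hp
      exact hne k _ hk hp
    · exact h _ _ hp
  · rw [ht] at h
    simp at h

/-- If `e` never entered, each of the first `2 * m` pivots would send one unit, where `m` is the
state with signed sum zero. -/
theorem enter_e_of_hasPartition (hn : 0 < n) (hs : IsSmall (extend a) ε n) (hpart : HasPartition a)
    {σ : ℕ → Configuration (Arc n)} {enter : ℕ → Option (Arc n)}
    (hexec : (network a ε).IsExecution (initial n) σ enter) : ∃ t, enter t = some .e := by
  by_contra! hne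
  obtain ⟨s, hs0⟩ := exists_signedSum_eq_zero_of_hasPartition hpart
  obtain ⟨m, hm, hx, hw⟩ := exists_center_of_signs (extend a) ε n s
  rw [hs0] at hw
  have hstep : ∀ t (k : Side → ℕ), IsReachable a ε k → σ t = stateConfiguration n k →
      (∃ g, k g < full n) → ∃ b, b ≠ .e ∧
        (network a ε).IsPivot (stateConfiguration n k) b (σ (t + 1)) := by
    rintro t k hk hσ ⟨g, hg⟩
    rcases hexec.step t with ⟨b, hb, hp⟩ | ⟨-, h, -⟩
    · refine ⟨b, ?_, hσ ▸ hp⟩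
      rintro rfl
      exact hne t hb
    · obtain ⟨b, τ, hp⟩ := hk.exists_isPivot hs hg
      rw [hσ] at h
      exact absurd hp (h b τ)
  have key : ∀ t ≤ 2 * m, ∃ k, IsReachable a ε k ∧ σ t = stateConfiguration n k ∧
      k .plus + k .minus = t := by
    intro t
    induction t with
    | zero =>
      refine fun _ => ⟨fun _ => 0, ⟨fun g => Nat.zero_le _, fun g g' j _ hj => ?_⟩, ?_, rfl⟩
      · simp at hj
      · rw [hexec.start, initial_eq hn]
    | succ t ih =>
      intro ht
      obtain ⟨k, hk, hσ, hsum⟩ := ih (by omega)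
      have hex : ∃ g, k g < full n := by
        by_contra! hge
        have h1 := hge .plus
        have h2 := hge .minus
        omega
      obtain ⟨b, hb, hp⟩ := hstep t k hk hσ hex
      obtain ⟨S, T, h⟩ := exists_isPotentialPair (extend a) n (2 ^ (n + 1)) fun g => levels n (k g)
      obtain ⟨g, hg, hk', -, -, hτ⟩ := hk.exists_advance hn hs h hp hb
      have hsum' : advance k g .plus + advance k g .minus = t + 1 := by
        cases g <;> simp [advance] <;> omega
      rcases hτ with hτ | ⟨hfull, -⟩
      · exact ⟨_, hk', hτ, hsum'⟩
      · have h1 := hfull .plus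
        have h2 := hfull .minus
        omega
  obtain ⟨k, hk, hσ, hsum⟩ := key _ le_rfl
  have h1 := hk.le_add_one hs .plus .minus
  have h2 := hk.le_add_one hs .minus .plus
  -- The states sum to `2 * m` and differ by at most one, so parity makes them equal.
  have hkm : ∀ g, k g = m := by
    rintro (_ | _) <;> omega
  obtain ⟨b, hb, hp⟩ := hstep _ k hk hσ ⟨.plus, by rwa [hkm]⟩
  obtain ⟨S, T, h⟩ := exists_isPotentialPair (extend a) n (2 ^ (n + 1)) fun g => levels n (k g)
  obtain ⟨g, -, -, hle, -⟩ := hk.exists_advance hn hs h hp hb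
  have e : (fun g => levels n (k g)) = fun _ => levels n m := by
    funext g
    rw [hkm]
  rw [e] at h hle
  have hmid := middleCost_center (ε := ε) (w := 0) h (coherent_levels hm.le) (by rwa [levels_self])
    (by rwa [levels_self]) (by rwa [levels_self])
  rw [hmid, hkm, hw, levels_self] at hle
  -- With `w = 0` the next exchange costs `ε / 5` more than `e`, contrary to its minimality.
  linarith [hs.pos]

/-- With only one level, `e` enters the basis in the first iteration. -/
theorem enter_e_of_one {a : Fin 1 → ℚ} (ha : a 0 = 0) (hε : 0 < ε)
    {σ : ℕ → Configuration (Arc 1)} {enter : ℕ → Option (Arc 1)}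
    (hexec : (network a ε).IsExecution (initial 1) σ enter) : enter 0 = some .e := by
  have hσ : σ 0 = stateConfiguration 1 fun _ => 0 := by rw [hexec.start, initial_eq one_pos]
  obtain ⟨S, T, h⟩ := exists_isPotentialPair (extend a) 1 (2 ^ (1 + 1)) fun _ => levels 1 0
  have h : IsTreePotential a (fun _ => 0) S T := h
  have ha0 : extend a 0 = 0 := by rw [extend_of_lt a one_pos]; exact ha
  have hS : ∀ g, S g 0 = 0 := by
    intro g
    rw [(h.pot g).left 0 one_pos, levels_zero, if_pos (Nat.zero_le _), ha0, zero_add, h.source]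
    simp
  have hT : ∀ g, T g 0 = 4 := by
    intro g
    rw [(h.pot g).right 0 one_pos, levels_zero, if_pos (Nat.zero_le _), ha0, zero_add, h.sink]
    norm_num
  have hS1 := h.source
  have hT1 := h.sink
  have hmid : (network a ε).reducedCost (treePotential ε (fun _ => 0) S T) .e = -4 := by
    rw [reducedCost_e]
    simp [middleCost, centerPotential, levels_zero, hS, hT]
  have hmem : (.e : Arc 1) ∉ (stateConfiguration 1 fun _ => 0).tree := by
    simp [mem_stateConfiguration, InStateTree]
  have hres : (network a ε).IsResidual (stateFlow fun _ => 0) .e .forward :=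
    (isResidual_e_iff _ _).2 rfl
  have hbase : ∀ g : Side, (fun _ => 0 : Side → ℕ) g ≤ full 1 := fun _ => Nat.zero_le _
  rcases hexec.step 0 with ⟨b, hb, hp⟩ | ⟨-, hno, -⟩
  · rw [hσ] at hp
    obtain ⟨d, -, -, -, h1, h2, -, -, h5, -⟩ := exists_of_isPivot h hp
    have h6 := h5 .e .forward hmem hres
    rw [hmid] at h6
    rw [mem_stateConfiguration] at h1
    rcases arc_cases b with ⟨g, p, hpr, rfl⟩ | ⟨g, rfl⟩ | ⟨g, rfl⟩ | rfl | rfl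
    · exfalso
      rw [inStateTree_pieceArc] at h1
      rw [isResidual_pieceArc_iff hbase hpr h1] at h2
      rw [h2, reducedCost_pieceArc] at h6
      cases p
      case sc =>
        cases g <;> simp [PieceInTree, levels_zero] at h1
        simp [pieceDirection, Direction.sign, pieceReduced, pieceCost, centerPotential, levels_zero,
          hS, hT] at h6
        linarith
      case ct =>
        cases g <;> simp [PieceInTree, levels_zero] at h1
        simp [pieceDirection, Direction.sign, pieceReduced, pieceCost, centerPotential, levels_zero,
          hS, hT] at h6
        linarith
      all_goals
        simp only [Piece.InRange, Nat.lt_one_iff] at hpr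
        subst hpr
        simp [PieceInTree, levels_zero] at h1
      all_goals
        norm_num [pieceDirection, Direction.sign, pieceReduced, pieceCost, hS, hT, hS1, hT1, ha0]
          at h6
    · exact absurd trivial h1
    · exact absurd trivial h1
    · exact absurd trivial h1
    · exact hb
  · exfalso
    rw [hσ] at hno
    obtain ⟨b, τ, hp⟩ := Network.exists_isPivot (network a ε) _ (stateTree_connected a ε _)
      (stateFlow_bounds _ hbase) (stateTree_cap _) _ h.reducedCost_eq_zero .e .forward hmem hres (by
        rw [hmid]
        norm_num [Direction.sign])
    exact hno b τ hp

end

end PartitionNetwork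

/-- One level is treated apart, since `ε` may then be large; the empty set is a partition because
the only entry is zero. -/
theorem lemma4 (n : ℕ) (hn : 0 < n) (a : Fin n → ℚ) (ε : ℚ)
    (ha_first : a ⟨0, hn⟩ = 0)
    (ha_pos : ∀ i : Fin n, (i : ℕ) ≠ 0 → 0 < a i)
    (ha_sum : ∑ i, a i < 1 / 12)
    (hε : 0 < ε)
    (ha_mult : ∀ i, ∃ m : ℕ, a i = m * ε)
    (σ : ℕ → Network.Configuration (PartitionNetwork.Arc n))
    (enter : ℕ → Option (PartitionNetwork.Arc n))
    (hexec : (PartitionNetwork.network a ε).IsExecution (PartitionNetwork.initial n) σ enter) :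
    (∃ k, enter k = some PartitionNetwork.Arc.e) ↔ HasPartition a := by
  rcases Nat.lt_or_ge 1 n with h | h
  · have hs := PartitionNetwork.isSmall_extend h (fun i => by
      by_cases hi : (i : ℕ) = 0
      · rw [show i = ⟨0, hn⟩ from Fin.ext hi, ha_first]
      · exact (ha_pos i hi).le) ha_pos ha_sum hε ha_mult
    exact ⟨PartitionNetwork.hasPartition_of_enter_e hn hs ha_mult hexec,
      fun hp => PartitionNetwork.enter_e_of_hasPartition hn hs hp hexec⟩
  · obtain rfl : n = 1 := by omega
    refine ⟨fun _ => ⟨∅, ?_⟩, fun _ => ⟨0, PartitionNetwork.enter_e_of_one ha_first hε hexec⟩⟩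
    simpa using ha_first.symm
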